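/- Let $d\in\{2,3\}$, and let $c_0>0$, $\omega>0$, $\rho_0>0$ and $\rho_1>\rho_0$ be constants. Write $\mathbb{R}_+=[0,\infty)$, $\mathbb{S}^{d-1}=\{x\in\mathbb{R}^d:|x|=1\}$ and $\mathbb{B}_{r}=\{x\in\mathbb{R}^d:|x|<r\}$, and let $\Omega\Subset\mathbb{B}_{\rho_0}$, meaning that $\Omega\subseteq\mathbb{B}_{\rho_0-\epsilon}$ for some $\epsilon>0$. Let $A\in C^5(\mathbb{R}_+)$ and $Y\in C^5(\mathbb{S}^{d-1})$ be complex-valued functions such that $A(\rho)=0$ for $\rho\in[0,\rho_0]$ and $$A(\rho)=\frac{e^{i\frac{\omega}{c_0}\rho}}{\rho^{\frac{d-1}{2}}}\qquad\text{for }\rho>\rho_1 .$$ Define, for $x\in\mathbb{R}^d$ (both functions being $0$ near $x=0$), $$v_0(x)=A(|x|)\,Y\!\left(\tfrac{x}{|x|}\right),\qquad v_1(x)=-c_0\,\partial_{|x|}v_0(x)=-c_0A'(|x|)\,Y\!\left(\tfrac{x}{|x|}\right).$$ Then there exists a constant $C>0$, depending only on the data above, such that every classical solution $v\in C^2(\mathbb{R}^d\times[0,\infty))$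 of $$\partial_t^2v-c_0^2\Delta v=0\ \text{ in }\mathbb{R}^d\times(0,\infty),\qquad v(x,0)=v_0(x),\quad \partial_tv(x,0)=v_1(x)\ \text{ for }x\in\mathbb{R}^d,$$ belongs to $C^3(\mathbb{R}^d\times[0,\infty))$ and satisfies, for all $x\in\Omega$ and $t\ge 0$, $$|v(x,t)|+|\nabla v(x,t)|+|\partial_tv(x,t)|+|\Delta v(x,t)|+|\partial_t\nabla v(x,t)|+|\partial_t\Delta v(x,t)|\le\frac{C}{(1+t^2)^{1/2}}.$$ Here time derivatives at $t=0$ are one-sided. -/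

import Mathlib

open Set Metric Laplacian
open scoped Manifold

noncomputable section

/-- The complex gradient `(∂₁u(x), …, ∂_d u(x))` of a complex-valued function on `ℝ^d`; its norm is
the Euclidean (Hermitian) norm. -/
def cgrad {d : ℕ} (u : EuclideanSpace ℝ (Fin d) → ℂ) (x : EuclideanSpace ℝ (Fin d)) :
    EuclideanSpace ℂ (Fin d) :=
  WithLp.toLp 2 fun i => fderiv ℝ u x (EuclideanSpace.single i 1)

/-- The time derivative of a function defined for times `t ≥ 0`, one-sided at `t = 0`. -/
def timeDeriv {F : Type*} [NormedAddCommGroup F] [NormedSpace ℝ F] (g : ℝ → F) (t : ℝ) : F :=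
  derivWithin g (Ici 0) t

/-- `v` belongs to `C^k(ℝ^d × [0,∞))`. -/
def IsCkSpaceTime {d : ℕ} (k : ℕ) (v : EuclideanSpace ℝ (Fin d) → ℝ → ℂ) : Prop :=
  ContDiffOn ℝ k (fun p : EuclideanSpace ℝ (Fin d) × ℝ => v p.1 p.2) (univ ×ˢ Ici 0)

/-- `v` is a classical solution, of class `C²(ℝ^d × [0,∞))`, of the Cauchy problem
`∂ₜ²v - c₀² Δv = 0` for `t > 0`, `v(·,0) = v₀`, `∂ₜv(·,0) = v₁`.
The values `v x t` at times `t < 0` are irrelevant. -/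
structure IsWaveSolution {d : ℕ} (c₀ : ℝ) (v₀ v₁ : EuclideanSpace ℝ (Fin d) → ℂ)
    (v : EuclideanSpace ℝ (Fin d) → ℝ → ℂ) : Prop where
  regular : IsCkSpaceTime 2 v
  wave : ∀ x, ∀ t, 0 < t →
    iteratedDeriv 2 (v x) t - (c₀ : ℂ) ^ 2 * Δ (fun y => v y t) x = 0
  init : ∀ x, v x 0 = v₀ x
  init_deriv : ∀ x, timeDeriv (v x) 0 = v₁ x

/-- `Y` is of class `C^k` on the unit sphere of `ℝ^(n+1)`; only the values of `Y` on the
sphere matter. -/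
def IsCkOnSphere {n : ℕ} (k : ℕ) (Y : EuclideanSpace ℝ (Fin (n + 1)) → ℂ) : Prop :=
  ContMDiff (𝓡 n) 𝓘(ℝ, ℂ) k
    (fun s : sphere (0 : EuclideanSpace ℝ (Fin (n + 1))) 1 => Y s)

/-- The function `x ↦ a(|x|) Y(x/|x|)`. (It is used only with `a 0 = 0`, so that the
value at `x = 0` is `0`, whatever `Y 0` is.) -/
def polarProduct {d : ℕ} (a : ℝ → ℂ) (Y : EuclideanSpace ℝ (Fin d) → ℂ)
    (x : EuclideanSpace ℝ (Fin d)) : ℂ :=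
  a ‖x‖ * Y (‖x‖⁻¹ • x)

/-- The sum
`|v| + |∇v| + |∂ₜv| + |Δv| + |∂ₜ∇v| + |∂ₜΔv|` at the point `(x, t)`. -/
def derivSum {d : ℕ} (v : EuclideanSpace ℝ (Fin d) → ℝ → ℂ)
    (x : EuclideanSpace ℝ (Fin d)) (t : ℝ) : ℝ :=
  ‖v x t‖ + ‖cgrad (fun y => v y t) x‖ + ‖timeDeriv (v x) t‖
    + ‖Δ (fun y => v y t) x‖
    + ‖timeDeriv (fun s => cgrad (fun y => v y s) x) t‖
    + ‖timeDeriv (fun s => Δ (fun y => v y s) x) t‖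

end

/-! ### Smooth dependence of interval integrals on parameters. -/

section ParametricIntegral

open MeasureTheory Filter Topology intervalIntegral

variable {H : Type*} [NormedAddCommGroup H] [NormedSpace ℝ H] [FiniteDimensional ℝ H]

/-! A classical solution is given by Kirchhoff's formula: `v(x,t)` is a spherical mean of `f + ct
∂_N f + t g` over the directions `N`. Uniqueness and representation come together, because a
suitable mean over the sphere of radius `ρ` in the backward light cone does not depend on `ρ`
(`hasDerivAt_coneMean`, `eq_kirchhoff_of_wave`). For `d = 2` the same computation runs with the
third frame vector equal to `0`; this is Hadamard's descent. The formula also gives the regularity,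
and it commutes with space derivatives. Since `∂ₜv` solves the wave equation with initial values
`(g, c²Δf)`, all six terms of `derivSum` reduce to Kirchhoff integrals of differentiated data
(`IsWaveSolution.derivSum_le`). It remains to show that each of these is `O(1/t)`.

The data are outgoing. For large `|y|` they are `exp(ik|y|)`, `k = ω/c₀`, times symbols of order
`-(d-1)/2`, and the choice of `v₁` makes the leading terms of `c ∂ᵣf + g` cancel. This structure
survives space derivatives and the passage `(f, g) ↦ (g, c²Δf)` (`IsOutgoing.dirDeriv`,
`IsOutgoing.next`).

For `d = 3`, on a sphere of radius `ct` with centre in a bounded set, `f` has size `1/t`, and so has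
`ct (∂_N f + c⁻¹ g)` by the cancellation, so absolute values suffice. For `d = 2` the data decay
only like `|y|^(-1/2)`, and the formula averages over a disc. On a meridian the phase is `k R sin
φ`, `R = ct`, stationary only at the equator. An integration by parts first brings `∂_N f` and `g`
together (`integral_meridian_eq`). Stationary phase then supplies the missing factor `R^(-1/2)`,
while the poles, where the data are not small, contribute only `O(1/R)`
(`norm_integral_oscillatory_le`). -/

theorem continuous_fderiv_section {f : H → ℝ → ℂ}
    (hf : ContDiff ℝ 1 (fun p : H × ℝ => f p.1 p.2)) :
    Continuous (fun q : H × ℝ => fderiv ℝ (fun p => f p q.2) q.1) := by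
  have : ContDiff ℝ 1 (Function.uncurry fun (q : H × ℝ) (p : H) => f p q.2) := by
    exact hf.comp (contDiff_snd.prodMk (contDiff_snd.comp contDiff_fst))
  exact (ContDiff.fderiv (m := 1) (n := 0) this contDiff_fst (by norm_num)).continuous

theorem hasFDerivAt_intervalIntegral_of_contDiff {f : H → ℝ → ℂ}
    (hf : ContDiff ℝ 1 (fun p : H × ℝ => f p.1 p.2)) (a b : ℝ) (x : H) :
    HasFDerivAt (fun p => ∫ s in a..b, f p s)
      (∫ s in a..b, fderiv ℝ (fun p => f p s) x) x := by
  have hsec : ∀ s p, HasFDerivAt (fun p => f p s) (fderiv ℝ (fun p => f p s) p) p := by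
    intro s p
    have : ContDiff ℝ 1 (fun p => f p s) := hf.comp (contDiff_id.prodMk contDiff_const)
    exact (this.differentiable one_ne_zero p).hasFDerivAt
  have hcont := continuous_fderiv_section hf
  obtain ⟨C, hC⟩ := ((isCompact_closedBall x 1).prod (isCompact_uIcc (a := a) (b := b))).exists_bound_of_continuousOn
    hcont.continuousOn
  refine intervalIntegral.hasFDerivAt_integral_of_dominated_of_fderiv_le (s := closedBall x 1)
    (F' := fun p s => fderiv ℝ (fun p => f p s) p) (bound := fun _ => C)
    (closedBall_mem_nhds x one_pos) ?_ ?_ ?_ ?_ ?_ ?_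
  · refine Eventually.of_forall fun p => ?_
    exact (hf.continuous.comp (Continuous.prodMk_right p)).aestronglyMeasurable
  · exact (hf.continuous.comp (Continuous.prodMk_right x)).intervalIntegrable _ _
  · exact (hcont.comp (Continuous.prodMk_right x)).aestronglyMeasurable
  · refine Eventually.of_forall fun s hs p hp => ?_
    exact hC (p, s) ⟨hp, uIoc_subset_uIcc hs⟩
  · exact intervalIntegrable_const
  · exact Eventually.of_forall fun s _ p _ => hsec s p

theorem fderiv_intervalIntegral_apply {f : H → ℝ → ℂ}
    (hf : ContDiff ℝ 1 (fun p : H × ℝ => f p.1 p.2)) (a b : ℝ) (x w : H) :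
    fderiv ℝ (fun p => ∫ s in a..b, f p s) x w
      = ∫ s in a..b, fderiv ℝ (fun p => f p s) x w := by
  rw [(hasFDerivAt_intervalIntegral_of_contDiff hf a b x).fderiv,
    ContinuousLinearMap.intervalIntegral_apply]
  exact ((continuous_fderiv_section hf).comp (Continuous.prodMk_right x)).intervalIntegrable _ _

/-- Induction on `k`: in finite dimension it suffices to control the derivative in each fixed
direction, and that derivative is again an integral of the same kind. -/
theorem contDiff_intervalIntegral {k : ℕ} {f : H → ℝ → ℂ}
    (hf : ContDiff ℝ k (fun p : H × ℝ => f p.1 p.2)) (a b : ℝ) :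
    ContDiff ℝ k (fun p => ∫ s in a..b, f p s) := by
  induction k generalizing f with
  | zero =>
    simp only [CharP.cast_eq_zero, contDiff_zero] at hf ⊢
    exact continuous_parametric_intervalIntegral_of_continuous' hf a b
  | succ k ih =>
    have h1 : ContDiff ℝ 1 (fun p : H × ℝ => f p.1 p.2) :=
      hf.of_le (by exact_mod_cast Nat.le_add_left 1 k)
    push_cast
    rw [contDiff_succ_iff_fderiv_apply]
    refine ⟨fun x => (hasFDerivAt_intervalIntegral_of_contDiff h1 a b x).differentiableAt,
      by simp, fun w => ?_⟩
    simp only [fderiv_intervalIntegral_apply h1]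
    apply ih (f := fun x s => fderiv ℝ (fun p => f p s) x w)
    have : ContDiff ℝ (k + 1 : ℕ) (Function.uncurry fun (q : H × ℝ) (p : H) => f p q.2) :=
      hf.comp (contDiff_snd.prodMk (contDiff_snd.comp contDiff_fst))
    exact (ContDiff.fderiv this contDiff_fst (by norm_cast)).clm_apply contDiff_const

end ParametricIntegral

/-! ### Conservation of the spherical mean along the backward light cone. -/

section Kirchhoff

open MeasureTheory Filter Topology intervalIntegral
open Real (sin cos)

theorem hasDerivAt_intervalIntegral_of_contDiff {f : ℝ → ℝ → ℂ} {f' : ℝ → ℂ}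
    (hf : ContDiff ℝ 1 (fun p : ℝ × ℝ => f p.1 p.2)) (a b x : ℝ)
    (hf' : ∀ s, HasDerivAt (fun r => f r s) (f' s) x) :
    HasDerivAt (fun r => ∫ s in a..b, f r s) (∫ s in a..b, f' s) x := by
  have h := (hasFDerivAt_intervalIntegral_of_contDiff hf a b x).hasDerivAt
  rw [ContinuousLinearMap.intervalIntegral_apply] at h
  · simpa [(hf' _).deriv] using h
  · exact ((continuous_fderiv_section hf).comp (Continuous.prodMk_right x)).intervalIntegrable _ _

variable {E : Type*} [NormedAddCommGroup E] [NormedSpace ℝ E]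

/-- The point of the unit sphere with spherical coordinates `θ` and `φ`, read in the
(possibly degenerate) frame `e`. -/
noncomputable def spherePoint (e : Fin 3 → E) (θ φ : ℝ) : E :=
  (sin φ * cos θ) • e 0 + (sin φ * sin θ) • e 1 + cos φ • e 2

/-- The derivative of `spherePoint` in the polar angle. -/
noncomputable def spherePolar (e : Fin 3 → E) (θ φ : ℝ) : E :=
  (cos φ * cos θ) • e 0 + (cos φ * sin θ) • e 1 - sin φ • e 2

/-- The unit tangent of the circles of latitude. -/
noncomputable def sphereAzimuth (e : Fin 3 → E) (θ : ℝ) : E :=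
  (-sin θ) • e 0 + cos θ • e 1

/-- The direction of azimuth `θ` on the equator. -/
noncomputable def equatorPoint (e : Fin 3 → E) (θ : ℝ) : E :=
  cos θ • e 0 + sin θ • e 1

theorem hasDerivAt_spherePoint_polar (e : Fin 3 → E) (θ φ : ℝ) :
    HasDerivAt (fun φ => spherePoint e θ φ) (spherePolar e θ φ) φ := by
  have h := ((((Real.hasDerivAt_sin φ).mul_const (cos θ)).smul_const (e 0)).add
    (((Real.hasDerivAt_sin φ).mul_const (sin θ)).smul_const (e 1))).add
    ((Real.hasDerivAt_cos φ).smul_const (e 2))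
  exact h.congr_deriv (by simp only [spherePolar]; module)

theorem hasDerivAt_spherePolar (e : Fin 3 → E) (θ φ : ℝ) :
    HasDerivAt (fun φ => spherePolar e θ φ) (-spherePoint e θ φ) φ := by
  have h := ((((Real.hasDerivAt_cos φ).mul_const (cos θ)).smul_const (e 0)).add
    (((Real.hasDerivAt_cos φ).mul_const (sin θ)).smul_const (e 1))).sub
    ((Real.hasDerivAt_sin φ).smul_const (e 2))
  exact h.congr_deriv (by simp only [spherePoint]; module)

theorem hasDerivAt_spherePoint_azimuth (e : Fin 3 → E) (θ φ : ℝ) :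
    HasDerivAt (fun θ => spherePoint e θ φ) (sin φ • sphereAzimuth e θ) θ := by
  have h := ((((Real.hasDerivAt_cos θ).const_mul (sin φ)).smul_const (e 0)).add
    (((Real.hasDerivAt_sin θ).const_mul (sin φ)).smul_const (e 1))).add_const
    (cos φ • e 2)
  exact h.congr_deriv (by simp only [sphereAzimuth]; module)

theorem hasDerivAt_sphereAzimuth (e : Fin 3 → E) (θ : ℝ) :
    HasDerivAt (fun θ => sphereAzimuth e θ) (-equatorPoint e θ) θ := by
  have h := (((Real.hasDerivAt_sin θ).neg).smul_const (e 0)).add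
    ((Real.hasDerivAt_cos θ).smul_const (e 1))
  exact h.congr_deriv (by simp only [equatorPoint]; module)

/-- With `L` and `B` the first and second derivatives of `V`, the left side is `sin φ` times `2 ∂_N
V + ρ (∂_N² - c⁻² ∂ₜ²) V`. The wave equation replaces `c⁻² ∂ₜ²` by the Laplacian, leaving minus the
tangential second derivatives, that is, a surface divergence. The right side is that divergence in
the coordinates `φ`, `θ`; the factor `sin φ` removes the singularity at the poles. Only polynomial
identities in sines and cosines enter, so the frame need not be orthonormal, nor even independent.
-/
theorem wave_cone_divergence (e : Fin 3 → E) (L : E × ℝ →L[ℝ] ℂ)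
    (B : E × ℝ →L[ℝ] E × ℝ →L[ℝ] ℂ) (hB : ∀ u w, B u w = B w u) (c ρ θ φ : ℝ)
    (hw : ∑ i, B (e i, 0) (e i, 0) = c⁻¹ ^ 2 • B (0, 1) (0, 1)) :
    sin φ • (L (spherePoint e θ φ, -c⁻¹) + (L (spherePoint e θ φ, c⁻¹)
        + ρ • B (spherePoint e θ φ, -c⁻¹) (spherePoint e θ φ, c⁻¹)))
      = -((cos φ • L (spherePolar e θ φ, 0) + sin φ •
          (B (ρ • spherePolar e θ φ, 0) (spherePolar e θ φ, 0) + L (-spherePoint e θ φ, 0)))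
        + (B (ρ • sin φ • sphereAzimuth e θ, 0) (sphereAzimuth e θ, 0)
          + L (-equatorPoint e θ, 0))) := by
  have dec : ∀ a b d t : ℝ, ((a • e 0 + b • e 1 + d • e 2, t) : E × ℝ)
      = a • (e 0, 0) + b • (e 1, 0) + d • (e 2, 0) + t • (0, 1) := by
    intro a b d t; ext <;> simp
  have p1 : ∀ t, ((spherePoint e θ φ, t) : E × ℝ) = (sin φ * cos θ) • (e 0, 0)
      + (sin φ * sin θ) • (e 1, 0) + cos φ • (e 2, 0) + t • (0, 1) := fun t => dec _ _ _ t
  have p2 : ((spherePolar e θ φ, 0) : E × ℝ) = (cos φ * cos θ) • (e 0, 0)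
      + (cos φ * sin θ) • (e 1, 0) - sin φ • (e 2, 0) := by
    rw [spherePolar]; ext <;> simp
  have p3 : ((sphereAzimuth e θ, 0) : E × ℝ) = (-sin θ) • (e 0, 0) + cos θ • (e 1, 0) := by
    rw [sphereAzimuth]; ext <;> simp
  have p4 : ((equatorPoint e θ, 0) : E × ℝ) = cos θ • (e 0, 0) + sin θ • (e 1, 0) := by
    rw [equatorPoint]; ext <;> simp
  have q1 : ((ρ • spherePolar e θ φ, 0) : E × ℝ) = ρ • (spherePolar e θ φ, 0) := by
    ext <;> simp
  have q2 : ((ρ • sin φ • sphereAzimuth e θ, 0) : E × ℝ)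
      = (ρ * sin φ) • (sphereAzimuth e θ, 0) := by
    ext <;> simp [mul_smul]
  have q3 : ((-spherePoint e θ φ, 0) : E × ℝ) = -(spherePoint e θ φ, 0) := by
    ext <;> simp
  have q4 : ((-equatorPoint e θ, 0) : E × ℝ) = -(equatorPoint e θ, 0) := by
    ext <;> simp
  rw [Fin.sum_univ_three] at hw
  rw [q1, q2, q3, q4, p2, p3, p4]
  simp only [p1]
  generalize ((e 0, 0) : E × ℝ) = u0 at *
  generalize ((e 1, 0) : E × ℝ) = u1 at *
  generalize ((e 2, 0) : E × ℝ) = u2 at *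
  generalize ((0, 1) : E × ℝ) = τ at *
  have h1 : (sin φ : ℂ) ^ 2 + (cos φ : ℂ) ^ 2 = 1 := by exact_mod_cast Real.sin_sq_add_cos_sq φ
  have h2 : (sin θ : ℂ) ^ 2 + (cos θ : ℂ) ^ 2 = 1 := by exact_mod_cast Real.sin_sq_add_cos_sq θ
  generalize sin φ = s at *
  generalize cos φ = k at *
  generalize sin θ = s' at *
  generalize cos θ = k' at *
  simp only [map_add, map_sub, map_neg, map_smul, add_apply, sub_apply, smul_apply,
    Complex.real_smul, hB u1 u0, hB u2 u0, hB u2 u1, hB τ u0, hB τ u1, hB τ u2] at hw ⊢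
  push_cast at hw ⊢
  linear_combination (ρ * s * (k' ^ 2 * B u0 u0 + 2 * (k' * s' * B u0 u1)
      + s' ^ 2 * B u1 u1 + B u2 u2) + k' * L u0 + s' * L u1) * h1
    + ρ * s * (B u0 u0 + B u1 u1) * h2 + ρ * s * hw

variable [FiniteDimensional ℝ E]

/-- The integral, over the sphere of radius `ρ` in the backward light cone of `(x, T)`, that
Kirchhoff's formula shows to be independent of `ρ`. -/
noncomputable def coneMean (e : Fin 3 → E) (c : ℝ) (V : E × ℝ → ℂ) (x : E) (T ρ : ℝ) : ℂ :=
  ∫ θ in 0..(2 * Real.pi), ∫ φ in 0..Real.pi, sin φ •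
    (V (x + ρ • spherePoint e θ φ, T - ρ * c⁻¹)
      + ρ • fderiv ℝ V (x + ρ • spherePoint e θ φ, T - ρ * c⁻¹) (spherePoint e θ φ, c⁻¹))

-- Differentiation in `ρ` under the integral produces the divergence of `wave_cone_divergence`. Its
-- polar part integrates to `0` because `sin` vanishes at `0` and `π`, its azimuthal part by
-- periodicity in `θ`.
set_option maxHeartbeats 1000000 in
theorem hasDerivAt_coneMean {V : E × ℝ → ℂ} (hV : ContDiff ℝ 2 V) (e : Fin 3 → E) (c : ℝ)
    (x : E) (T ρ : ℝ)
    (hw : ∀ y : E, ∑ i, fderiv ℝ (fderiv ℝ V) (y, T - ρ * c⁻¹) (e i, 0) (e i, 0)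
      = c⁻¹ ^ 2 • fderiv ℝ (fderiv ℝ V) (y, T - ρ * c⁻¹) (0, 1) (0, 1)) :
    HasDerivAt (coneMean e c V x T) 0 ρ := by
  unfold coneMean
  have hDc : ContDiff ℝ 1 (fderiv ℝ V) := hV.fderiv_right (m := 1) (by norm_num)
  have hD2c : Continuous (fderiv ℝ (fderiv ℝ V)) := hDc.continuous_fderiv one_ne_zero
  have hVd : ∀ p, HasFDerivAt V (fderiv ℝ V p) p := fun p =>
    (hV.differentiable two_ne_zero p).hasFDerivAt
  have hDd : ∀ p, HasFDerivAt (fderiv ℝ V) (fderiv ℝ (fderiv ℝ V) p) p := fun p =>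
    (hDc.differentiable one_ne_zero p).hasFDerivAt
  have hsymm : ∀ p u w, fderiv ℝ (fderiv ℝ V) p u w = fderiv ℝ (fderiv ℝ V) p w u := by
    intro p u w
    exact (hV.contDiffAt.isSymmSndFDerivAt (by simp)) u w
  generalize fderiv ℝ (fderiv ℝ V) = D2 at *
  generalize fderiv ℝ V = D at *
  obtain ⟨q, hq⟩ : ∃ q : ℝ → ℝ → ℝ → E × ℝ,
      q = fun ρ θ φ => (x + ρ • spherePoint e θ φ, T - ρ * c⁻¹) := ⟨_, rfl⟩
  have hq' : ∀ ρ θ φ, (x + ρ • spherePoint e θ φ, T - ρ * c⁻¹) = q ρ θ φ := fun ρ θ φ => by rw [hq]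
  simp only [hq']
  have hqρ : ∀ θ φ r, HasDerivAt (fun ρ => q ρ θ φ) (spherePoint e θ φ, -c⁻¹) r := by
    intro θ φ r
    rw [hq]
    have h1 : HasDerivAt (fun ρ : ℝ => x + ρ • spherePoint e θ φ) (spherePoint e θ φ) r := by
      simpa using ((hasDerivAt_id r).smul_const (spherePoint e θ φ)).const_add x
    have h2 : HasDerivAt (fun ρ : ℝ => T - ρ * c⁻¹) (-c⁻¹) r := by
      simpa using ((hasDerivAt_id r).mul_const c⁻¹).const_sub T
    exact h1.prodMk h2
  have hqφ : ∀ θ φ, HasDerivAt (fun φ => q ρ θ φ) (ρ • spherePolar e θ φ, 0) φ := fun θ φ => hq ▸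
    (((hasDerivAt_spherePoint_polar e θ φ).const_smul ρ).const_add x).prodMk (hasDerivAt_const _ _)
  have hqθ : ∀ θ φ, HasDerivAt (fun θ => q ρ θ φ) (ρ • sin φ • sphereAzimuth e θ, 0) θ :=
    fun θ φ => hq ▸ (((hasDerivAt_spherePoint_azimuth e θ φ).const_smul ρ).const_add x).prodMk
      (hasDerivAt_const _ _)
  have hw' : ∀ θ φ, ∑ i, D2 (q ρ θ φ) (e i, 0) (e i, 0)
      = c⁻¹ ^ 2 • D2 (q ρ θ φ) (0, 1) (0, 1) := fun θ φ => hq ▸ hw _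
  -- the integrand and its derivative in the radius
  have hg : ContDiff ℝ 1 (fun p : (ℝ × ℝ) × ℝ => sin p.2 • (V (q p.1.1 p.1.2 p.2)
      + p.1.1 • D (q p.1.1 p.1.2 p.2) (spherePoint e p.1.2 p.2, c⁻¹))) := by
    have hV1 : ContDiff ℝ 1 V := hV.of_le (by norm_num)
    simp only [hq]
    unfold spherePoint
    fun_prop
  have hgρ : ∀ θ φ, HasDerivAt (fun ρ => sin φ • (V (q ρ θ φ)
      + ρ • D (q ρ θ φ) (spherePoint e θ φ, c⁻¹)))
      (sin φ • (D (q ρ θ φ) (spherePoint e θ φ, -c⁻¹) + (D (q ρ θ φ) (spherePoint e θ φ, c⁻¹)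
        + ρ • D2 (q ρ θ φ) (spherePoint e θ φ, -c⁻¹) (spherePoint e θ φ, c⁻¹)))) ρ := by
    intro θ φ
    have h1 : HasDerivAt (fun ρ => V (q ρ θ φ)) (D (q ρ θ φ) (spherePoint e θ φ, -c⁻¹)) ρ :=
      (hVd (q ρ θ φ)).comp_hasDerivAt ρ (hqρ θ φ ρ)
    have hDq : HasDerivAt (fun ρ => D (q ρ θ φ)) (D2 (q ρ θ φ) (spherePoint e θ φ, -c⁻¹)) ρ :=
      (hDd (q ρ θ φ)).comp_hasDerivAt ρ (hqρ θ φ ρ)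
    have h2 : HasDerivAt (fun ρ => D (q ρ θ φ) (spherePoint e θ φ, c⁻¹))
        (D2 (q ρ θ φ) (spherePoint e θ φ, -c⁻¹) (spherePoint e θ φ, c⁻¹)) ρ := by
      simpa using hDq.clm_apply (hasDerivAt_const ρ ((spherePoint e θ φ, c⁻¹) : E × ℝ))
    refine ((h1.add ((hasDerivAt_id ρ).smul h2)).const_smul (sin φ)).congr_deriv ?_
    simp only [id, one_smul]
    rw [add_comm (D _ _) (ρ • _)]
  refine (hasDerivAt_intervalIntegral_of_contDiff
    (f := fun ρ θ => ∫ φ in 0..Real.pi, sin φ • (V (q ρ θ φ)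
      + ρ • D (q ρ θ φ) (spherePoint e θ φ, c⁻¹)))
    (f' := fun θ => ∫ φ in 0..Real.pi, (sin φ • (D (q ρ θ φ) (spherePoint e θ φ, -c⁻¹)
        + (D (q ρ θ φ) (spherePoint e θ φ, c⁻¹)
        + ρ • D2 (q ρ θ φ) (spherePoint e θ φ, -c⁻¹) (spherePoint e θ φ, c⁻¹)))))
    ?_ _ _ _ fun θ => ?_).congr_deriv ?_
  · exact contDiff_intervalIntegral (k := 1) (f := fun (p : ℝ × ℝ) φ => sin φ • (V (q p.1 p.2 φ)
      + p.1 • D (q p.1 p.2 φ) (spherePoint e p.2 φ, c⁻¹))) hg _ _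
  · have hι : ContDiff ℝ 1 (fun p : ℝ × ℝ => ((p.1, θ), p.2)) := by fun_prop
    have hgθ := hg.comp hι
    exact hasDerivAt_intervalIntegral_of_contDiff hgθ 0 Real.pi ρ (hgρ θ)
  have hpolar : ∀ θ φ, HasDerivAt (fun φ => sin φ • D (q ρ θ φ) (spherePolar e θ φ, 0))
      (cos φ • D (q ρ θ φ) (spherePolar e θ φ, 0) + sin φ •
          (D2 (q ρ θ φ) (ρ • spherePolar e θ φ, 0) (spherePolar e θ φ, 0)
            + D (q ρ θ φ) (-spherePoint e θ φ, 0))) φ := by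
    intro θ φ
    have hDq : HasDerivAt (fun φ => D (q ρ θ φ)) (D2 (q ρ θ φ) (ρ • spherePolar e θ φ, 0)) φ :=
      (hDd (q ρ θ φ)).comp_hasDerivAt φ (hqφ θ φ)
    have h2 := hDq.clm_apply
      ((hasDerivAt_spherePolar e θ φ).prodMk (hasDerivAt_const φ (0 : ℝ)))
    refine ((Real.hasDerivAt_sin φ).smul h2).congr_deriv ?_
    rw [add_comm]
  have hazim : ∀ θ φ, HasDerivAt (fun θ => D (q ρ θ φ) (sphereAzimuth e θ, 0))
      (D2 (q ρ θ φ) (ρ • sin φ • sphereAzimuth e θ, 0) (sphereAzimuth e θ, 0)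
          + D (q ρ θ φ) (-equatorPoint e θ, 0)) θ := by
    intro θ φ
    have hDq : HasDerivAt (fun θ => D (q ρ θ φ))
        (D2 (q ρ θ φ) (ρ • sin φ • sphereAzimuth e θ, 0)) θ :=
      (hDd (q ρ θ φ)).comp_hasDerivAt θ (hqθ θ φ)
    exact hDq.clm_apply
      ((hasDerivAt_sphereAzimuth e θ).prodMk (hasDerivAt_const θ (0 : ℝ)))
  have c1 : Continuous fun p : ℝ × ℝ => cos p.2 • D (q ρ p.1 p.2) (spherePolar e p.1 p.2, 0)
      + sin p.2 • (D2 (q ρ p.1 p.2) (ρ • spherePolar e p.1 p.2, 0) (spherePolar e p.1 p.2, 0)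
            + D (q ρ p.1 p.2) (-spherePoint e p.1 p.2, 0)) := by
    have := hDc.continuous
    simp only [hq]
    unfold spherePolar spherePoint
    fun_prop
  have c2 : Continuous fun p : ℝ × ℝ =>
      D2 (q ρ p.1 p.2) (ρ • sin p.2 • sphereAzimuth e p.1, 0) (sphereAzimuth e p.1, 0)
          + D (q ρ p.1 p.2) (-equatorPoint e p.1, 0) := by
    have := hDc.continuous
    simp only [hq]
    unfold sphereAzimuth equatorPoint spherePoint
    fun_prop
  have hB : ContDiff ℝ 1 (fun p : ℝ × ℝ => D (q ρ p.1 p.2) (sphereAzimuth e p.1, 0)) := by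
    simp only [hq]
    unfold sphereAzimuth spherePoint
    fun_prop
  have hθ : ∫ θ in 0..(2 * Real.pi), ∫ φ in 0..Real.pi,
      (D2 (q ρ θ φ) (ρ • sin φ • sphereAzimuth e θ, 0) (sphereAzimuth e θ, 0)
          + D (q ρ θ φ) (-equatorPoint e θ, 0)) = 0 := by
    rw [integral_eq_sub_of_hasDerivAt
      (f := fun θ => ∫ φ in 0..Real.pi, D (q ρ θ φ) (sphereAzimuth e θ, 0))
      (fun θ _ => hasDerivAt_intervalIntegral_of_contDiff hB _ _ _ fun φ => hazim θ φ)
      ((continuous_parametric_intervalIntegral_of_continuous' (f := fun θ φ =>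
        (D2 (q ρ θ φ) (ρ • sin φ • sphereAzimuth e θ, 0) (sphereAzimuth e θ, 0)
          + D (q ρ θ φ) (-equatorPoint e θ, 0))) c2 _ _).intervalIntegrable _ _)]
    simp [hq, spherePoint, sphereAzimuth]
  have hφ : ∀ θ, ∫ φ in 0..Real.pi, (cos φ • D (q ρ θ φ) (spherePolar e θ φ, 0) + sin φ •
          (D2 (q ρ θ φ) (ρ • spherePolar e θ φ, 0) (spherePolar e θ φ, 0)
            + D (q ρ θ φ) (-spherePoint e θ φ, 0))) = 0 := by
    intro θ
    rw [integral_eq_sub_of_hasDerivAt (fun φ _ => hpolar θ φ)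
      ((c1.comp (Continuous.prodMk_right θ)).intervalIntegrable _ _)]
    simp
  calc _ = ∫ θ in 0..(2 * Real.pi), -∫ φ in 0..Real.pi,
      (D2 (q ρ θ φ) (ρ • sin φ • sphereAzimuth e θ, 0) (sphereAzimuth e θ, 0)
          + D (q ρ θ φ) (-equatorPoint e θ, 0)) := by
        refine intervalIntegral.integral_congr fun θ _ => ?_
        simp only [wave_cone_divergence e _ _ (hsymm _) c ρ _ _ (hw' _ _)]
        have hadd := intervalIntegral.integral_add
          ((c1.comp (Continuous.prodMk_right θ)).intervalIntegrable (μ := volume) 0 Real.pi)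
          ((c2.comp (Continuous.prodMk_right θ)).intervalIntegrable (μ := volume) 0 Real.pi)
        simp only [Function.comp] at hadd
        rw [intervalIntegral.integral_neg, hadd, hφ, zero_add]
    _ = 0 := by rw [intervalIntegral.integral_neg, hθ, neg_zero]

end Kirchhoff

/-! ### Kirchhoff's formula for classical solutions. -/

section Representation

open MeasureTheory Filter Topology intervalIntegral
open Real (sin cos)

variable {E : Type*} [NormedAddCommGroup E] [NormedSpace ℝ E]

/-- The right-hand side of Kirchhoff's formula for the wave equation with initial values `f`
and `g`; with a degenerate frame `e` it is Poisson's formula in the plane. -/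
noncomputable def kirchhoff (e : Fin 3 → E) (c : ℝ) (f g : E → ℂ) (x : E) (t : ℝ) : ℂ :=
  (4 * Real.pi)⁻¹ • ∫ θ in 0..(2 * Real.pi), ∫ φ in 0..Real.pi, sin φ •
    (f (x + (c * t) • spherePoint e θ φ)
      + (c * t) • fderiv ℝ f (x + (c * t) • spherePoint e θ φ) (spherePoint e θ φ)
      + t • g (x + (c * t) • spherePoint e θ φ))

theorem integral_sphere_const (z : ℂ) :
    ∫ _ in 0..(2 * Real.pi), ∫ φ in 0..Real.pi, sin φ • z = (4 * Real.pi) • z := by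
  rw [intervalIntegral.integral_const, intervalIntegral.integral_smul_const, integral_sin]
  simp only [Real.cos_zero, Real.cos_pi, smul_smul]
  congr 1; ring

variable [FiniteDimensional ℝ E]

/-- The mean is constant for radii between `0` and `c (T - s)`, and at radius `0` the integrand is
`sin φ` times the value at the vertex of the cone. Staying at times `≥ s > 0` avoids the boundary,
where `v` has only one-sided derivatives. -/
theorem coneMean_eq_of_wave_of_pos {v : E × ℝ → ℂ} (hv : ContDiffOn ℝ 2 v (univ ×ˢ Ioi 0))
    (e : Fin 3 → E) {c : ℝ} (hc : 0 < c) (x : E) {s T : ℝ} (hs : 0 < s) (hsT : s ≤ T)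
    (hw : ∀ y t, 0 < t → ∑ i, fderiv ℝ (fderiv ℝ v) (y, t) (e i, 0) (e i, 0)
      = c⁻¹ ^ 2 • fderiv ℝ (fderiv ℝ v) (y, t) (0, 1) (0, 1)) :
    coneMean e c v x T (c * (T - s)) = (4 * Real.pi) • v (x, T) := by
  -- The cutoff vanishes for times below `s / 3` and equals `1` for times above `2 s / 3`. Thus `V`
  -- is `C²` on all of space-time and agrees with `v` near every point of time at least `s`.
  set V : E × ℝ → ℂ := fun p => Real.smoothTransition (3 * p.2 / s - 1) • v p with hV
  have hVeq : ∀ p : E × ℝ, s ≤ p.2 → V =ᶠ[𝓝 p] v := by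
    intro p hp
    have : ∀ᶠ q : E × ℝ in 𝓝 p, 2 / 3 * s < q.2 :=
      continuous_snd.continuousAt.eventually (lt_mem_nhds (by linarith))
    filter_upwards [this] with q hq
    have : 1 ≤ 3 * q.2 / s - 1 := by
      rw [le_sub_iff_add_le, le_div_iff₀ hs]; linarith
    simp [hV, Real.smoothTransition.one_of_one_le this]
  have hVC : ContDiff ℝ 2 V := by
    rw [contDiff_iff_contDiffAt]
    intro p
    rcases lt_or_ge 0 p.2 with hp | hp
    · have h1 : ContDiffAt ℝ 2 v p := hv.contDiffAt
        ((isOpen_univ.prod isOpen_Ioi).mem_nhds ⟨mem_univ _, hp⟩)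
      have h2 : ContDiff ℝ 2 (fun p : E × ℝ => Real.smoothTransition (3 * p.2 / s - 1)) :=
        Real.smoothTransition.contDiff.comp (by fun_prop)
      exact h2.contDiffAt.smul h1
    · have : V =ᶠ[𝓝 p] fun _ => 0 := by
        have : ∀ᶠ q : E × ℝ in 𝓝 p, q.2 < s / 3 :=
          continuous_snd.continuousAt.eventually (gt_mem_nhds (by linarith))
        filter_upwards [this] with q hq
        have : 3 * q.2 / s - 1 ≤ 0 := by
          rw [sub_nonpos, div_le_one hs]; linarith
        simp [hV, Real.smoothTransition.zero_of_nonpos this]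
      exact contDiffAt_const.congr_of_eventuallyEq this
  have hd : ∀ p : E × ℝ, s ≤ p.2 → fderiv ℝ V p = fderiv ℝ v p := fun p hp =>
    (hVeq p hp).fderiv_eq
  have hd2 : ∀ p : E × ℝ, s ≤ p.2 → fderiv ℝ (fderiv ℝ V) p = fderiv ℝ (fderiv ℝ v) p :=
    fun p hp => (hVeq p hp).fderiv.fderiv_eq
  have htime : ∀ ρ ≤ c * (T - s), s ≤ T - ρ * c⁻¹ := by
    intro ρ hρ
    have : ρ * c⁻¹ ≤ T - s := by
      rw [← div_eq_mul_inv, div_le_iff₀ hc]; linarith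
    linarith
  have hder : ∀ ρ ≤ c * (T - s), HasDerivAt (coneMean e c V x T) 0 ρ := by
    intro ρ hρ
    refine hasDerivAt_coneMean hVC e c x T ρ fun y => ?_
    rw [hd2 _ (htime ρ hρ)]
    exact hw y _ (hs.trans_le (htime ρ hρ))
  have hR : 0 ≤ c * (T - s) := mul_nonneg hc.le (by linarith)
  have hconst := constant_of_has_deriv_right_zero (f := coneMean e c V x T) (a := 0)
    (b := c * (T - s))
    (fun ρ hρ => (hder ρ hρ.2).continuousAt.continuousWithinAt)
    (fun ρ hρ => (hder ρ hρ.2.le).hasDerivWithinAt) (c * (T - s)) ⟨hR, le_rfl⟩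
  have h0 : coneMean e c V x T 0 = (4 * Real.pi) • v (x, T) := by
    rw [← integral_sphere_const]
    simp only [coneMean, zero_smul, add_zero, zero_mul, sub_zero]
    rw [(hVeq (x, T) hsT).eq_of_nhds]
  rw [← h0, ← hconst]
  simp only [coneMean]
  refine intervalIntegral.integral_congr fun θ _ => intervalIntegral.integral_congr fun φ _ => ?_
  rw [hd _ (htime _ le_rfl), (hVeq (_, _) (htime _ le_rfl)).eq_of_nhds]

/-- Kirchhoff's formula: a classical solution of the wave equation in a half-space is determined
by its initial values. -/
theorem eq_kirchhoff_of_wave {v : E → ℝ → ℂ} {f g : E → ℂ}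
    (hv : ContDiffOn ℝ 2 (fun p : E × ℝ => v p.1 p.2) (univ ×ˢ Ici 0))
    (e : Fin 3 → E) {c : ℝ} (hc : 0 < c)
    (hw : ∀ y t, 0 < t →
      ∑ i, fderiv ℝ (fderiv ℝ (fun p : E × ℝ => v p.1 p.2)) (y, t) (e i, 0) (e i, 0)
      = c⁻¹ ^ 2 • fderiv ℝ (fderiv ℝ (fun p : E × ℝ => v p.1 p.2)) (y, t) (0, 1) (0, 1))
    (hf : ∀ x, v x 0 = f x) (hg : ∀ x, timeDeriv (v x) 0 = g x) (x : E) {T : ℝ} (hT : 0 ≤ T) :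
    v x T = kirchhoff e c f g x T := by
  have hpi : (4 * Real.pi) ≠ 0 := by positivity
  rcases hT.eq_or_lt with rfl | hT
  · simp only [kirchhoff, mul_zero, zero_smul, add_zero]
    rw [integral_sphere_const, smul_smul, inv_mul_cancel₀ hpi, one_smul, hf]
  set H : Set (E × ℝ) := univ ×ˢ Ici 0 with hH
  have hHu : UniqueDiffOn ℝ H := uniqueDiffOn_univ.prod (uniqueDiffOn_Ici 0)
  obtain ⟨vv, hvv⟩ : ∃ vv : E × ℝ → ℂ, vv = fun p => v p.1 p.2 := ⟨_, rfl⟩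
  rw [← hvv] at hv hw
  have hvi : ∀ x t, v x t = vv (x, t) := fun x t => by rw [hvv]
  set W := fderivWithin ℝ vv H with hW
  have hWc : ContinuousOn W H := hv.continuousOn_fderivWithin hHu (by norm_num)
  have hpos : ContDiffOn ℝ 2 vv (univ ×ˢ Ioi 0) :=
    hv.mono (prod_mono_right Ioi_subset_Ici_self)
  -- `J s` is the cone mean at time `s`, with one-sided derivatives and with `s` replaced by `max s
  -- 0`. It is continuous on `ℝ`, so its constant value on `(0, T)` persists at `s = 0`.
  set J : ℝ → ℂ := fun s => ∫ θ in 0..(2 * Real.pi), ∫ φ in 0..Real.pi, sin φ •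
    (vv (x + (c * (T - max s 0)) • spherePoint e θ φ, max s 0)
      + (c * (T - max s 0)) • W (x + (c * (T - max s 0)) • spherePoint e θ φ, max s 0)
        (spherePoint e θ φ, c⁻¹)) with hJ
  have hJc : Continuous J := by
    refine continuous_parametric_intervalIntegral_of_continuous' (f := fun s θ =>
      ∫ φ in 0..Real.pi, sin φ •
      (vv (x + (c * (T - max s 0)) • spherePoint e θ φ, max s 0)
      + (c * (T - max s 0)) • W (x + (c * (T - max s 0)) • spherePoint e θ φ, max s 0)
        (spherePoint e θ φ, c⁻¹))) ?_ _ _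
    refine continuous_parametric_intervalIntegral_of_continuous' (X := ℝ × ℝ)
      (f := fun p φ => sin φ •
      (vv (x + (c * (T - max p.1 0)) • spherePoint e p.2 φ, max p.1 0)
      + (c * (T - max p.1 0)) • W (x + (c * (T - max p.1 0)) • spherePoint e p.2 φ, max p.1 0)
        (spherePoint e p.2 φ, c⁻¹))) ?_ _ _
    have hP : Continuous fun p : (ℝ × ℝ) × ℝ => spherePoint e p.1.2 p.2 := by
      unfold spherePoint; fun_prop
    have hq : Continuous fun p : (ℝ × ℝ) × ℝ =>
        ((x + (c * (T - max p.1.1 0)) • spherePoint e p.1.2 p.2, max p.1.1 0) : E × ℝ) := by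
      fun_prop
    have hqH : ∀ p : (ℝ × ℝ) × ℝ,
        ((x + (c * (T - max p.1.1 0)) • spherePoint e p.1.2 p.2, max p.1.1 0) : E × ℝ) ∈ H :=
      fun p => mk_mem_prod (mem_univ _) (mem_Ici.2 (le_max_right p.1.1 0))
    have h1 := hv.continuousOn.comp_continuous hq hqH
    have h2 := hWc.comp_continuous hq hqH
    have h3 : Continuous fun p : (ℝ × ℝ) × ℝ => c * (T - max p.1.1 0) := by fun_prop
    exact (Real.continuous_sin.comp continuous_snd).smul (h1.add
      (h3.smul (h2.clm_apply (hP.prodMk continuous_const))))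
  have hJpos : EqOn J (fun _ => (4 * Real.pi) • vv (x, T)) (Ioo 0 T) := by
    intro s hs
    have h := coneMean_eq_of_wave_of_pos hpos e hc x hs.1 hs.2.le hw
    simp only
    rw [← h]
    simp only [hJ, coneMean]
    have hst : T - c * (T - s) * c⁻¹ = s := by field_simp; ring
    rw [max_eq_left hs.1.le, hst]
    refine intervalIntegral.integral_congr fun θ _ => intervalIntegral.integral_congr fun φ _ => ?_
    simp only [hW]
    rw [fderivWithin_of_mem_nhds]
    exact mem_of_superset ((isOpen_univ.prod isOpen_Ioi).mem_nhds
      (mk_mem_prod (mem_univ _) (mem_Ioi.2 hs.1)))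
      (prod_mono_right Ioi_subset_Ici_self)
  have hJ0 : J 0 = (4 * Real.pi) • vv (x, T) := by
    refine hJpos.closure hJc continuous_const ?_
    rw [closure_Ioo hT.ne]
    exact ⟨le_rfl, hT.le⟩
  -- At time `0` the derivative along `(P, c⁻¹)` splits into a space part, seen by `f`, and a time
  -- part, seen by `g`. This turns `J 0` into the integral in Kirchhoff's formula.
  have hW0 : ∀ y P, W (y, 0) (P, c⁻¹) = fderiv ℝ f y P + c⁻¹ • g y := by
    intro y P
    have hy : (y, (0 : ℝ)) ∈ H := mk_mem_prod (mem_univ _) self_mem_Ici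
    have hd : HasFDerivWithinAt vv (W (y, 0)) H (y, 0) :=
      ((hv.differentiableOn two_ne_zero) _ hy).hasFDerivWithinAt
    have h1 : HasFDerivAt f ((W (y, 0)).comp (ContinuousLinearMap.inl ℝ E ℝ)) y := by
      have hι : HasFDerivWithinAt (fun z : E => (z, (0 : ℝ))) (ContinuousLinearMap.inl ℝ E ℝ)
          univ y := (hasFDerivAt_prodMk_left y 0).hasFDerivWithinAt
      have := hd.comp y hι (fun z _ => mk_mem_prod (mem_univ _) self_mem_Ici)
      rw [hasFDerivWithinAt_univ] at this
      refine this.congr_of_eventuallyEq (Eventually.of_forall fun z => ?_)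
      simp [← hf, hvi]
    have h2 : HasDerivWithinAt (v y) (W (y, 0) (0, 1)) (Ici 0) 0 := by
      have hι : HasDerivWithinAt (fun t : ℝ => (y, t)) ((0 : E), (1 : ℝ)) (Ici 0) 0 :=
        ((hasDerivAt_const _ y).prodMk (hasDerivAt_id _)).hasDerivWithinAt
      have := hd.comp_hasDerivWithinAt 0 hι (fun t ht => mk_mem_prod (mem_univ _) ht)
      refine this.congr_of_eventuallyEq (Eventually.of_forall fun z => ?_) ?_ <;> simp [hvi]
    have h3 : g y = W (y, 0) (0, 1) := by
      rw [← hg, timeDeriv, h2.derivWithin (uniqueDiffOn_Ici 0 0 self_mem_Ici)]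
    rw [h1.fderiv, h3, ContinuousLinearMap.comp_apply, ← map_smul, ← map_add]
    simp
  rw [kirchhoff, eq_inv_smul_iff₀ hpi, hvi, ← hJ0]
  simp only [hJ, max_self, sub_zero, hW0, ← hvi, hf]
  refine intervalIntegral.integral_congr fun θ _ => intervalIntegral.integral_congr fun φ _ => ?_
  rw [smul_add (c * T), smul_smul, mul_right_comm, mul_inv_cancel₀ hc.ne', one_mul, add_assoc]

end Representation

/-! ### Directional derivatives and their commutation. -/

section DirectionalDerivative

variable {E F : Type*} [NormedAddCommGroup E] [NormedSpace ℝ E] [NormedAddCommGroup F]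
  [NormedSpace ℝ F]

/-- The derivative of `f` in the direction `w`. -/
noncomputable def dirDeriv (w : E) (f : E → ℂ) (x : E) : ℂ := fderiv ℝ f x w

theorem ContDiff.dirDeriv {k l : WithTop ℕ∞} {f : E → ℂ} (hf : ContDiff ℝ k f) (hl : l + 1 ≤ k)
    (w : E) : ContDiff ℝ l (dirDeriv w f) :=
  (hf.fderiv_right hl).clm_apply contDiff_const

theorem fderiv_fderiv_apply_eq_dirDeriv {f : E → ℂ} {x : E}
    (hf : DifferentiableAt ℝ (fderiv ℝ f) x) (a b : E) :
    fderiv ℝ (fderiv ℝ f) x a b = dirDeriv a (dirDeriv b f) x := by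
  have h : HasFDerivAt (dirDeriv b f) ((ContinuousLinearMap.apply ℝ ℂ b).comp
      (fderiv ℝ (fderiv ℝ f) x)) x :=
    (ContinuousLinearMap.apply ℝ ℂ b).hasFDerivAt.comp x hf.hasFDerivAt
  rw [dirDeriv, h.fderiv]; rfl

theorem ContDiff.differentiable_fderiv {f : E → ℂ} (hf : ContDiff ℝ 2 f) :
    Differentiable ℝ (fderiv ℝ f) :=
  (hf.fderiv_right (m := 1) (by norm_num)).differentiable one_ne_zero

theorem dirDeriv_comm {f : E → ℂ} (hf : ContDiff ℝ 2 f) (a b : E) :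
    dirDeriv a (dirDeriv b f) = dirDeriv b (dirDeriv a f) := by
  ext x
  rw [← fderiv_fderiv_apply_eq_dirDeriv (hf.differentiable_fderiv x),
    ← fderiv_fderiv_apply_eq_dirDeriv (hf.differentiable_fderiv x)]
  exact (hf.contDiffAt.isSymmSndFDerivAt (by simp)) a b

theorem dirDeriv_section_left {V : E × F → ℂ} {x : E} {t : F}
    (hV : DifferentiableAt ℝ V (x, t)) (w : E) :
    dirDeriv w (fun y => V (y, t)) x = dirDeriv (w, 0) V (x, t) := by
  have : HasFDerivAt (fun y => V (y, t)) ((fderiv ℝ V (x, t)).comp (.inl ℝ E F)) x :=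
    hV.hasFDerivAt.comp x (hasFDerivAt_prodMk_left x t)
  rw [dirDeriv, this.fderiv]; rfl

theorem hasDerivAt_section_right {V : E × ℝ → ℂ} {x : E} {t : ℝ}
    (hV : DifferentiableAt ℝ V (x, t)) :
    HasDerivAt (fun s => V (x, s)) (dirDeriv (0, 1) V (x, t)) t :=
  hV.hasFDerivAt.comp_hasDerivAt t ((hasDerivAt_const t x).prodMk (hasDerivAt_id t))

theorem dirDeriv_sum {ι : Type*} (s : Finset ι) {f : ι → E → ℂ}
    (hf : ∀ i, Differentiable ℝ (f i)) (w : E) :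
    dirDeriv w (fun x => ∑ i ∈ s, f i x) = fun x => ∑ i ∈ s, dirDeriv w (f i) x := by
  ext x
  simp only [dirDeriv]
  rw [fderiv_fun_sum fun i _ => hf i x, sum_apply]

theorem dirDeriv_const_smul {f : E → ℂ} (hf : Differentiable ℝ f) (a : ℝ) (w : E) :
    dirDeriv w (fun x => a • f x) = fun x => a • dirDeriv w f x := by
  ext x
  simp only [dirDeriv]
  rw [fderiv_fun_const_smul (hf x)]
  rfl

end DirectionalDerivative

/-! ### Regularity and space derivatives of the Kirchhoff integral. -/

section KirchhoffRegularity

open intervalIntegral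
open Real (sin cos)

variable {E : Type*} [NormedAddCommGroup E] [NormedSpace ℝ E] [FiniteDimensional ℝ E]

theorem contDiff_kirchhoff_integrand (e : Fin 3 → E) (c : ℝ) {f g : E → ℂ} {k : ℕ}
    (hf : ContDiff ℝ (k + 1) f) (hg : ContDiff ℝ k g) :
    ContDiff ℝ k (fun p : ((E × ℝ) × ℝ) × ℝ => sin p.2 •
    (f (p.1.1.1 + (c * p.1.1.2) • spherePoint e p.1.2 p.2)
      + (c * p.1.1.2) • fderiv ℝ f (p.1.1.1 + (c * p.1.1.2) • spherePoint e p.1.2 p.2)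
          (spherePoint e p.1.2 p.2)
      + p.1.1.2 • g (p.1.1.1 + (c * p.1.1.2) • spherePoint e p.1.2 p.2))) := by
  have hf0 : ContDiff ℝ k f := hf.of_le (by exact_mod_cast Nat.le_succ k)
  have hf1 : ContDiff ℝ k (fderiv ℝ f) := hf.fderiv_right le_rfl
  generalize fderiv ℝ f = D at *
  unfold spherePoint
  fun_prop

theorem contDiff_kirchhoff (e : Fin 3 → E) (c : ℝ) {f g : E → ℂ} {k : ℕ}
    (hf : ContDiff ℝ (k + 1) f) (hg : ContDiff ℝ k g) :
    ContDiff ℝ k (fun p : E × ℝ => kirchhoff e c f g p.1 p.2) := by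
  have h := contDiff_intervalIntegral (f := fun (p : (E × ℝ) × ℝ) φ => sin φ •
    (f (p.1.1 + (c * p.1.2) • spherePoint e p.2 φ)
      + (c * p.1.2) • fderiv ℝ f (p.1.1 + (c * p.1.2) • spherePoint e p.2 φ)
          (spherePoint e p.2 φ)
      + p.1.2 • g (p.1.1 + (c * p.1.2) • spherePoint e p.2 φ)))
    (contDiff_kirchhoff_integrand e c hf hg) 0 Real.pi
  exact (contDiff_intervalIntegral h 0 (2 * Real.pi)).const_smul _

/-- The formula is translation invariant in `x`. The only nontrivial point is that `∂_w` must pass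
the derivative `∂_P f` under the integral, which is the symmetry of second derivatives. -/
theorem dirDeriv_kirchhoff (e : Fin 3 → E) (c : ℝ) {f g : E → ℂ}
    (hf : ContDiff ℝ 2 f) (hg : ContDiff ℝ 1 g) (w x : E) (t : ℝ) :
    dirDeriv w (fun y => kirchhoff e c f g y t) x
      = kirchhoff e c (dirDeriv w f) (dirDeriv w g) x t := by
  have h0 := contDiff_kirchhoff_integrand e c (k := 1) (by exact_mod_cast hf) (by exact_mod_cast hg)
  rw [Nat.cast_one] at h0
  have h2 : ContDiff ℝ 1 (fun p : (E × ℝ) × ℝ => ((((p.1.1, t), p.1.2), p.2) : ((E × ℝ) × ℝ) × ℝ)) := by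
    fun_prop
  have h1 := h0.comp h2
  simp only [Function.comp_def] at h1
  have h3 := contDiff_intervalIntegral (f := fun (p : E × ℝ) φ => sin φ •
    (f (p.1 + (c * t) • spherePoint e p.2 φ)
      + (c * t) • fderiv ℝ f (p.1 + (c * t) • spherePoint e p.2 φ) (spherePoint e p.2 φ)
      + t • g (p.1 + (c * t) • spherePoint e p.2 φ))) (k := 1) (by exact_mod_cast h1) 0 Real.pi
  rw [Nat.cast_one] at h3
  have hdiff := (hasFDerivAt_intervalIntegral_of_contDiff
    (f := fun y θ => ∫ φ in 0..Real.pi, sin φ •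
    (f (y + (c * t) • spherePoint e θ φ)
      + (c * t) • fderiv ℝ f (y + (c * t) • spherePoint e θ φ) (spherePoint e θ φ)
      + t • g (y + (c * t) • spherePoint e θ φ))) h3 0 (2 * Real.pi) x).differentiableAt
  unfold kirchhoff
  rw [dirDeriv, fderiv_fun_const_smul hdiff, smul_apply]
  congr 1
  rw [fderiv_intervalIntegral_apply
    (f := fun y θ => ∫ φ in 0..Real.pi, sin φ •
    (f (y + (c * t) • spherePoint e θ φ)
      + (c * t) • fderiv ℝ f (y + (c * t) • spherePoint e θ φ) (spherePoint e θ φ)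
      + t • g (y + (c * t) • spherePoint e θ φ))) h3]
  refine intervalIntegral.integral_congr fun θ _ => ?_
  have h4 : ContDiff ℝ 1 (fun p : E × ℝ => ((((p.1, t), θ), p.2) : ((E × ℝ) × ℝ) × ℝ)) := by
    fun_prop
  have h5 := h0.comp h4
  simp only [Function.comp_def] at h5
  refine (fderiv_intervalIntegral_apply (f := fun y φ => sin φ •
    (f (y + (c * t) • spherePoint e θ φ)
      + (c * t) • fderiv ℝ f (y + (c * t) • spherePoint e θ φ) (spherePoint e θ φ)
      + t • g (y + (c * t) • spherePoint e θ φ))) h5 0 Real.pi x w).trans ?_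
  refine intervalIntegral.integral_congr fun φ _ => ?_
  generalize spherePoint e θ φ = P
  have hy : HasFDerivAt (fun y : E => y + (c * t) • P) (.id ℝ E) x :=
    (hasFDerivAt_id x).add_const _
  have d1 : HasFDerivAt (fun y => f (y + (c * t) • P)) (fderiv ℝ f (x + (c * t) • P)) x :=
    ((hf.differentiable two_ne_zero _).hasFDerivAt).comp x hy
  have d2 : HasFDerivAt (fun y => dirDeriv P f (y + (c * t) • P))
      (fderiv ℝ (dirDeriv P f) (x + (c * t) • P)) x :=
    (((hf.dirDeriv (l := 1) (by norm_num) P).differentiable one_ne_zero _).hasFDerivAt).comp x hy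
  have d3 : HasFDerivAt (fun y => g (y + (c * t) • P)) (fderiv ℝ g (x + (c * t) • P)) x :=
    ((hg.differentiable one_ne_zero _).hasFDerivAt).comp x hy
  have d4 := (((d1.add (d2.const_smul (c * t))).add (d3.const_smul t)).const_smul (sin φ)).fderiv
  refine (congrArg (· w) d4).trans ?_
  have hcomm := congrFun (dirDeriv_comm hf w P) (x + (c * t) • P)
  simp only [dirDeriv] at hcomm ⊢
  simp [hcomm]

end KirchhoffRegularity

/-! ### Reduction of the six terms to Kirchhoff integrals. -/

section WaveReduction

open Filter Topology

variable {d : ℕ}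

/-- The standard basis of `ℝ^d`, `d = 2` or `d = 3`, filled up with `0` to three vectors. -/
noncomputable def stdFrame (d : ℕ) (i : Fin 3) : EuclideanSpace ℝ (Fin d) :=
  if h : (i : ℕ) < d then EuclideanSpace.single ⟨i, h⟩ 1 else 0

/-- The zero vector that fills up the frame in the plane contributes nothing, so the sum of second
derivatives over the frame is the Laplacian in both dimensions. -/
theorem sum_stdFrame (hd : d = 2 ∨ d = 3) (F : EuclideanSpace ℝ (Fin d) → ℂ) (hF : F 0 = 0) :
    ∑ i, F (stdFrame d i) = ∑ i, F (EuclideanSpace.single i 1) := by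
  rcases hd with rfl | rfl
  · rw [Fin.sum_univ_three, Fin.sum_univ_two]
    simp [stdFrame, hF]
  · rw [Fin.sum_univ_three, Fin.sum_univ_three]
    simp [stdFrame]

/-- The sum of the unmixed second partial derivatives. -/
noncomputable def sumSndDeriv (f : EuclideanSpace ℝ (Fin d) → ℂ)
    (x : EuclideanSpace ℝ (Fin d)) : ℂ :=
  ∑ i, dirDeriv (EuclideanSpace.single i 1) (dirDeriv (EuclideanSpace.single i 1) f) x

theorem laplacian_eq_sumSndDeriv {f : EuclideanSpace ℝ (Fin d) → ℂ} (hf : ContDiff ℝ 2 f) :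
    Δ f = sumSndDeriv f := by
  ext x
  rw [InnerProductSpace.laplacian_eq_iteratedFDeriv_orthonormalBasis f (EuclideanSpace.basisFun (Fin d) ℝ)]
  refine Finset.sum_congr rfl fun i _ => ?_
  rw [iteratedFDeriv_two_apply, ← fderiv_fderiv_apply_eq_dirDeriv (hf.differentiable_fderiv x)]
  simp

theorem IsWaveSolution.sum_fderiv_fderiv_eq (hd : d = 2 ∨ d = 3) {c : ℝ} (hc : 0 < c)
    {f g : EuclideanSpace ℝ (Fin d) → ℂ} {v : EuclideanSpace ℝ (Fin d) → ℝ → ℂ}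
    (hv : IsWaveSolution c f g v) (y : EuclideanSpace ℝ (Fin d)) (t : ℝ) (ht : 0 < t) :
    ∑ i, fderiv ℝ (fderiv ℝ (fun p : EuclideanSpace ℝ (Fin d) × ℝ => v p.1 p.2)) (y, t)
        (stdFrame d i, 0) (stdFrame d i, 0)
      = c⁻¹ ^ 2 • fderiv ℝ (fderiv ℝ (fun p : EuclideanSpace ℝ (Fin d) × ℝ => v p.1 p.2)) (y, t)
        (0, 1) (0, 1) := by
  obtain ⟨u, hu⟩ : ∃ u : EuclideanSpace ℝ (Fin d) × ℝ → ℂ, u = fun p => v p.1 p.2 := ⟨_, rfl⟩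
  have hreg := hv.regular
  have hwave := hv.wave y t ht
  rw [IsCkSpaceTime, ← hu] at hreg
  rw [← hu]
  have hvu : ∀ x, v x = fun t => u (x, t) := fun x => by rw [hu]
  simp only [hvu] at hwave
  have hca : ∀ z s, 0 < s → ContDiffAt ℝ 2 u (z, s) := fun z s hs => hreg.contDiffAt
    (mem_of_superset ((isOpen_univ.prod isOpen_Ioi).mem_nhds (mk_mem_prod (mem_univ _)
      (mem_Ioi.2 hs))) (prod_mono_right Ioi_subset_Ici_self))
  have hda : ∀ z s, 0 < s → DifferentiableAt ℝ u (z, s) := fun z s hs =>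
    (hca z s hs).differentiableAt two_ne_zero
  have hdf : ∀ z s, 0 < s → DifferentiableAt ℝ (fderiv ℝ u) (z, s) := fun z s hs =>
    ((hca z s hs).fderiv_right (m := 1) (by norm_num)).differentiableAt one_ne_zero
  have hdd : ∀ w z s, 0 < s → DifferentiableAt ℝ (dirDeriv w u) (z, s) := fun w z s hs =>
    (hdf z s hs).clm_apply (differentiableAt_const _)
  have hspace : ContDiff ℝ 2 (fun z => u (z, t)) := contDiff_iff_contDiffAt.2 fun z =>
    (hca z t ht).comp z (by fun_prop : ContDiffAt ℝ 2 (fun z => (z, t)) z)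
  have h1 : ∀ w : EuclideanSpace ℝ (Fin d), dirDeriv w (dirDeriv w (fun z => u (z, t))) y
      = fderiv ℝ (fderiv ℝ u) (y, t) (w, 0) (w, 0) := by
    intro w
    have : dirDeriv w (fun z => u (z, t)) = fun z => dirDeriv (w, 0) u (z, t) :=
      funext fun z => dirDeriv_section_left (hda z t ht) w
    rw [this, dirDeriv_section_left (hdd _ y t ht), fderiv_fderiv_apply_eq_dirDeriv (hdf y t ht)]
  have h2 : iteratedDeriv 2 (fun s => u (y, s)) t
      = fderiv ℝ (fderiv ℝ u) (y, t) (0, 1) (0, 1) := by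
    have : deriv (fun s => u (y, s)) =ᶠ[𝓝 t] fun s => dirDeriv (0, 1) u (y, s) := by
      filter_upwards [lt_mem_nhds ht] with s hs
      exact (hasDerivAt_section_right (hda y s hs)).deriv
    rw [iteratedDeriv_succ, iteratedDeriv_one, this.deriv_eq,
      (hasDerivAt_section_right (hdd _ y t ht)).deriv,
      fderiv_fderiv_apply_eq_dirDeriv (hdf y t ht)]
  have h3 : fderiv ℝ (fderiv ℝ u) (y, t) ((0 : EuclideanSpace ℝ (Fin d)), (0 : ℝ)) (0, 0) = 0 :=
    map_zero _
  rw [sum_stdFrame hd (fun w => fderiv ℝ (fderiv ℝ u) (y, t) (w, 0) (w, 0)) h3]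
  simp only [← h1]
  rw [← h2, Complex.real_smul]
  rw [laplacian_eq_sumSndDeriv hspace, sub_eq_zero] at hwave
  rw [hwave, sumSndDeriv]
  have : (c : ℂ) ≠ 0 := by exact_mod_cast hc.ne'
  push_cast
  field_simp

theorem norm_toLp_le_sum (z : Fin d → ℂ) :
    ‖(WithLp.toLp 2 z : EuclideanSpace ℂ (Fin d))‖ ≤ ∑ i, ‖z i‖ := by
  have : (WithLp.toLp 2 z : EuclideanSpace ℂ (Fin d)) = ∑ i, EuclideanSpace.single i (z i) := by
    ext j
    simp [Finset.sum_apply, Pi.single_apply]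
  rw [this]
  exact (norm_sum_le _ _).trans (by simp)

theorem eqOn_dirDeriv_time {d : ℕ} {G₁ G₂ : EuclideanSpace ℝ (Fin d) × ℝ → ℂ}
    (h : ∀ y t, 0 < t → G₁ (y, t) = G₂ (y, t)) (w : EuclideanSpace ℝ (Fin d) × ℝ)
    (y : EuclideanSpace ℝ (Fin d)) {t : ℝ} (ht : 0 < t) :
    dirDeriv w G₁ (y, t) = dirDeriv w G₂ (y, t) := by
  have : G₁ =ᶠ[𝓝 (y, t)] G₂ := by
    filter_upwards [(isOpen_univ.prod isOpen_Ioi).mem_nhds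
      (mk_mem_prod (mem_univ y) (mem_Ioi.2 ht))] with p hp
    exact h p.1 p.2 hp.2
  rw [dirDeriv, this.fderiv_eq]; rfl

theorem eq_at_zero_of_eq_pos {F : Type*} {G₁ G₂ : F × ℝ → ℂ} [TopologicalSpace F]
    (h₁ : Continuous G₁) (h₂ : Continuous G₂)
    (h : ∀ y t, 0 < t → G₁ (y, t) = G₂ (y, t)) (y : F) : G₁ (y, 0) = G₂ (y, 0) := by
  have : EqOn (fun t => G₁ (y, t)) (fun t => G₂ (y, t)) (Ioi 0) := fun t ht => h y t ht
  refine this.closure (by fun_prop) (by fun_prop) ?_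
  rw [closure_Ioi]
  exact self_mem_Ici

theorem contDiff_sumSndDeriv {f : EuclideanSpace ℝ (Fin d) → ℂ} {k l : WithTop ℕ∞}
    (hf : ContDiff ℝ k f) (hl : l + 1 + 1 ≤ k) : ContDiff ℝ l (sumSndDeriv f) :=
  ContDiff.sum fun _ _ => (hf.dirDeriv hl _).dirDeriv le_rfl _

/-- The space-time function `∂ₜv` of a classical solution `v` is given by Kirchhoff's formula. -/
theorem dirDeriv_time_eq_kirchhoff (hd : d = 2 ∨ d = 3) {c : ℝ} (hc : 0 < c)
    {f g : EuclideanSpace ℝ (Fin d) → ℂ}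
    {V : EuclideanSpace ℝ (Fin d) × ℝ → ℂ} (hV : ContDiff ℝ 4 V)
    (hw : ∀ y t, 0 < t → ∑ i, fderiv ℝ (fderiv ℝ V) (y, t) (stdFrame d i, 0) (stdFrame d i, 0)
      = c⁻¹ ^ 2 • fderiv ℝ (fderiv ℝ V) (y, t) (0, 1) (0, 1))
    (hf : ∀ x, V (x, 0) = f x) (hg : ∀ x, dirDeriv (0, 1) V (x, 0) = g x)
    (x : EuclideanSpace ℝ (Fin d)) {t : ℝ} (ht : 0 ≤ t) :
    dirDeriv (0, 1) V (x, t)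
      = kirchhoff (stdFrame d) c g (fun y => c ^ 2 • sumSndDeriv f y) x t := by
  have hV2 : ContDiff ℝ 2 V := hV.of_le (by norm_num)
  have hdV : ∀ w, ContDiff ℝ 3 (dirDeriv w V) := fun w => hV.dirDeriv (by norm_num) w
  have hdV2 : ∀ w, ContDiff ℝ 2 (dirDeriv w V) := fun w => (hdV w).of_le (by norm_num)
  have hddV : ∀ a b, ContDiff ℝ 2 (dirDeriv a (dirDeriv b V)) := fun a b =>
    (hdV b).dirDeriv (by norm_num) a
  have hconv : ∀ {W : EuclideanSpace ℝ (Fin d) × ℝ → ℂ}, ContDiff ℝ 2 W → ∀ p a b,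
      fderiv ℝ (fderiv ℝ W) p a b = dirDeriv a (dirDeriv b W) p := fun hW p a b =>
    fderiv_fderiv_apply_eq_dirDeriv (hW.differentiable_fderiv p) a b
  simp only [hconv hV2] at hw
  have hτ : ∀ a b, dirDeriv (0, 1) (dirDeriv a (dirDeriv b V))
      = dirDeriv a (dirDeriv b (dirDeriv (0, 1) V)) := fun a b => by
    rw [dirDeriv_comm (hdV2 b), dirDeriv_comm hV2]
  refine eq_kirchhoff_of_wave (v := fun x t => dirDeriv (0, 1) V (x, t))
    (hdV2 (0, 1)).contDiffOn (stdFrame d) hc ?_ hg ?_ x ht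
  · intro y s hs
    simp only [Prod.mk.eta]
    simp only [hconv (hdV2 (0, 1))]
    -- The wave equation is differentiated in time, and the time derivative is moved inside by
    -- symmetry.
    have h := eqOn_dirDeriv_time (G₁ := fun p =>
        ∑ i, dirDeriv (stdFrame d i, 0) (dirDeriv (stdFrame d i, 0) V) p)
      (G₂ := fun p => c⁻¹ ^ 2 • dirDeriv (0, 1) (dirDeriv (0, 1) V) p) hw (0, 1) y hs
    rw [dirDeriv_sum _ fun i => (hddV _ _).differentiable two_ne_zero,
      dirDeriv_const_smul ((hddV _ _).differentiable two_ne_zero)] at h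
    simpa only [hτ] using h
  · intro y
    -- By continuity the wave equation holds at `t = 0` as well; this identifies the initial
    -- velocity of `∂ₜV` as `c² Δf`.
    have h0 := eq_at_zero_of_eq_pos (G₁ := fun p =>
        ∑ i, dirDeriv (stdFrame d i, 0) (dirDeriv (stdFrame d i, 0) V) p)
      (G₂ := fun p => c⁻¹ ^ 2 • dirDeriv (0, 1) (dirDeriv (0, 1) V) p)
      (continuous_finsetSum _ fun i _ => (hddV _ _).continuous)
      (by have := (hddV (0, 1) (0, 1)).continuous; fun_prop) hw y
    have h1 : timeDeriv (fun t => dirDeriv (0, 1) V (y, t)) 0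
        = dirDeriv (0, 1) (dirDeriv (0, 1) V) (y, 0) :=
      (hasDerivAt_section_right
        ((hdV2 (0, 1)).differentiable two_ne_zero (y, 0))).hasDerivWithinAt.derivWithin
        (uniqueDiffOn_Ici 0 0 self_mem_Ici)
    have h2 : ∀ w : EuclideanSpace ℝ (Fin d), dirDeriv w (dirDeriv w f) y
        = dirDeriv (w, 0) (dirDeriv (w, 0) V) (y, 0) := by
      intro w
      have hf' : f = fun z => V (z, 0) := funext fun z => (hf z).symm
      have : dirDeriv w (fun z => V (z, 0)) = fun z => dirDeriv (w, 0) V (z, 0) :=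
        funext fun z => dirDeriv_section_left (hV2.differentiable two_ne_zero _) w
      rw [hf', this, dirDeriv_section_left ((hdV2 _).differentiable two_ne_zero _)]
    rw [h1, sumSndDeriv]
    simp only [h2]
    have h3 : dirDeriv ((0 : EuclideanSpace ℝ (Fin d)), (0 : ℝ))
        (dirDeriv ((0 : EuclideanSpace ℝ (Fin d)), (0 : ℝ)) V) (y, 0) = 0 :=
      map_zero _
    have h4 := sum_stdFrame hd (fun w => dirDeriv (w, 0) (dirDeriv (w, 0) V) (y, 0)) h3
    rw [← h4, h0, smul_smul, ← mul_pow, mul_inv_cancel₀ hc.ne', one_pow, one_smul]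

/-- The six terms of `derivSum` of a classical solution are bounded by solutions given by
Kirchhoff's formula, with initial values that are derivatives of the original ones. -/
theorem IsWaveSolution.derivSum_le (hd : d = 2 ∨ d = 3) {c : ℝ} (hc : 0 < c)
    {f g h : EuclideanSpace ℝ (Fin d) → ℂ} (hf : ContDiff ℝ 5 f) (hg : ContDiff ℝ 4 g)
    (hh : h = fun y => c ^ 2 • sumSndDeriv f y)
    {v : EuclideanSpace ℝ (Fin d) → ℝ → ℂ} (hv : IsWaveSolution c f g v) :
    IsCkSpaceTime 3 v ∧ ∀ x t, 0 ≤ t → derivSum v x t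
      ≤ ‖kirchhoff (stdFrame d) c f g x t‖
        + ∑ i, ‖kirchhoff (stdFrame d) c (dirDeriv (EuclideanSpace.single i 1) f)
            (dirDeriv (EuclideanSpace.single i 1) g) x t‖
        + ‖kirchhoff (stdFrame d) c g h x t‖
        + ∑ i, ‖kirchhoff (stdFrame d) c
            (dirDeriv (EuclideanSpace.single i 1) (dirDeriv (EuclideanSpace.single i 1) f))
            (dirDeriv (EuclideanSpace.single i 1) (dirDeriv (EuclideanSpace.single i 1) g)) x t‖
        + ∑ i, ‖kirchhoff (stdFrame d) c (dirDeriv (EuclideanSpace.single i 1) g)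
            (dirDeriv (EuclideanSpace.single i 1) h) x t‖
        + ∑ i, ‖kirchhoff (stdFrame d) c
            (dirDeriv (EuclideanSpace.single i 1) (dirDeriv (EuclideanSpace.single i 1) g))
            (dirDeriv (EuclideanSpace.single i 1) (dirDeriv (EuclideanSpace.single i 1) h)) x t‖ := by
  set V : EuclideanSpace ℝ (Fin d) × ℝ → ℂ := fun p => kirchhoff (stdFrame d) c f g p.1 p.2
    with hVdef
  -- One derivative of `f` is lost, since Kirchhoff's formula contains `∂f`; hence `C⁵` for `f` and
  -- `C⁴` for `g`.
  have hV : ContDiff ℝ 4 V := by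
    exact_mod_cast contDiff_kirchhoff (stdFrame d) c (k := 4) (by exact_mod_cast hf)
      (by exact_mod_cast hg)
  have hV2 : ContDiff ℝ 2 V := hV.of_le (by norm_num)
  have hdV2 : ∀ w, ContDiff ℝ 2 (dirDeriv w V) := fun w => hV.dirDeriv (by norm_num) w
  have hdiff : ∀ {W : EuclideanSpace ℝ (Fin d) × ℝ → ℂ}, ContDiff ℝ 2 W → Differentiable ℝ W :=
    fun hW => hW.differentiable two_ne_zero
  have hh3 : ContDiff ℝ 3 h := by
    have := contDiff_sumSndDeriv (l := 3) hf (by norm_num)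
    rw [hh]
    fun_prop
  have hvV : ∀ x t, 0 ≤ t → v x t = V (x, t) := fun x t ht =>
    eq_kirchhoff_of_wave hv.regular (stdFrame d) hc (hv.sum_fderiv_fderiv_eq hd hc) hv.init
      hv.init_deriv x ht
  have htd : ∀ {W : EuclideanSpace ℝ (Fin d) × ℝ → ℂ} {z : ℝ → ℂ} (x : EuclideanSpace ℝ (Fin d)),
      ContDiff ℝ 2 W → (∀ t, 0 ≤ t → z t = W (x, t)) → ∀ t, 0 ≤ t →
      HasDerivWithinAt z (dirDeriv (0, 1) W (x, t)) (Ici 0) t := fun x hW hz t ht =>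
    (hasDerivAt_section_right (hdiff hW (x, t))).hasDerivWithinAt.congr (fun s hs => hz s hs)
      (hz t ht)
  have hu : ∀ t : ℝ, 0 ≤ t → UniqueDiffWithinAt ℝ (Ici (0 : ℝ)) t := fun t ht =>
    uniqueDiffOn_Ici 0 t ht
  have hU : ∀ x t, 0 ≤ t → dirDeriv (0, 1) V (x, t) = kirchhoff (stdFrame d) c g h x t := by
    intro x t ht
    rw [hh]
    refine dirDeriv_time_eq_kirchhoff hd hc hV ?_ ?_ ?_ x ht
    · intro y s hs
      have hev : (fun p : EuclideanSpace ℝ (Fin d) × ℝ => v p.1 p.2) =ᶠ[𝓝 (y, s)] V := by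
        filter_upwards [(isOpen_univ.prod isOpen_Ioi).mem_nhds
          (mk_mem_prod (mem_univ y) (mem_Ioi.2 hs))] with p hp
        exact hvV p.1 p.2 (le_of_lt hp.2)
      have := hv.sum_fderiv_fderiv_eq hd hc y s hs
      rwa [hev.fderiv.fderiv_eq] at this
    · intro y
      rw [← hvV y 0 le_rfl, hv.init]
    · intro y
      rw [← hv.init_deriv y, timeDeriv,
        (htd y hV2 (hvV y) 0 le_rfl).derivWithin (hu 0 le_rfl)]
  have hsec : ∀ {t : ℝ}, 0 ≤ t → (fun y => v y t) = fun y => V (y, t) := fun ht =>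
    funext fun y => hvV y _ ht
  have hsec2 : ∀ {W : EuclideanSpace ℝ (Fin d) × ℝ → ℂ}, ContDiff ℝ 2 W → ∀ t,
      ContDiff ℝ 2 (fun y => W (y, t)) := fun hW t =>
    hW.comp (contDiff_id.prodMk contDiff_const)
  have hdsec : ∀ {W : EuclideanSpace ℝ (Fin d) × ℝ → ℂ}, ContDiff ℝ 2 W →
      ∀ (w : EuclideanSpace ℝ (Fin d)) (t : ℝ), dirDeriv w (fun y => W (y, t))
      = fun y => dirDeriv (w, 0) W (y, t) :=
    fun hW w t => funext fun y => dirDeriv_section_left (hdiff hW _) w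
  refine ⟨?_, fun x t ht => ?_⟩
  · rw [IsCkSpaceTime]
    refine (hV.of_le (by norm_num : (3 : WithTop ℕ∞) ≤ 4)).contDiffOn.congr fun p hp => ?_
    exact hvV p.1 p.2 hp.2
  -- the first and second space derivatives of the two Kirchhoff integrals
  have hfg1 : ∀ (w : EuclideanSpace ℝ (Fin d)) x s, dirDeriv (w, 0) V (x, s)
      = kirchhoff (stdFrame d) c (dirDeriv w f) (dirDeriv w g) x s := fun w x s => by
    rw [← dirDeriv_kirchhoff (stdFrame d) c (hf.of_le (by norm_num)) (hg.of_le (by norm_num)),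
      ← dirDeriv_section_left (hdiff hV2 _)]
  have hfg2 : ∀ (w : EuclideanSpace ℝ (Fin d)) x s, dirDeriv (w, 0) (dirDeriv (w, 0) V) (x, s)
      = kirchhoff (stdFrame d) c (dirDeriv w (dirDeriv w f)) (dirDeriv w (dirDeriv w g)) x s :=
    fun w x s => by
    rw [← dirDeriv_kirchhoff (stdFrame d) c (hf.dirDeriv (by norm_num) w)
      (hg.dirDeriv (by norm_num) w), ← dirDeriv_section_left (hdiff (hdV2 _) _)]
    simp only [hfg1]
  have hgh1 : ∀ (w x : EuclideanSpace ℝ (Fin d)) s, 0 ≤ s →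
      dirDeriv (w, 0) (dirDeriv (0, 1) V) (x, s)
      = kirchhoff (stdFrame d) c (dirDeriv w g) (dirDeriv w h) x s := fun w x s hs => by
    rw [← dirDeriv_kirchhoff (stdFrame d) c (hg.of_le (by norm_num)) (hh3.of_le (by norm_num)),
      ← dirDeriv_section_left (hdiff (hdV2 _) _)]
    simp only [hU _ s hs]
  have hgh2 : ∀ (w x : EuclideanSpace ℝ (Fin d)) s, 0 ≤ s →
      dirDeriv (w, 0) (dirDeriv (w, 0) (dirDeriv (0, 1) V)) (x, s)
      = kirchhoff (stdFrame d) c (dirDeriv w (dirDeriv w g)) (dirDeriv w (dirDeriv w h)) x s :=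
    fun w x s hs => by
    have hd2 : ContDiff ℝ 2 (dirDeriv (w, 0) V) := hdV2 _
    have hd1 : ContDiff ℝ 1 (dirDeriv (w, 0) (dirDeriv (0, 1) V)) :=
      (hdV2 _).dirDeriv (by norm_num) _
    rw [← dirDeriv_kirchhoff (stdFrame d) c (hg.dirDeriv (by norm_num) w)
      (hh3.dirDeriv (by norm_num) w),
      ← dirDeriv_section_left (hd1.differentiable one_ne_zero _)]
    simp only [hgh1 _ _ s hs]
  have hgrad : ∀ s, 0 ≤ s → cgrad (fun y => v y s) x = WithLp.toLp 2 fun i =>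
      dirDeriv (EuclideanSpace.single i 1, 0) V (x, s) := by
    intro s hs
    rw [cgrad, hsec hs]
    congr 1
    ext i
    exact congrFun (hdsec hV2 _ s) x
  have hlap : ∀ s, 0 ≤ s → Δ (fun y => v y s) x = ∑ i, dirDeriv (EuclideanSpace.single i 1, 0)
      (dirDeriv (EuclideanSpace.single i 1, 0) V) (x, s) := by
    intro s hs
    rw [hsec hs, laplacian_eq_sumSndDeriv (hsec2 hV2 s), sumSndDeriv]
    refine Finset.sum_congr rfl fun i _ => ?_
    rw [hdsec hV2, hdsec (hdV2 _)]
  have hcomm1 : ∀ w : EuclideanSpace ℝ (Fin d), dirDeriv (0, 1) (dirDeriv (w, 0) V)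
      = dirDeriv (w, 0) (dirDeriv (0, 1) V) := fun w => dirDeriv_comm hV2 _ _
  have hcomm2 : ∀ w : EuclideanSpace ℝ (Fin d),
      dirDeriv (0, 1) (dirDeriv (w, 0) (dirDeriv (w, 0) V))
      = dirDeriv (w, 0) (dirDeriv (w, 0) (dirDeriv (0, 1) V)) := fun w => by
    rw [dirDeriv_comm (hdV2 _), hcomm1]
  have hgradt : timeDeriv (fun s => cgrad (fun y => v y s) x) t = WithLp.toLp 2 fun i =>
      dirDeriv (EuclideanSpace.single i 1, 0) (dirDeriv (0, 1) V) (x, t) := by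
    have h1 : HasDerivWithinAt (fun s i => dirDeriv (EuclideanSpace.single i 1, 0) V (x, s))
        (fun i => dirDeriv (EuclideanSpace.single i 1, 0) (dirDeriv (0, 1) V) (x, t))
        (Ici 0) t := by
      rw [hasDerivWithinAt_pi]
      intro i
      have := htd x (hdV2 (EuclideanSpace.single i 1, 0)) (fun s _ => rfl) t ht
      rwa [hcomm1] at this
    have h2 := ((PiLp.continuousLinearEquiv 2 ℝ (fun _ : Fin d => ℂ)).symm.toContinuousLinearMap
      |>.hasFDerivAt).comp_hasDerivWithinAt t h1
    have h3 : HasDerivWithinAt (fun s => cgrad (fun y => v y s) x) (WithLp.toLp 2 fun i =>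
      dirDeriv (EuclideanSpace.single i 1, 0) (dirDeriv (0, 1) V) (x, t)) (Ici 0) t :=
      h2.congr (fun s hs => hgrad s hs) (hgrad t ht)
    exact h3.derivWithin (hu t ht)
  have hlapt : timeDeriv (fun s => Δ (fun y => v y s) x) t
      = ∑ i, dirDeriv (EuclideanSpace.single i 1, 0)
        (dirDeriv (EuclideanSpace.single i 1, 0) (dirDeriv (0, 1) V)) (x, t) := by
    have h1 : HasDerivWithinAt (fun s => ∑ i, dirDeriv (EuclideanSpace.single i 1, 0)
      (dirDeriv (EuclideanSpace.single i 1, 0) V) (x, s)) (∑ i,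
        dirDeriv (EuclideanSpace.single i 1, 0)
        (dirDeriv (EuclideanSpace.single i 1, 0) (dirDeriv (0, 1) V)) (x, t)) (Ici 0) t := by
      refine HasDerivWithinAt.fun_sum fun i _ => ?_
      rw [← hcomm2]
      exact htd x ((hV.dirDeriv (l := 3) (by norm_num) _).dirDeriv (by norm_num) _)
        (fun s _ => rfl) t ht
    exact (h1.congr (fun s hs => hlap s hs) (hlap t ht)).derivWithin (hu t ht)
  have hvt : timeDeriv (v x) t = dirDeriv (0, 1) V (x, t) :=
    (htd x hV2 (hvV x) t ht).derivWithin (hu t ht)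
  rw [derivSum, hgrad t ht, hlap t ht, hgradt, hlapt, hvt, hvV x t ht, hU x t ht]
  simp only [hfg1, hfg2, hgh1 _ x t ht, hgh2 _ x t ht]
  gcongr
  · exact norm_toLp_le_sum _
  · exact norm_sum_le _ _
  · exact norm_toLp_le_sum _
  · exact norm_sum_le _ _

end WaveReduction

/-! ### Regularity of the initial values. -/

section PolarProduct

open Filter Topology

/-- The extension of degree `0` is `Y` composed with the radial projection of the punctured space
onto the sphere, which is smooth as a map of manifolds. -/
theorem IsCkOnSphere.contDiffAt {n k : ℕ} {Y : EuclideanSpace ℝ (Fin (n + 1)) → ℂ}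
    (hY : IsCkOnSphere k Y) {x : EuclideanSpace ℝ (Fin (n + 1))} (hx : x ≠ 0) :
    ContDiffAt ℝ k (fun x => Y (‖x‖⁻¹ • x)) x := by
  let U : TopologicalSpace.Opens (EuclideanSpace ℝ (Fin (n + 1))) := ⟨{0}ᶜ, isOpen_compl_singleton⟩
  have hne : ∀ y : U, (y : EuclideanSpace ℝ (Fin (n + 1))) ≠ 0 := fun y => y.2
  have hf : ContMDiff 𝓘(ℝ, EuclideanSpace ℝ (Fin (n + 1))) 𝓘(ℝ, EuclideanSpace ℝ (Fin (n + 1)))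
      k (fun y : U => ‖(y : EuclideanSpace ℝ (Fin (n + 1)))‖⁻¹ •
        (y : EuclideanSpace ℝ (Fin (n + 1)))) := by
    intro y
    refine (contMDiffAt_subtype_iff (f := fun y => ‖y‖⁻¹ • y) (x := y)).2 ?_
    rw [contMDiffAt_iff_contDiffAt]
    exact ((contDiffAt_norm ℝ (hne y)).inv (norm_ne_zero_iff.2 (hne y))).smul contDiffAt_id
  have hs : ∀ y : U, ‖(y : EuclideanSpace ℝ (Fin (n + 1)))‖⁻¹ •
        (y : EuclideanSpace ℝ (Fin (n + 1))) ∈ sphere (0 : EuclideanSpace ℝ (Fin (n + 1))) 1 := by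
    intro y
    rw [mem_sphere_zero_iff_norm, norm_smul, norm_inv, norm_norm,
      inv_mul_cancel₀ (norm_ne_zero_iff.2 (hne y))]
  have : Fact (Module.finrank ℝ (EuclideanSpace ℝ (Fin (n + 1))) = n + 1) :=
    ⟨finrank_euclideanSpace_fin⟩
  have h := hY.comp (hf.codRestrict_sphere hs)
  have h2 := h.contMDiffAt (x := ⟨x, hx⟩)
  have h3 := (contMDiffAt_subtype_iff (U := U) (f := fun y => Y (‖y‖⁻¹ • y)) (x := ⟨x, hx⟩)).1 h2
  exact contMDiffAt_iff_contDiffAt.1 h3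

theorem contDiff_polarProduct {n k : ℕ} {Y : EuclideanSpace ℝ (Fin (n + 1)) → ℂ}
    (hY : IsCkOnSphere k Y) {a : ℝ → ℂ} (ha : ContDiffOn ℝ k a (Ici 0)) {r : ℝ} (hr : 0 < r)
    (ha0 : ∀ ρ ∈ Ico 0 r, a ρ = 0) : ContDiff ℝ k (polarProduct a Y) := by
  rw [contDiff_iff_contDiffAt]
  intro x
  by_cases hx : x = 0
  · have : polarProduct a Y =ᶠ[𝓝 x] fun _ => 0 := by
      have : ∀ᶠ y : EuclideanSpace ℝ (Fin (n + 1)) in 𝓝 x, ‖y‖ < r :=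
        continuous_norm.continuousAt.eventually (gt_mem_nhds (by simpa [hx] using hr))
      filter_upwards [this] with y hy
      rw [polarProduct, ha0 _ ⟨norm_nonneg _, hy⟩, zero_mul]
    exact contDiffAt_const.congr_of_eventuallyEq this
  · have h1 : ContDiffAt ℝ k a ‖x‖ := ha.contDiffAt (Ici_mem_nhds (norm_pos_iff.2 hx))
    exact (h1.comp x (contDiffAt_norm ℝ hx)).mul (hY.contDiffAt hx)

end PolarProduct

/-! ### Symbols: functions that gain one order of decay with each derivative. -/

section SymbolClasses

open Filter Topology

section Normed

variable {E : Type*} [NormedAddCommGroup E] [NormedSpace ℝ E]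

/-- Symbols of order `m` outside the ball of radius `r`: functions that decay like `‖y‖ ^ m` and
gain one order with each of the first `K` derivatives. -/
def IsSymbol (r : ℝ) : ℕ → ℝ → (E → ℂ) → Prop
  | 0, m, a => ∃ C : ℝ, ∀ y, r < ‖y‖ → ‖a y‖ ≤ C * ‖y‖ ^ m
  | K + 1, m, a => (∃ C : ℝ, ∀ y, r < ‖y‖ → ‖a y‖ ≤ C * ‖y‖ ^ m) ∧
      (∀ y, r < ‖y‖ → DifferentiableAt ℝ a y) ∧ ∀ w, IsSymbol r K (m - 1) (dirDeriv w a)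

variable {r : ℝ} {K : ℕ} {m : ℝ} {a b : E → ℂ}

theorem setOf_lt_norm_mem_nhds {y : E} (hy : r < ‖y‖) : ∀ᶠ z : E in 𝓝 y, r < ‖z‖ :=
  continuous_norm.continuousAt.eventually (lt_mem_nhds hy)

theorem dirDeriv_congr_of_lt_norm (h : ∀ y, r < ‖y‖ → a y = b y) (w : E) {y : E} (hy : r < ‖y‖) :
    dirDeriv w a y = dirDeriv w b y := by
  have : a =ᶠ[𝓝 y] b := (setOf_lt_norm_mem_nhds hy).mono h
  rw [dirDeriv, this.fderiv_eq]; rfl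

theorem IsSymbol.bound (ha : IsSymbol r K m a) : ∃ C : ℝ, ∀ y, r < ‖y‖ → ‖a y‖ ≤ C * ‖y‖ ^ m := by
  cases K with
  | zero => exact ha
  | succ K => exact ha.1

theorem IsSymbol.differentiableAt (ha : IsSymbol r (K + 1) m a) {y : E} (hy : r < ‖y‖) :
    DifferentiableAt ℝ a y := ha.2.1 y hy

theorem IsSymbol.dirDeriv (ha : IsSymbol r (K + 1) m a) (w : E) :
    IsSymbol r K (m - 1) (dirDeriv w a) := ha.2.2 w

theorem IsSymbol.of_succ (ha : IsSymbol r (K + 1) m a) : IsSymbol r K m a := by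
  induction K generalizing m a with
  | zero => exact ha.1
  | succ K ih => exact ⟨ha.1, ha.2.1, fun w => ih (ha.2.2 w)⟩

theorem IsSymbol.congr (ha : IsSymbol r K m a) (h : ∀ y, r < ‖y‖ → a y = b y) :
    IsSymbol r K m b := by
  induction K generalizing m a b with
  | zero =>
    obtain ⟨C, hC⟩ := ha
    exact ⟨C, fun y hy => h y hy ▸ hC y hy⟩
  | succ K ih =>
    obtain ⟨⟨C, hC⟩, hd, hi⟩ := ha
    refine ⟨⟨C, fun y hy => h y hy ▸ hC y hy⟩, fun y hy => ?_, fun w => ?_⟩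
    · exact (hd y hy).congr_of_eventuallyEq
        ((setOf_lt_norm_mem_nhds hy).mono fun z hz => (h z hz).symm)
    · exact ih (hi w) fun y hy => dirDeriv_congr_of_lt_norm h w hy

theorem IsSymbol.mono (hr : 0 < r) {m' : ℝ} (hm : m ≤ m') (ha : IsSymbol r K m a) :
    IsSymbol r K m' a := by
  have key : ∀ {m m' : ℝ} {a : E → ℂ}, m ≤ m' → (∃ C : ℝ, ∀ y, r < ‖y‖ → ‖a y‖ ≤ C * ‖y‖ ^ m) →
      ∃ C : ℝ, ∀ y, r < ‖y‖ → ‖a y‖ ≤ C * ‖y‖ ^ m' := by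
    rintro m m' a hm ⟨C, hC⟩
    refine ⟨|C| * r ^ (m - m'), fun y hy => (hC y hy).trans ?_⟩
    have hy0 : 0 < ‖y‖ := hr.trans hy
    have h1 : ‖y‖ ^ m = ‖y‖ ^ (m - m') * ‖y‖ ^ m' := by
      rw [← Real.rpow_add hy0]; congr 1; ring
    have h2 : ‖y‖ ^ (m - m') ≤ r ^ (m - m') :=
      Real.rpow_le_rpow_of_nonpos hr hy.le (by linarith)
    calc C * ‖y‖ ^ m ≤ |C| * ‖y‖ ^ m := by gcongr; exact le_abs_self C
      _ ≤ |C| * r ^ (m - m') * ‖y‖ ^ m' := by rw [h1, mul_assoc]; gcongr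
  induction K generalizing m m' a with
  | zero => exact key hm ha
  | succ K ih => exact ⟨key hm ha.1, ha.2.1, fun w => ih (by linarith) (ha.2.2 w)⟩

theorem IsSymbol.add (ha : IsSymbol r K m a) (hb : IsSymbol r K m b) :
    IsSymbol r K m (fun y => a y + b y) := by
  have key : ∀ {m : ℝ} {a b : E → ℂ}, (∃ C : ℝ, ∀ y, r < ‖y‖ → ‖a y‖ ≤ C * ‖y‖ ^ m) →
      (∃ C : ℝ, ∀ y, r < ‖y‖ → ‖b y‖ ≤ C * ‖y‖ ^ m) →
      ∃ C : ℝ, ∀ y, r < ‖y‖ → ‖a y + b y‖ ≤ C * ‖y‖ ^ m := by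
    rintro m a b ⟨C, hC⟩ ⟨C', hC'⟩
    refine ⟨C + C', fun y hy => (norm_add_le _ _).trans ?_⟩
    linarith [hC y hy, hC' y hy]
  induction K generalizing m a b with
  | zero => exact key ha hb
  | succ K ih =>
    refine ⟨key ha.1 hb.1, fun y hy => (ha.2.1 y hy).add (hb.2.1 y hy), fun w => ?_⟩
    refine (ih (ha.2.2 w) (hb.2.2 w)).congr fun y hy => ?_
    simp only [_root_.dirDeriv]
    rw [fderiv_fun_add (ha.2.1 y hy) (hb.2.1 y hy), add_apply]

theorem IsSymbol.mul {m' : ℝ} (hr : 0 < r) (ha : IsSymbol r K m a) (hb : IsSymbol r K m' b) :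
    IsSymbol r K (m + m') (fun y => a y * b y) := by
  have key : ∀ {m m' : ℝ} {a b : E → ℂ}, (∃ C : ℝ, ∀ y, r < ‖y‖ → ‖a y‖ ≤ C * ‖y‖ ^ m) →
      (∃ C : ℝ, ∀ y, r < ‖y‖ → ‖b y‖ ≤ C * ‖y‖ ^ m') →
      ∃ C : ℝ, ∀ y, r < ‖y‖ → ‖a y * b y‖ ≤ C * ‖y‖ ^ (m + m') := by
    rintro m m' a b ⟨C, hC⟩ ⟨C', hC'⟩
    refine ⟨C * C', fun y hy => ?_⟩
    rw [norm_mul, Real.rpow_add (hr.trans hy)]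
    calc ‖a y‖ * ‖b y‖ ≤ (C * ‖y‖ ^ m) * (C' * ‖y‖ ^ m') :=
          mul_le_mul (hC y hy) (hC' y hy) (norm_nonneg _) ((norm_nonneg _).trans (hC y hy))
      _ = _ := by ring
  induction K generalizing m m' a b with
  | zero => exact key ha hb
  | succ K ih =>
    refine ⟨key ha.1 hb.1, fun y hy => (ha.2.1 y hy).mul (hb.2.1 y hy), fun w => ?_⟩
    have h1 := ih ha.of_succ (hb.2.2 w)
    have h2 := ih (ha.2.2 w) hb.of_succ
    rw [show m + (m' - 1) = m + m' - 1 by ring] at h1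
    rw [show m - 1 + m' = m + m' - 1 by ring] at h2
    refine (h1.add h2).congr fun y hy => ?_
    simp only [_root_.dirDeriv]
    rw [fderiv_fun_mul (ha.2.1 y hy) (hb.2.1 y hy)]
    simp [mul_comm]

theorem isSymbol_zero : IsSymbol r K m (fun _ : E => (0 : ℂ)) := by
  induction K generalizing m with
  | zero => exact ⟨0, fun y _ => by simp⟩
  | succ K ih =>
    refine ⟨⟨0, fun y _ => by simp⟩, fun y _ => differentiableAt_const _, fun w => ?_⟩
    refine (ih (m := m - 1)).congr fun y _ => ?_
    simp [_root_.dirDeriv]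

theorem isSymbol_const (z : ℂ) : IsSymbol r K 0 (fun _ : E => z) := by
  cases K with
  | zero => exact ⟨‖z‖, fun y _ => by simp⟩
  | succ K =>
    refine ⟨⟨‖z‖, fun y _ => by simp⟩, fun y _ => differentiableAt_const _, fun w => ?_⟩
    refine (isSymbol_zero (m := 0 - 1)).congr fun y _ => ?_
    simp [_root_.dirDeriv]

theorem IsSymbol.const_mul (hr : 0 < r) (z : ℂ) (ha : IsSymbol r K m a) :
    IsSymbol r K m (fun y => z * a y) := by
  simpa using (isSymbol_const z).mul hr ha

theorem IsSymbol.sum {ι : Type*} (s : Finset ι) {f : ι → E → ℂ}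
    (hf : ∀ i ∈ s, IsSymbol r K m (f i)) : IsSymbol r K m (fun y => ∑ i ∈ s, f i y) := by
  classical
  induction s using Finset.induction_on with
  | empty => simpa using isSymbol_zero
  | insert i s hi ih =>
    simp only [Finset.sum_insert hi]
    exact (hf i (by simp)).add (ih fun j hj => hf j (by simp [hj]))

theorem IsSymbol.of_le {K' : ℕ} (hK : K ≤ K') (ha : IsSymbol r K' m a) : IsSymbol r K m a := by
  induction hK with
  | refl => exact ha
  | step _ ih => exact ih ha.of_succ

/-- Homogeneity reduces the bound to the compact unit sphere, and a derivative of a function of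
degree `m` is homogeneous of degree `m - 1`. This supplies all symbols needed here: powers of the
norm, components of `y / ‖y‖`, and `Y (y / ‖y‖)`. -/
theorem isSymbol_of_homogeneous [FiniteDimensional ℝ E] (hr : 0 < r)
    (ha : ∀ y, y ≠ 0 → ContDiffAt ℝ K a y)
    (hm : ∀ (t : ℝ) (y : E), 0 < t → y ≠ 0 → a (t • y) = ((t ^ m : ℝ) : ℂ) * a y) :
    IsSymbol r K m a := by
  have key : ∀ {m : ℝ} {a : E → ℂ}, (∀ y, y ≠ 0 → ContinuousAt a y) →
      (∀ (t : ℝ) (y : E), 0 < t → y ≠ 0 → a (t • y) = ((t ^ m : ℝ) : ℂ) * a y) →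
      ∃ C : ℝ, ∀ y, r < ‖y‖ → ‖a y‖ ≤ C * ‖y‖ ^ m := by
    intro m a ha hm
    obtain ⟨C, hC⟩ := (isCompact_sphere (0 : E) 1).exists_bound_of_continuousOn (f := a)
      (fun y hy => (ha y (by rintro rfl; simp at hy)).continuousWithinAt)
    refine ⟨C, fun y hy => ?_⟩
    have hy0 : 0 < ‖y‖ := hr.trans hy
    have hy1 : ‖y‖⁻¹ • y ∈ sphere (0 : E) 1 := by
      rw [mem_sphere_zero_iff_norm, norm_smul, norm_inv, norm_norm, inv_mul_cancel₀ hy0.ne']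
    have hy2 : ‖y‖⁻¹ • y ≠ 0 := by
      rw [← norm_pos_iff]; rw [mem_sphere_zero_iff_norm] at hy1; rw [hy1]; norm_num
    have h := hm ‖y‖ (‖y‖⁻¹ • y) hy0 hy2
    rw [smul_smul, mul_inv_cancel₀ hy0.ne', one_smul] at h
    rw [h, norm_mul, Complex.norm_real, Real.norm_of_nonneg (by positivity), mul_comm]
    gcongr
    exact hC _ hy1
  induction K generalizing m a with
  | zero => exact key (fun y hy => (ha y hy).continuousAt) hm
  | succ K ih =>
    have hd : ∀ y, y ≠ 0 → DifferentiableAt ℝ a y := fun y hy =>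
      (ha y hy).differentiableAt (by simp)
    have hn : ∀ y : E, r < ‖y‖ → y ≠ 0 := fun y hy => by
      rw [← norm_pos_iff]; exact hr.trans hy
    refine ⟨key (fun y hy => (ha y hy).continuousAt) hm, fun y hy => hd y (hn y hy), fun w => ?_⟩
    refine ih (fun y hy => ?_) fun t y ht hy => ?_
    · exact ((ha y hy).fderiv_right (m := K) (by norm_cast)).clm_apply contDiffAt_const
    · have hty : t • y ≠ 0 := smul_ne_zero ht.ne' hy
      have h1 : HasFDerivAt (fun z => a (t • z)) ((fderiv ℝ a (t • y)).comp
          (t • ContinuousLinearMap.id ℝ E)) y :=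
        (hd _ hty).hasFDerivAt.comp y ((hasFDerivAt_id y).const_smul t)
      have h2 : HasFDerivAt (fun z => ((t ^ m : ℝ) : ℂ) * a z)
          (((t ^ m : ℝ) : ℂ) • fderiv ℝ a y) y := (hd y hy).hasFDerivAt.const_mul _
      have h3 : (fun z => a (t • z)) =ᶠ[𝓝 y] fun z => ((t ^ m : ℝ) : ℂ) * a z := by
        filter_upwards [isOpen_ne.mem_nhds hy] with z hz
        exact hm t z ht hz
      have h4 := congrArg (fun L => L w) (h1.unique (h2.congr_of_eventuallyEq h3))
      simp only [ContinuousLinearMap.comp_apply, smul_apply, ContinuousLinearMap.id_apply,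
        map_smul, Complex.real_smul, smul_eq_mul] at h4
      have ht0 : (t : ℂ) ≠ 0 := by exact_mod_cast ht.ne'
      simp only [_root_.dirDeriv]
      rw [Real.rpow_sub_one ht.ne']
      push_cast
      rw [div_mul_eq_mul_div, eq_div_iff ht0, ← h4, mul_comm]

end Normed

end SymbolClasses

/-! ### Outgoing initial values and their stability. -/

section Outgoing

open Filter Topology
open scoped RealInnerProductSpace

section Radial

variable {E : Type*} [NormedAddCommGroup E] [InnerProductSpace ℝ E]

/-- The component in the direction `w` of the unit vector `y / ‖y‖`. -/
noncomputable def radialComp (w y : E) : ℝ := ⟪y, w⟫ / ‖y‖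

theorem hasFDerivAt_norm_of_ne_zero {y : E} (hy : y ≠ 0) :
    HasFDerivAt (fun z : E => ‖z‖) (‖y‖⁻¹ • innerSL ℝ y) y := by
  have h := (hasStrictFDerivAt_norm_sq y).hasFDerivAt.sqrt (pow_ne_zero 2 (norm_ne_zero_iff.2 hy))
  simp only [Real.sqrt_sq (norm_nonneg _)] at h
  refine h.congr_fderiv ?_
  ext w
  have := norm_ne_zero_iff.2 hy
  simp only [smul_apply, innerSL_apply_apply, smul_eq_mul, nsmul_eq_mul]
  field_simp
  norm_num

theorem hasFDerivAt_exp_norm {y : E} (hy : y ≠ 0) (k : ℝ) :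
    HasFDerivAt (fun z : E => Complex.exp (Complex.I * ((k * ‖z‖ : ℝ) : ℂ)))
      (Complex.exp (Complex.I * ((k * ‖y‖ : ℝ) : ℂ)) • (Complex.I • Complex.ofRealCLM.comp
        (k • ‖y‖⁻¹ • innerSL ℝ y))) y := by
  have h1 := (hasFDerivAt_norm_of_ne_zero hy).const_mul k
  have h2 := (Complex.ofRealCLM.hasFDerivAt (x := k * ‖y‖)).comp y h1
  exact (h2.const_mul Complex.I).cexp

theorem dirDeriv_exp_mul {y : E} (hy : y ≠ 0) (k : ℝ) {a : E → ℂ} (ha : DifferentiableAt ℝ a y)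
    (w : E) :
    dirDeriv w (fun z => Complex.exp (Complex.I * ((k * ‖z‖ : ℝ) : ℂ)) * a z) y
      = Complex.exp (Complex.I * ((k * ‖y‖ : ℝ) : ℂ))
        * (Complex.I * k * radialComp w y * a y + dirDeriv w a y) := by
  rw [dirDeriv, ((hasFDerivAt_exp_norm hy k).fun_mul ha.hasFDerivAt).fderiv]
  simp only [add_apply, smul_apply, ContinuousLinearMap.comp_apply, innerSL_apply_apply,
    smul_eq_mul, Complex.ofRealCLM_apply, radialComp, dirDeriv]
  push_cast
  ring

theorem radialComp_smul {t : ℝ} (ht : 0 < t) (w y : E) :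
    radialComp w (t • y) = radialComp w y := by
  rw [radialComp, radialComp, real_inner_smul_left, norm_smul, Real.norm_of_nonneg ht.le,
    mul_div_mul_left _ _ ht.ne']

variable [FiniteDimensional ℝ E] {r : ℝ} {K : ℕ} {m : ℝ}

theorem isSymbol_radialComp (hr : 0 < r) (w : E) :
    IsSymbol r K 0 (fun y => (radialComp w y : ℂ)) := by
  refine isSymbol_of_homogeneous hr (fun y hy => ?_) fun t y ht _ => ?_
  · have : ContDiffAt ℝ K (fun y => radialComp w y) y :=
      (contDiffAt_id.inner ℝ contDiffAt_const).div (contDiffAt_norm ℝ hy) (norm_ne_zero_iff.2 hy)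
    exact Complex.ofRealCLM.contDiff.contDiffAt.comp y this
  · rw [radialComp_smul ht]; simp

theorem isSymbol_norm_rpow (hr : 0 < r) : IsSymbol r K m (fun y : E => ((‖y‖ ^ m : ℝ) : ℂ)) := by
  refine isSymbol_of_homogeneous hr (fun y hy => ?_) fun t y ht _ => ?_
  · have : ContDiffAt ℝ K (fun y : E => ‖y‖ ^ m) y :=
      (contDiffAt_norm ℝ hy).rpow_const_of_ne (norm_ne_zero_iff.2 hy)
    exact Complex.ofRealCLM.contDiff.contDiffAt.comp y this
  · rw [norm_smul, Real.norm_of_nonneg ht.le, Real.mul_rpow ht.le (norm_nonneg _)]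
    push_cast; rfl

end Radial

variable {d : ℕ} {r k c m : ℝ} {K : ℕ} {f g h : EuclideanSpace ℝ (Fin d) → ℂ}

/-- Initial values of an outgoing wave: for `‖y‖ > r` they are symbols of order `m` times
`exp (i k ‖y‖)`, and `f` and `g` cancel to the leading order in `c ∂ᵣ f + g`. -/
def IsOutgoing (r k c m : ℝ) (K : ℕ) (f g : EuclideanSpace ℝ (Fin d) → ℂ) : Prop :=
  ∃ a b : EuclideanSpace ℝ (Fin d) → ℂ,
    (∀ y, r < ‖y‖ → f y = Complex.exp (Complex.I * ((k * ‖y‖ : ℝ) : ℂ)) * a y) ∧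
    (∀ y, r < ‖y‖ → g y = Complex.exp (Complex.I * ((k * ‖y‖ : ℝ) : ℂ)) * b y) ∧
    IsSymbol r (K + 1) m a ∧ IsSymbol r K m b ∧
    IsSymbol r K (m - 1) (fun y => Complex.I * k * a y + c⁻¹ * b y)

theorem IsOutgoing.of_le {K' : ℕ} (hK : K ≤ K') (hfg : IsOutgoing r k c m K' f g) :
    IsOutgoing r k c m K f g := by
  obtain ⟨a, b, hf, hg, ha, hb, hab⟩ := hfg
  exact ⟨a, b, hf, hg, ha.of_le (by omega), hb.of_le hK, hab.of_le hK⟩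

theorem ne_zero_of_lt_norm {E : Type*} [NormedAddCommGroup E] (hr : 0 < r) {y : E}
    (hy : r < ‖y‖) : y ≠ 0 := norm_pos_iff.1 (hr.trans hy)

theorem dirDeriv_eq_exp_mul (hr : 0 < r) {a : EuclideanSpace ℝ (Fin d) → ℂ}
    (hf : ∀ y, r < ‖y‖ → f y = Complex.exp (Complex.I * ((k * ‖y‖ : ℝ) : ℂ)) * a y)
    (ha : IsSymbol r (K + 1) m a) (w : EuclideanSpace ℝ (Fin d)) (y : EuclideanSpace ℝ (Fin d))
    (hy : r < ‖y‖) : dirDeriv w f y = Complex.exp (Complex.I * ((k * ‖y‖ : ℝ) : ℂ))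
        * (Complex.I * k * radialComp w y * a y + dirDeriv w a y) := by
  rw [dirDeriv_congr_of_lt_norm hf w hy,
    dirDeriv_exp_mul (ne_zero_of_lt_norm hr hy) k (ha.differentiableAt hy)]

theorem IsSymbol.radial_mul (hr : 0 < r) {a : EuclideanSpace ℝ (Fin d) → ℂ}
    (ha : IsSymbol r K m a) (z : ℂ) (w : EuclideanSpace ℝ (Fin d)) :
    IsSymbol r K m (fun y => z * radialComp w y * a y) := by
  have := ((isSymbol_radialComp hr w).const_mul hr z).mul hr ha
  rwa [zero_add] at this

/-- `∂_w` acts on amplitudes as the operator `i k n_w + ∂_w`, where `n_w` is the radial component of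
`w`. The defect `i k a + c⁻¹ b` is linear in the amplitudes, hence is transformed by the same
operator and keeps its order `m - 1`. -/
theorem IsOutgoing.dirDeriv (hr : 0 < r) (hfg : IsOutgoing r k c m (K + 1) f g)
    (w : EuclideanSpace ℝ (Fin d)) :
    IsOutgoing r k c m K (dirDeriv w f) (dirDeriv w g) := by
  obtain ⟨a, b, hf, hg, ha, hb, hab⟩ := hfg
  refine ⟨fun y => Complex.I * k * radialComp w y * a y + _root_.dirDeriv w a y,
    fun y => Complex.I * k * radialComp w y * b y + _root_.dirDeriv w b y,
    dirDeriv_eq_exp_mul hr hf ha w, dirDeriv_eq_exp_mul hr hg hb w,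
    (ha.of_succ.radial_mul hr _ w).add ((ha.dirDeriv w).mono hr (by linarith)),
    (hb.of_succ.radial_mul hr _ w).add ((hb.dirDeriv w).mono hr (by linarith)), ?_⟩
  refine ((hab.of_succ.radial_mul hr (Complex.I * k) w).add
    ((hab.dirDeriv w).mono hr (by linarith))).congr fun y hy => ?_
  have h1 : _root_.dirDeriv w (fun y => Complex.I * k * a y + c⁻¹ * b y) y
      = Complex.I * k * _root_.dirDeriv w a y + c⁻¹ * _root_.dirDeriv w b y := by
    simp only [_root_.dirDeriv]
    rw [fderiv_fun_add ((ha.differentiableAt hy).const_mul _) ((hb.differentiableAt hy).const_mul _),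
      fderiv_const_mul (ha.differentiableAt hy), fderiv_const_mul (hb.differentiableAt hy)]
    simp
  rw [h1]
  ring

theorem sum_radialComp_sq {y : EuclideanSpace ℝ (Fin d)} (hy : y ≠ 0) :
    ∑ i, (radialComp (EuclideanSpace.single i 1) y : ℂ) ^ 2 = 1 := by
  have h : ∑ i, radialComp (EuclideanSpace.single i 1) y ^ 2 = 1 := by
    have h1 : ∀ i, ⟪y, EuclideanSpace.single i (1 : ℝ)⟫ = y i := fun i => by
      simp [EuclideanSpace.inner_single_right]
    simp only [radialComp, h1, div_pow]
    rw [← Finset.sum_div, ← EuclideanSpace.real_norm_sq_eq,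
      div_self (pow_ne_zero 2 (norm_ne_zero_iff.2 hy))]
  exact_mod_cast h

/-- The time derivative of an outgoing wave is an outgoing wave. -/
theorem IsOutgoing.next (hr : 0 < r) (hc : 0 < c) (hfg : IsOutgoing r k c m (K + 1) f g)
    (hh : h = fun y => c ^ 2 • sumSndDeriv f y) : IsOutgoing r k c m K g h := by
  obtain ⟨a, b, hf, hg, ha, hb, hab⟩ := hfg
  set e : Fin d → EuclideanSpace ℝ (Fin d) := fun i => EuclideanSpace.single i 1 with he
  set p : Fin d → EuclideanSpace ℝ (Fin d) → ℂ := fun i y =>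
    Complex.I * k * radialComp (e i) y * a y with hp
  set q : Fin d → EuclideanSpace ℝ (Fin d) → ℂ := fun i => _root_.dirDeriv (e i) a with hq
  have hps : ∀ i, IsSymbol r (K + 2) m (p i) := fun i => ha.radial_mul hr _ (e i)
  have hqs : ∀ i, IsSymbol r (K + 1) (m - 1) (q i) := fun i => ha.dirDeriv (e i)
  -- the lower order part of `exp (-i k ‖y‖) Δ f`
  set l : EuclideanSpace ℝ (Fin d) → ℂ := fun y => ∑ i,
    (Complex.I * k * radialComp (e i) y * q i y
      + _root_.dirDeriv (e i) (fun y => p i y + q i y) y) with hl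
  have hpq : ∀ i, IsSymbol r (K + 1) m (fun y => p i y + q i y) := fun i =>
    (hps i).of_succ.add ((hqs i).mono hr (by linarith))
  have hls : IsSymbol r K (m - 1) l := IsSymbol.sum _ fun i _ =>
    (((hqs i).of_succ).radial_mul hr _ (e i)).add ((hpq i).dirDeriv (e i))
  -- The leading part of `Δf` is `-k² a`, because the squares of the radial components sum to `1`.
  have hlap : ∀ y, r < ‖y‖ → sumSndDeriv f y
      = Complex.exp (Complex.I * ((k * ‖y‖ : ℝ) : ℂ)) * (-k ^ 2 * a y + l y) := by
    intro y hy
    have h1 : ∀ i, _root_.dirDeriv (e i) (_root_.dirDeriv (e i) f) y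
        = Complex.exp (Complex.I * ((k * ‖y‖ : ℝ) : ℂ)) * (-k ^ 2 * a y
          * (radialComp (e i) y : ℂ) ^ 2 + (Complex.I * k * radialComp (e i) y * q i y
      + _root_.dirDeriv (e i) (fun y => p i y + q i y) y)) := by
      intro i
      rw [dirDeriv_eq_exp_mul hr (dirDeriv_eq_exp_mul hr hf ha (e i)) (hpq i) (e i) y hy]
      congr 1
      simp only [hp]
      linear_combination (k ^ 2 * radialComp (e i) y ^ 2 * a y : ℂ) * Complex.I_sq
    rw [sumSndDeriv, Finset.sum_congr rfl fun i _ => h1 i, ← Finset.mul_sum,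
      Finset.sum_add_distrib, ← Finset.mul_sum, sum_radialComp_sq (ne_zero_of_lt_norm hr hy),
      mul_one]
  refine ⟨b, fun y => c ^ 2 * (-k ^ 2 * a y + l y), hg, fun y hy => ?_, hb, ?_, ?_⟩
  · rw [hh]
    simp only [hlap y hy, Complex.real_smul]
    push_cast; ring
  · have hak := (ha.of_succ.of_succ.const_mul hr (-k ^ 2 : ℂ))
    exact (hak.add (hls.mono hr (by linarith))).const_mul hr _
  -- The new defect `i k b + c (-k² a + l)` equals `i k c (i k a + c⁻¹ b) + c l`: the old defect and
  -- a term of lower order.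
  · refine ((hab.of_succ.const_mul hr (Complex.I * k * c)).add (hls.const_mul hr c)).congr
      fun y _ => ?_
    have hc' : (c : ℂ) ≠ 0 := by exact_mod_cast hc.ne'
    rw [Complex.ofReal_inv]
    field_simp
    linear_combination (c * k ^ 2 * a y : ℂ) * Complex.I_sq

/-- With `m = -n/2`, the derivative `A'` is `(i k + m/ρ) A`. So the amplitude of `-c A' Y` is `-c (i
k + m/ρ) a`, and the defect is exactly `-(m/ρ) a`. -/
theorem isOutgoing_polarProduct {n K : ℕ} {r k c : ℝ} (hr : 0 < r) (hc : 0 < c) {A : ℝ → ℂ}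
    {Y : EuclideanSpace ℝ (Fin (n + 1)) → ℂ} (hY : IsCkOnSphere (K + 1) Y)
    (hA : ∀ ρ, r < ρ →
      A ρ = Complex.exp (Complex.I * ((k * ρ : ℝ) : ℂ)) / ((ρ ^ ((n : ℝ) / 2) : ℝ) : ℂ)) :
    IsOutgoing r k c (-((n : ℝ) / 2)) K (polarProduct A Y)
      (polarProduct (fun ρ => -(c : ℂ) * derivWithin A (Ici 0) ρ) Y) := by
  set m : ℝ := -((n : ℝ) / 2) with hm
  set a : EuclideanSpace ℝ (Fin (n + 1)) → ℂ :=
    fun y => ((‖y‖ ^ m : ℝ) : ℂ) * Y (‖y‖⁻¹ • y) with ha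
  have hA' : ∀ ρ, r < ρ → A ρ = Complex.exp (Complex.I * ((k * ρ : ℝ) : ℂ)) * ((ρ ^ m : ℝ) : ℂ) := by
    intro ρ hρ
    rw [hA ρ hρ, hm, Real.rpow_neg (hr.trans hρ).le, div_eq_mul_inv]
    push_cast; rfl
  have hdA : ∀ ρ, r < ρ → derivWithin A (Ici 0) ρ
      = Complex.exp (Complex.I * ((k * ρ : ℝ) : ℂ))
        * ((Complex.I * k + m * ((ρ ^ (-1 : ℝ) : ℝ) : ℂ)) * ((ρ ^ m : ℝ) : ℂ)) := by
    intro ρ hρ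
    have hρ0 : 0 < ρ := hr.trans hρ
    have h1 : HasDerivAt (fun ρ : ℝ => Complex.exp (Complex.I * ((k * ρ : ℝ) : ℂ)))
        (Complex.exp (Complex.I * ((k * ρ : ℝ) : ℂ)) * (Complex.I * ((k : ℝ) : ℂ))) ρ := by
      have := ((hasDerivAt_id ρ).const_mul k).ofReal_comp
      simp only [id, mul_one] at this
      exact (this.const_mul Complex.I).cexp
    have h2 : HasDerivAt (fun ρ : ℝ => ((ρ ^ m : ℝ) : ℂ)) ((m * ρ ^ (m - 1) : ℝ) : ℂ) ρ :=
      (Real.hasDerivAt_rpow_const (Or.inl hρ0.ne')).ofReal_comp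
    have h3 : HasDerivAt A _ ρ := (h1.mul h2).congr_of_eventuallyEq (by
      filter_upwards [lt_mem_nhds hρ] with s hs
      exact hA' s hs)
    rw [h3.hasDerivWithinAt.derivWithin (uniqueDiffOn_Ici 0 ρ hρ0.le), sub_eq_add_neg m,
      Real.rpow_add hρ0]
    push_cast
    ring
  have has : IsSymbol r (K + 1) m a := by
    have hYs : IsSymbol r (K + 1) 0 (fun y => Y (‖y‖⁻¹ • y)) := by
      refine isSymbol_of_homogeneous hr (fun y hy => by exact_mod_cast hY.contDiffAt hy)
        fun t y ht _ => ?_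
      rw [norm_smul, Real.norm_of_nonneg ht.le, smul_smul, mul_inv_rev, mul_assoc,
        inv_mul_cancel₀ ht.ne']
      simp
    simpa using (isSymbol_norm_rpow (m := m) hr).mul hr hYs
  have hla : IsSymbol r (K + 1) (m - 1) (fun y => ((‖y‖ ^ (-1 : ℝ) : ℝ) : ℂ) * a y) := by
    have := (isSymbol_norm_rpow (m := -1) hr).mul hr has
    rwa [neg_add_eq_sub] at this
  refine ⟨a, fun y => -(c : ℂ) * (Complex.I * k * a y
    + m * (((‖y‖ ^ (-1 : ℝ) : ℝ) : ℂ) * a y)), fun y hy => ?_, fun y hy => ?_, has, ?_, ?_⟩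
  · rw [polarProduct, hA' _ hy]; simp only [ha]; ring
  · rw [polarProduct, hdA _ hy]; simp only [ha]; ring
  · exact ((has.of_succ.const_mul hr (Complex.I * k)).add ((hla.of_succ.const_mul hr m).mono hr
      (by linarith))).const_mul hr _
  · refine (hla.of_succ.const_mul hr (-m)).congr fun y _ => ?_
    have hc' : (c : ℂ) ≠ 0 := by exact_mod_cast hc.ne'
    rw [Complex.ofReal_inv]
    field_simp
    ring

end Outgoing

/-! ### Stationary phase on a meridian. -/

section Oscillatory

open MeasureTheory Filter Topology intervalIntegral
open Real (sin cos)

theorem integral_one_add_mul_rpow_le {β : ℝ} (hβ : 0 < β) {l : ℝ} (hl : 0 ≤ l) :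
    ∫ φ in 0..l, (1 + β * φ) ^ (-(3 / 2) : ℝ) ≤ 2 / β := by
  have hpos : ∀ φ ∈ uIcc 0 l, 0 < 1 + β * φ := fun φ hφ => by
    rw [uIcc_of_le hl] at hφ
    have := mul_nonneg hβ.le hφ.1
    linarith
  have hd : ∀ φ ∈ uIcc 0 l, HasDerivAt (fun φ => -(2 / β) * (1 + β * φ) ^ (-(1 / 2) : ℝ))
      ((1 + β * φ) ^ (-(3 / 2) : ℝ)) φ := by
    intro φ hφ
    have h1 : HasDerivAt (fun φ => 1 + β * φ) β φ := by
      simpa using ((hasDerivAt_id φ).const_mul β).const_add 1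
    have h2 := (h1.rpow_const (p := -(1 / 2)) (Or.inl (hpos φ hφ).ne')).const_mul (-(2 / β))
    refine h2.congr_deriv ?_
    rw [show (-(1 / 2) - 1 : ℝ) = -(3 / 2) by norm_num]
    field_simp
  rw [integral_eq_sub_of_hasDerivAt hd]
  · have : 0 ≤ (2 / β) * (1 + β * l) ^ (-(1 / 2) : ℝ) :=
      mul_nonneg (by positivity) (Real.rpow_nonneg (hpos l right_mem_uIcc).le _)
    simp only [mul_zero, add_zero, Real.one_rpow]
    linarith
  · refine ContinuousOn.intervalIntegrable fun φ hφ => ?_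
    have hc : ContinuousAt (fun φ => 1 + β * φ) φ := by fun_prop
    exact (hc.rpow_const (Or.inl (hpos φ hφ).ne')).continuousWithinAt

theorem integral_inv_one_add_sq_le {α : ℝ} (hα : 0 < α) (a b s : ℝ) :
    ∫ φ in a..b, (1 + (α * (φ - s)) ^ 2)⁻¹ ≤ Real.pi / α := by
  have hd : ∀ φ ∈ uIcc a b, HasDerivAt (fun φ => α⁻¹ * Real.arctan (α * (φ - s)))
      ((1 + (α * (φ - s)) ^ 2)⁻¹) φ := by
    intro φ _
    have h1 : HasDerivAt (fun φ => α * (φ - s)) α φ := by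
      simpa using ((hasDerivAt_id φ).sub_const s).const_mul α
    refine (h1.arctan.const_mul α⁻¹).congr_deriv ?_
    field_simp
  rw [integral_eq_sub_of_hasDerivAt hd]
  · have h1 := Real.arctan_lt_pi_div_two (α * (b - s))
    have h2 := Real.neg_pi_div_two_lt_arctan (α * (a - s))
    rw [← mul_sub, inv_mul_eq_div]
    gcongr
    linarith
  · refine (Continuous.inv₀ (by fun_prop) fun φ => ?_).intervalIntegrable _ _
    positivity

/-- An integrable majorant for the oscillatory integrals over a meridian. -/
noncomputable def meridianBound (R φ : ℝ) : ℝ :=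
  3 * (2 * (√R)⁻¹ * (1 + (2 / Real.pi * √R * (φ - Real.pi / 2)) ^ 2)⁻¹ + 2 / R)
    + ((1 + 2 / Real.pi * R * φ) ^ (-(3 / 2) : ℝ)
      + (1 + 2 / Real.pi * R * (Real.pi - φ)) ^ (-(3 / 2) : ℝ))

theorem continuousOn_meridianBound {R : ℝ} (hR : 0 < R) :
    ContinuousOn (meridianBound R) (Icc 0 Real.pi) := by
  have hpi := Real.pi_pos
  intro φ hφ
  have h1 : 0 < 1 + 2 / Real.pi * R * φ := by
    have := hφ.1; positivity
  have h2 : 0 < 1 + 2 / Real.pi * R * (Real.pi - φ) := by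
    have : 0 ≤ Real.pi - φ := by linarith [hφ.2]
    positivity
  have h3 : 1 + (2 / Real.pi * √R * (φ - Real.pi / 2)) ^ 2 ≠ 0 := by positivity
  unfold meridianBound
  refine ContinuousAt.continuousWithinAt (ContinuousAt.add ?_ (ContinuousAt.add ?_ ?_))
  · fun_prop (disch := assumption)
  · exact ContinuousAt.rpow_const (by fun_prop) (Or.inl h1.ne')
  · exact ContinuousAt.rpow_const (by fun_prop) (Or.inl h2.ne')

theorem integral_meridianBound_le {R : ℝ} (hR : 0 < R) :
    ∫ φ in 0..Real.pi, meridianBound R φ ≤ 58 / R := by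
  have hpi := Real.pi_pos
  have hpi2 := Real.pi_lt_d2
  have hsq : 0 < √R := Real.sqrt_pos.2 hR
  have hβ : 0 < 2 / Real.pi * R := by positivity
  have hα : 0 < 2 / Real.pi * √R := by positivity
  have c1 : Continuous fun φ => (1 + (2 / Real.pi * √R * (φ - Real.pi / 2)) ^ 2)⁻¹ :=
    Continuous.inv₀ (by fun_prop) fun φ => by positivity
  have i2 : IntervalIntegrable (fun φ => (1 + 2 / Real.pi * R * φ) ^ (-(3 / 2) : ℝ)) volume
      0 Real.pi := by
    refine ContinuousOn.intervalIntegrable fun φ hφ => ?_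
    rw [uIcc_of_le hpi.le] at hφ
    have h1 : 0 < 1 + 2 / Real.pi * R * φ := by
      have := hφ.1; positivity
    have hc : ContinuousAt (fun φ => 1 + 2 / Real.pi * R * φ) φ := by fun_prop
    exact (hc.rpow_const (Or.inl h1.ne')).continuousWithinAt
  have i3 : IntervalIntegrable (fun φ => (1 + 2 / Real.pi * R * (Real.pi - φ)) ^ (-(3 / 2) : ℝ))
      volume 0 Real.pi := by
    have := i2.comp_sub_left Real.pi
    simpa using this.symm
  have e3 : ∫ φ in 0..Real.pi, (1 + 2 / Real.pi * R * (Real.pi - φ)) ^ (-(3 / 2) : ℝ)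
      = ∫ φ in 0..Real.pi, (1 + 2 / Real.pi * R * φ) ^ (-(3 / 2) : ℝ) := by
    rw [intervalIntegral.integral_comp_sub_left
      (fun φ => (1 + 2 / Real.pi * R * φ) ^ (-(3 / 2) : ℝ)) Real.pi]
    simp
  have e1 := integral_inv_one_add_sq_le hα 0 Real.pi (Real.pi / 2)
  have e2 := integral_one_add_mul_rpow_le hβ hpi.le
  have hi1 : IntervalIntegrable (fun φ => 3 * (2 * (√R)⁻¹ *
      (1 + (2 / Real.pi * √R * (φ - Real.pi / 2)) ^ 2)⁻¹ + 2 / R)) volume 0 Real.pi :=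
    Continuous.intervalIntegrable (by fun_prop) _ _
  unfold meridianBound
  rw [intervalIntegral.integral_add hi1 (i2.add i3), intervalIntegral.integral_add i2 i3, e3,
    intervalIntegral.integral_const_mul, intervalIntegral.integral_add
    (Continuous.intervalIntegrable (by fun_prop) _ _) intervalIntegrable_const,
    intervalIntegral.integral_const_mul, intervalIntegral.integral_const]
  have f1 : 2 * (√R)⁻¹ * (Real.pi / (2 / Real.pi * √R)) = Real.pi ^ 2 / R := by
    rw [← Real.sq_sqrt hR.le]
    simp only [Real.sqrt_sq hsq.le]
    field_simp
  have f2 : 2 / (2 / Real.pi * R) = Real.pi / R := by field_simp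
  have f3 : 2 * (√R)⁻¹ * ∫ φ in 0..Real.pi, (1 + (2 / Real.pi * √R * (φ - Real.pi / 2)) ^ 2)⁻¹
      ≤ Real.pi ^ 2 / R := by
    rw [← f1]; gcongr
  rw [f2] at e2
  have f4 : (Real.pi - 0) • (2 / R) = 2 * Real.pi / R := by
    rw [smul_eq_mul]; ring
  rw [f4]
  calc _ ≤ 3 * (Real.pi ^ 2 / R + 2 * Real.pi / R) + (Real.pi / R + Real.pi / R) := by gcongr
    _ = (3 * (Real.pi ^ 2 + 2 * Real.pi) + 2 * Real.pi) / R := by ring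
    -- The numerator is `3 π² + 8 π`, below `55` for `π < 3.15`.
    _ ≤ 58 / R := by
      gcongr
      nlinarith

/-- Jordan's inequality `sin x ≥ 2x/π` is used at the equator and at both poles. Where `sin φ ≥
1/2`, the amplitude is `O(R^(-1/2))` and the other factor is a Lorentzian of width `R^(-1/2)`;
elsewhere `cos² φ ≥ 3/4`, so that factor is `O(1/R)`. The power `-3/2` is integrable with mass
`O(1/R)` at each pole. -/
theorem meridian_weights_le {R φ : ℝ} (hR : 0 < R) (hφ : φ ∈ Icc 0 Real.pi) :
    3 * ((1 + R * sin φ) ^ (-(1 / 2) : ℝ) * (1 + R * cos φ ^ 2)⁻¹)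
      + (1 + R * sin φ) ^ (-(3 / 2) : ℝ) ≤ meridianBound R φ := by
  have hpi := Real.pi_pos
  have hs : 0 ≤ sin φ := Real.sin_nonneg_of_mem_Icc hφ
  have hsq : 0 < √R := Real.sqrt_pos.2 hR
  have hRs : 0 < 1 + R * sin φ := by positivity
  have hsc := Real.sin_sq_add_cos_sq φ
  unfold meridianBound
  refine add_le_add (mul_le_mul_of_nonneg_left ?_ (by norm_num)) ?_
  · rcases le_or_gt (1 / 2) (sin φ) with h | h
    · have h1 : (1 + R * sin φ) ^ (-(1 / 2) : ℝ) ≤ 2 * (√R)⁻¹ := by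
        calc (1 + R * sin φ) ^ (-(1 / 2) : ℝ) ≤ (R / 4) ^ (-(1 / 2) : ℝ) :=
              Real.rpow_le_rpow_of_nonpos (by positivity) (by nlinarith) (by norm_num)
          _ = 2 * (√R)⁻¹ := by
              rw [Real.rpow_neg (by positivity), ← Real.sqrt_eq_rpow, Real.sqrt_div hR.le,
                show (4 : ℝ) = 2 ^ 2 by norm_num, Real.sqrt_sq (by norm_num)]
              field_simp
      have h2 : 2 / Real.pi * |φ - Real.pi / 2| ≤ |cos φ| := by
        have := Real.mul_abs_le_abs_sin (x := φ - Real.pi / 2)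
          (by rw [abs_le]; constructor <;> linarith [hφ.1, hφ.2])
        rwa [Real.sin_sub_pi_div_two, abs_neg] at this
      have h3 : (2 / Real.pi * √R * (φ - Real.pi / 2)) ^ 2 ≤ R * cos φ ^ 2 := by
        have h4 : (2 / Real.pi * (φ - Real.pi / 2)) ^ 2 ≤ cos φ ^ 2 := by
          rw [sq_le_sq, abs_mul, abs_of_pos (by positivity : 0 < 2 / Real.pi)]
          exact h2
        calc _ = (√R) ^ 2 * (2 / Real.pi * (φ - Real.pi / 2)) ^ 2 := by ring
          _ ≤ _ := by rw [Real.sq_sqrt hR.le]; gcongr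
      have h5 : (1 + R * sin φ) ^ (-(1 / 2) : ℝ) * (1 + R * cos φ ^ 2)⁻¹
          ≤ 2 * (√R)⁻¹ * (1 + (2 / Real.pi * √R * (φ - Real.pi / 2)) ^ 2)⁻¹ := by
        gcongr
      have : 0 < 2 / R := by positivity
      linarith
    · have h1 : (1 + R * sin φ) ^ (-(1 / 2) : ℝ) ≤ 1 :=
        Real.rpow_le_one_of_one_le_of_nonpos (by nlinarith) (by norm_num)
      have h2 : (1 + R * cos φ ^ 2)⁻¹ ≤ 2 / R := by
        rw [inv_le_comm₀ (by positivity) (by positivity), inv_div]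
        nlinarith
      have h3 : (1 + R * sin φ) ^ (-(1 / 2) : ℝ) * (1 + R * cos φ ^ 2)⁻¹ ≤ 1 * (2 / R) := by
        gcongr
      have : 0 ≤ 2 * (√R)⁻¹ * (1 + (2 / Real.pi * √R * (φ - Real.pi / 2)) ^ 2)⁻¹ := by positivity
      linarith
  · have h2 : 0 ≤ Real.pi - φ := by linarith [hφ.2]
    have hφ0 := hφ.1
    have p1 : 0 ≤ (1 + 2 / Real.pi * R * φ) ^ (-(3 / 2) : ℝ) := by positivity
    have p2 : 0 ≤ (1 + 2 / Real.pi * R * (Real.pi - φ)) ^ (-(3 / 2) : ℝ) := by positivity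
    rcases le_total φ (Real.pi / 2) with h | h
    · have h1 := Real.mul_le_sin hφ.1 h
      have : (1 + R * sin φ) ^ (-(3 / 2) : ℝ) ≤ (1 + 2 / Real.pi * R * φ) ^ (-(3 / 2) : ℝ) :=
        Real.rpow_le_rpow_of_nonpos (by positivity) (by nlinarith) (by norm_num)
      linarith
    · have h1 := Real.mul_le_sin h2 (by linarith)
      rw [Real.sin_pi_sub] at h1
      have : (1 + R * sin φ) ^ (-(3 / 2) : ℝ)
          ≤ (1 + 2 / Real.pi * R * (Real.pi - φ)) ^ (-(3 / 2) : ℝ) :=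
        Real.rpow_le_rpow_of_nonpos (by positivity) (by nlinarith) (by norm_num)
      linarith

/-- The phase `k R sin φ` has derivative `k R cos φ`, zero at the equator. Instead of splitting the
interval, one integrates by parts globally with the regularised inverse `cos φ / (1 + R cos² φ)` of
`R cos φ`. It is accurate away from the equator and bounded at it, and what is left is dominated by
`meridianBound`. -/
theorem norm_integral_oscillatory_le {k R B : ℝ} (hk : 0 < k) (hR : 1 ≤ R) {q q' : ℝ → ℂ}
    (hq : ∀ ρ, HasDerivAt q (q' ρ) ρ) (hq'c : Continuous q')
    (h1 : ∀ ρ, 0 ≤ ρ → ‖q ρ‖ ≤ B * (1 + ρ) ^ (-(1 / 2) : ℝ))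
    (h2 : ∀ ρ, 0 ≤ ρ → ‖q' ρ‖ ≤ B * (1 + ρ) ^ (-(3 / 2) : ℝ)) {w w' : ℝ → ℝ}
    (hw : ∀ φ ∈ Icc 0 Real.pi, HasDerivAt w (w' φ) φ) (hw'c : ContinuousOn w' (Icc 0 Real.pi))
    (hw1 : ∀ φ ∈ Icc 0 Real.pi, |w φ| ≤ 1) (hw2 : ∀ φ ∈ Icc 0 Real.pi, |w' φ| ≤ 1) :
    ‖∫ φ in 0..Real.pi, (w φ : ℂ) * (Complex.exp (Complex.I * ((k * (R * sin φ) : ℝ) : ℂ))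
      * q (R * sin φ))‖ ≤ 60 * (1 + k⁻¹) * B / R := by
  have hpi := Real.pi_pos
  have hR0 : 0 < R := by linarith
  have hB : 0 ≤ B := by
    have := (norm_nonneg _).trans (h1 0 le_rfl)
    simpa using this
  set e : ℝ → ℂ := fun φ => Complex.exp (Complex.I * ((k * (R * sin φ) : ℝ) : ℂ)) with he
  set G : ℝ → ℝ := fun φ => cos φ * (1 + R * cos φ ^ 2)⁻¹ with hG
  set G' : ℝ → ℝ := fun φ => -(sin φ * (1 - R * cos φ ^ 2) * ((1 + R * cos φ ^ 2)⁻¹) ^ 2) with hG'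
  have hden : ∀ φ, 0 < 1 + R * cos φ ^ 2 := fun φ => by positivity
  have hen : ∀ φ, ‖e φ‖ = 1 := fun φ => by
    simp only [he]; rw [mul_comm, Complex.norm_exp_ofReal_mul_I]
  have hed : ∀ φ, HasDerivAt e (e φ * (Complex.I * ((k * (R * cos φ) : ℝ) : ℂ))) φ := fun φ =>
    ((((Real.hasDerivAt_sin φ).const_mul R).const_mul k).ofReal_comp.const_mul Complex.I).cexp
  have hGd : ∀ φ, HasDerivAt G (G' φ) φ := by
    intro φ
    have h3 : HasDerivAt (fun φ => 1 + R * cos φ ^ 2) (R * (2 * cos φ * (-sin φ))) φ := by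
      simpa using (((Real.hasDerivAt_cos φ).pow 2).const_mul R).const_add 1
    refine ((Real.hasDerivAt_cos φ).mul (h3.inv (hden φ).ne')).congr_deriv ?_
    simp only [hG', inv_pow, Pi.inv_apply]
    have := (hden φ).ne'
    field_simp
    ring
  have hqd : ∀ φ, HasDerivAt (fun φ => q (R * sin φ)) (((R * cos φ : ℝ) : ℂ) * q' (R * sin φ)) φ := by
    intro φ
    have : HasDerivAt (fun φ => q (R * sin φ)) ((R * cos φ) • q' (R * sin φ)) φ :=
      (hq (R * sin φ)).scomp φ ((Real.hasDerivAt_sin φ).const_mul R)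
    rwa [Complex.real_smul] at this
  have hF : ∀ φ ∈ uIcc 0 Real.pi, HasDerivAt
      (fun φ => (w φ : ℂ) * (e φ * q (R * sin φ)) * (G φ : ℂ))
      (((w' φ : ℂ) * (e φ * q (R * sin φ)) + (w φ : ℂ) *
        (e φ * (Complex.I * ((k * (R * cos φ) : ℝ) : ℂ)) * q (R * sin φ)
          + e φ * (((R * cos φ : ℝ) : ℂ) * q' (R * sin φ)))) * (G φ : ℂ)
        + (w φ : ℂ) * (e φ * q (R * sin φ)) * (G' φ : ℂ)) φ := by
    intro φ hφ
    rw [uIcc_of_le hpi.le] at hφ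
    exact (((hw φ hφ).ofReal_comp).mul ((hed φ).mul (hqd φ))).mul ((hGd φ).ofReal_comp)
  have hwc : ContinuousOn w (Icc 0 Real.pi) := fun φ hφ =>
    (hw φ hφ).continuousAt.continuousWithinAt
  have hqc : Continuous q := continuous_iff_continuousAt.2 fun ρ => (hq ρ).continuousAt
  have hec : Continuous e := continuous_iff_continuousAt.2 fun ρ => (hed ρ).continuousAt
  have hGc : Continuous G := continuous_iff_continuousAt.2 fun ρ => (hGd ρ).continuousAt
  have hG'c : Continuous G' := by
    have : Continuous fun φ => (1 + R * cos φ ^ 2)⁻¹ :=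
      Continuous.inv₀ (by fun_prop) fun φ => (hden φ).ne'
    simp only [hG']
    fun_prop
  have hwc' : ContinuousOn (fun φ => (w φ : ℂ)) (Icc 0 Real.pi) :=
    Complex.continuous_ofReal.comp_continuousOn hwc
  have hw'c' : ContinuousOn (fun φ => (w' φ : ℂ)) (Icc 0 Real.pi) :=
    Complex.continuous_ofReal.comp_continuousOn hw'c
  have hFi : IntervalIntegrable (fun φ =>
      (((w' φ : ℂ) * (e φ * q (R * sin φ)) + (w φ : ℂ) *
        (e φ * (Complex.I * ((k * (R * cos φ) : ℝ) : ℂ)) * q (R * sin φ)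
          + e φ * (((R * cos φ : ℝ) : ℂ) * q' (R * sin φ)))) * (G φ : ℂ)
        + (w φ : ℂ) * (e φ * q (R * sin φ)) * (G' φ : ℂ))) volume 0 Real.pi := by
    refine ContinuousOn.intervalIntegrable ?_
    rw [uIcc_of_le hpi.le]
    have c1 : Continuous fun φ => e φ * q (R * sin φ) := by fun_prop
    have c2 : Continuous fun φ => e φ * (Complex.I * ((k * (R * cos φ) : ℝ) : ℂ)) * q (R * sin φ)
          + e φ * (((R * cos φ : ℝ) : ℂ) * q' (R * sin φ)) := by fun_prop
    have c3 : Continuous fun φ => (G φ : ℂ) := by fun_prop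
    have c4 : Continuous fun φ => (G' φ : ℂ) := by fun_prop
    exact (((hw'c'.mul c1.continuousOn).add (hwc'.mul c2.continuousOn)).mul c3.continuousOn).add
      ((hwc'.mul c1.continuousOn).mul c4.continuousOn)
  have hI := integral_eq_sub_of_hasDerivAt hF hFi
  have hκi : IntervalIntegrable (fun φ => (w φ : ℂ) * (e φ * q (R * sin φ))) volume 0 Real.pi := by
    refine ContinuousOn.intervalIntegrable ?_
    rw [uIcc_of_le hpi.le]
    exact hwc'.mul (by fun_prop : Continuous fun φ => e φ * q (R * sin φ)).continuousOn
  have hik : (Complex.I * k : ℂ) ≠ 0 := mul_ne_zero Complex.I_ne_zero (by exact_mod_cast hk.ne')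
  -- The derivative of `(i k)⁻¹ w e q G` is subtracted from the integrand and restored through its
  -- boundary values.
  have hsplit : ∫ φ in 0..Real.pi, (w φ : ℂ) * (e φ * q (R * sin φ))
      = (∫ φ in 0..Real.pi, ((w φ : ℂ) * (e φ * q (R * sin φ)) - (Complex.I * k)⁻¹ *
        (((w' φ : ℂ) * (e φ * q (R * sin φ)) + (w φ : ℂ) *
        (e φ * (Complex.I * ((k * (R * cos φ) : ℝ) : ℂ)) * q (R * sin φ)
          + e φ * (((R * cos φ : ℝ) : ℂ) * q' (R * sin φ)))) * (G φ : ℂ)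
        + (w φ : ℂ) * (e φ * q (R * sin φ)) * (G' φ : ℂ))))
      + (Complex.I * k)⁻¹ * ((w Real.pi : ℂ) * (e Real.pi * q (R * sin Real.pi)) * (G Real.pi : ℂ)
        - (w 0 : ℂ) * (e 0 * q (R * sin 0)) * (G 0 : ℂ)) := by
    rw [intervalIntegral.integral_sub hκi (hFi.const_mul _), intervalIntegral.integral_const_mul,
      hI]
    ring
  have hkinv : ‖(Complex.I * k : ℂ)⁻¹‖ = k⁻¹ := by
    rw [norm_inv, norm_mul, Complex.norm_I, one_mul, Complex.norm_real, Real.norm_of_nonneg hk.le]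
  have hpt : ∀ φ ∈ Icc 0 Real.pi, ‖(w φ : ℂ) * (e φ * q (R * sin φ)) - (Complex.I * k)⁻¹ *
        (((w' φ : ℂ) * (e φ * q (R * sin φ)) + (w φ : ℂ) *
        (e φ * (Complex.I * ((k * (R * cos φ) : ℝ) : ℂ)) * q (R * sin φ)
          + e φ * (((R * cos φ : ℝ) : ℂ) * q' (R * sin φ)))) * (G φ : ℂ)
        + (w φ : ℂ) * (e φ * q (R * sin φ)) * (G' φ : ℂ))‖
      ≤ (1 + k⁻¹) * B * meridianBound R φ := by
    intro φ hφ
    have hs : 0 ≤ sin φ := Real.sin_nonneg_of_mem_Icc hφ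
    have hs1 := Real.sin_le_one φ
    have hc1 := Real.abs_cos_le_one φ
    have hden' := hden φ
    set u := (1 + R * cos φ ^ 2)⁻¹ with hu
    have hu0 : 0 < u := inv_pos.2 hden'
    have hu1 : (1 + R * cos φ ^ 2) * u = 1 := mul_inv_cancel₀ hden'.ne'
    have hu1' : (1 + R * (cos φ : ℂ) ^ 2) * u = 1 := by exact_mod_cast hu1
    -- Differentiating the exponential gives `w e q R cos² φ u = w e q (1 - u)`, which cancels the
    -- integrand up to `w e q u`. The other terms come from `w'`, `q'` and `G'`.
    have hid : (w φ : ℂ) * (e φ * q (R * sin φ)) - (Complex.I * k)⁻¹ *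
        (((w' φ : ℂ) * (e φ * q (R * sin φ)) + (w φ : ℂ) *
        (e φ * (Complex.I * ((k * (R * cos φ) : ℝ) : ℂ)) * q (R * sin φ)
          + e φ * (((R * cos φ : ℝ) : ℂ) * q' (R * sin φ)))) * (G φ : ℂ)
        + (w φ : ℂ) * (e φ * q (R * sin φ)) * (G' φ : ℂ))
        = e φ * ((w φ * u : ℝ) * q (R * sin φ) - (Complex.I * k)⁻¹ *
          ((w' φ * (cos φ * u) : ℝ) * q (R * sin φ)
            + (w φ * (R * cos φ ^ 2 * u) : ℝ) * q' (R * sin φ)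
            + (w φ * G' φ : ℝ) * q (R * sin φ))) := by
      have hk1 : (Complex.I * k : ℂ)⁻¹ * (Complex.I * k) = 1 := inv_mul_cancel₀ hik
      simp only [hG, ← hu]
      generalize e φ = e₀ at *
      generalize q (R * sin φ) = q₀ at *
      generalize q' (R * sin φ) = q₁ at *
      generalize G' φ = g at *
      generalize cos φ = t at *
      generalize (Complex.I * k : ℂ)⁻¹ = z at *
      push_cast
      linear_combination (-(w φ * e₀ * q₀ : ℂ)) * hu1' - (w φ * e₀ * q₀ * R * t ^ 2 * u : ℂ) * hk1
    rw [hid, norm_mul, hen, one_mul]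
    have hq1 := h1 (R * sin φ) (by positivity)
    have hq2 := h2 (R * sin φ) (by positivity)
    set X := (1 + R * sin φ) ^ (-(1 / 2) : ℝ) with hX
    set Z := (1 + R * sin φ) ^ (-(3 / 2) : ℝ) with hZ
    have hX0 : 0 ≤ X := by positivity
    have hZ0 : 0 ≤ Z := by positivity
    have b1 : |w φ * u| ≤ u := by
      rw [abs_mul, abs_of_pos hu0]
      nlinarith [hw1 φ hφ]
    have b2 : |w' φ * (cos φ * u)| ≤ u := by
      rw [abs_mul, abs_mul, abs_of_pos hu0]
      calc |w' φ| * (|cos φ| * u) ≤ 1 * (1 * u) := by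
            gcongr
            exact hw2 φ hφ
        _ = u := by ring
    have b3 : |w φ * (R * cos φ ^ 2 * u)| ≤ 1 := by
      have h0 : 0 ≤ R * cos φ ^ 2 * u := by positivity
      rw [abs_mul, abs_of_nonneg h0]
      calc |w φ| * (R * cos φ ^ 2 * u) ≤ 1 * (R * cos φ ^ 2 * u) := by
            gcongr
            exact hw1 φ hφ
        _ ≤ 1 := by linarith
    have b4 : |w φ * G' φ| ≤ u := by
      have h0 : |G' φ| ≤ u := by
        simp only [hG', ← hu]
        have h3 : |1 - R * cos φ ^ 2| ≤ 1 + R * cos φ ^ 2 := by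
          have : 0 ≤ R * cos φ ^ 2 := by positivity
          rw [abs_le]; constructor <;> linarith
        rw [abs_neg, abs_mul, abs_mul, abs_of_nonneg hs, abs_of_pos (pow_pos hu0 2)]
        calc sin φ * |1 - R * cos φ ^ 2| * u ^ 2 ≤ 1 * (1 + R * cos φ ^ 2) * u ^ 2 := by gcongr
          _ = ((1 + R * cos φ ^ 2) * u) * u := by ring
          _ = u := by rw [hu1, one_mul]
      rw [abs_mul]
      calc |w φ| * |G' φ| ≤ 1 * u := by
            gcongr
            exact hw1 φ hφ
        _ = u := one_mul u
    have n1 : ∀ {s : ℝ} {b : ℝ}, |s| ≤ b → ‖(s : ℂ) * q (R * sin φ)‖ ≤ b * (B * X) := by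
      intro s b hs
      rw [norm_mul, Complex.norm_real, Real.norm_eq_abs]
      gcongr
      exact (abs_nonneg s).trans hs
    have n2 : ‖((w φ * (R * cos φ ^ 2 * u) : ℝ) : ℂ) * q' (R * sin φ)‖ ≤ 1 * (B * Z) := by
      rw [norm_mul, Complex.norm_real, Real.norm_eq_abs]
      gcongr
    have hm := meridian_weights_le hR0 hφ
    rw [← hX, ← hZ, ← hu] at hm
    have hki : 0 < k⁻¹ := inv_pos.2 hk
    calc _ ≤ u * (B * X) + k⁻¹ * (u * (B * X) + 1 * (B * Z) + u * (B * X)) := by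
          refine (norm_sub_le _ _).trans (add_le_add (n1 b1) ?_)
          rw [norm_mul, hkinv]
          gcongr
          exact (norm_add_le _ _).trans (add_le_add ((norm_add_le _ _).trans
            (add_le_add (n1 b2) n2)) (n1 b4))
      _ ≤ (1 + k⁻¹) * B * (3 * (X * u) + Z) := by
          have p1 : 0 ≤ B * X * u := by positivity
          have p2 : 0 ≤ B * Z := by positivity
          have p3 : 0 ≤ k⁻¹ * (B * X * u) := by positivity
          nlinarith
      _ ≤ _ := by gcongr
  rw [hsplit]
  have hbd : ‖(Complex.I * k : ℂ)⁻¹ *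
      -- At the poles `q` is merely bounded, but there `|G| = 1 / (1 + R)`.
      ((w Real.pi : ℂ) * (e Real.pi * q (R * sin Real.pi)) * (G Real.pi : ℂ)
        - (w 0 : ℂ) * (e 0 * q (R * sin 0)) * (G 0 : ℂ))‖ ≤ k⁻¹ * (B / R + B / R) := by
    have hend : ∀ φ ∈ Icc 0 Real.pi, sin φ = 0 →
        ‖(w φ : ℂ) * (e φ * q (R * sin φ)) * (G φ : ℂ)‖ ≤ B / R := by
      intro φ hφ h0
      have hq0 : ‖q (R * sin φ)‖ ≤ B := by
        rw [h0, mul_zero]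
        simpa using h1 0 le_rfl
      have hc2 : cos φ ^ 2 = 1 := by
        have := Real.sin_sq_add_cos_sq φ
        rw [h0] at this; linarith
      have hG0 : |G φ| ≤ R⁻¹ := by
        simp only [hG]
        rw [abs_mul, hc2, mul_one, abs_of_pos (by positivity : 0 < (1 + R)⁻¹)]
        calc |cos φ| * (1 + R)⁻¹ ≤ 1 * R⁻¹ := by
              gcongr
              · exact Real.abs_cos_le_one φ
              · linarith
          _ = _ := one_mul _
      rw [norm_mul, norm_mul, norm_mul, hen, one_mul, Complex.norm_real, Complex.norm_real,
        Real.norm_eq_abs, Real.norm_eq_abs]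
      calc |w φ| * ‖q (R * sin φ)‖ * |G φ| ≤ 1 * B * R⁻¹ := by
            gcongr
            exact hw1 φ hφ
        _ = B / R := by rw [one_mul, div_eq_mul_inv]
    rw [norm_mul, hkinv]
    gcongr
    exact (norm_sub_le _ _).trans (add_le_add
      (hend _ ⟨hpi.le, le_rfl⟩ Real.sin_pi) (hend _ ⟨le_rfl, hpi.le⟩ Real.sin_zero))
  have hki : 0 < k⁻¹ := inv_pos.2 hk
  have hmi : IntervalIntegrable (meridianBound R) volume 0 Real.pi := by
    refine ContinuousOn.intervalIntegrable ?_
    rw [uIcc_of_le hpi.le]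
    exact continuousOn_meridianBound hR0
  calc _ ≤ (∫ φ in 0..Real.pi, (1 + k⁻¹) * B * meridianBound R φ) + k⁻¹ * (B / R + B / R) := by
        refine (norm_add_le _ _).trans (add_le_add ?_ hbd)
        refine intervalIntegral.norm_integral_le_of_norm_le hpi.le ?_ (hmi.const_mul _)
        exact Eventually.of_forall fun φ hφ => hpt φ (Ioc_subset_Icc_self hφ)
    _ ≤ (1 + k⁻¹) * B * (58 / R) + k⁻¹ * (B / R + B / R) := by
        rw [intervalIntegral.integral_const_mul]
        gcongr
        exact integral_meridianBound_le hR0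
    _ ≤ 60 * (1 + k⁻¹) * B / R := by
        have : 0 ≤ B / R := by positivity
        have e1 : 60 * (1 + k⁻¹) * B / R = 60 * (1 + k⁻¹) * (B / R) := by ring
        have e2 : (1 + k⁻¹) * B * (58 / R) = 58 * (1 + k⁻¹) * (B / R) := by ring
        rw [e1, e2]
        nlinarith

end Oscillatory

/-! ### Symbols along rays, uniformly in base point and direction. -/

section RaySymbols

open Filter Topology
open scoped RealInnerProductSpace

theorem rpow_le_of_half_le {s ρ : ℝ} (hρ : 0 < ρ) (h1 : ρ / 2 ≤ s) (h2 : s ≤ 2 * ρ) (m : ℝ) :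
    s ^ m ≤ 2 ^ |m| * ρ ^ m := by
  have hs : 0 < s := by linarith
  rcases le_total 0 m with hm | hm
  · rw [abs_of_nonneg hm, ← Real.mul_rpow (by norm_num) hρ.le]
    exact Real.rpow_le_rpow hs.le h2 hm
  · rw [abs_of_nonpos hm, Real.rpow_neg (by norm_num), ← Real.inv_rpow (by norm_num),
      ← Real.mul_rpow (by norm_num) hρ.le]
    exact Real.rpow_le_rpow_of_nonpos (by positivity) (by linarith) hm

section Rays

variable {E : Type*} [NormedAddCommGroup E] [InnerProductSpace ℝ E]
  {r R₀ ρ₂ ρ m m' : ℝ} {x N : E} {τ σ : E → E → ℝ → ℂ}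

/-- The threshold `2 R₀ + 2 r` puts the ray outside the ball of radius `r` and makes `‖x + ρ N‖`
comparable with `ρ`, so symbol orders in the two variables coincide. -/
theorem norm_ray (hr : 0 < r) (hR₀ : 0 ≤ R₀) (hρ₂ : 2 * R₀ + 2 * r ≤ ρ₂) (hx : ‖x‖ ≤ R₀)
    (hN : ‖N‖ = 1) (hρ : ρ₂ < ρ) :
    0 < ρ ∧ |‖x + ρ • N‖ - ρ| ≤ R₀ ∧ r < ‖x + ρ • N‖ ∧ ρ / 2 ≤ ‖x + ρ • N‖
      ∧ ‖x + ρ • N‖ ≤ 2 * ρ := by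
  have hρ0 : 0 < ρ := by linarith
  have hn : ‖ρ • N‖ = ρ := by rw [norm_smul, hN, mul_one, Real.norm_of_nonneg hρ0.le]
  have h := abs_norm_sub_norm_le (x + ρ • N) (ρ • N)
  rw [add_sub_cancel_right, hn] at h
  have h' := h.trans hx
  have h2 := abs_le.1 h'
  refine ⟨hρ0, h', ?_, ?_, ?_⟩ <;> linarith [h2.1, h2.2]

theorem abs_radialComp_ray_sub_one_le (hr : 0 < r) (hR₀ : 0 ≤ R₀) (hρ₂ : 2 * R₀ + 2 * r ≤ ρ₂)
    (hx : ‖x‖ ≤ R₀) (hN : ‖N‖ = 1) (hρ : ρ₂ < ρ) :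
    |radialComp N (x + ρ • N) - 1| ≤ 4 * R₀ * ρ⁻¹ := by
  obtain ⟨hρ0, h1, -, h3, -⟩ := norm_ray hr hR₀ hρ₂ hx hN hρ
  have hy : 0 < ‖x + ρ • N‖ := by linarith
  have hin : ⟪x + ρ • N, N⟫ = ⟪x, N⟫ + ρ := by
    rw [inner_add_left, real_inner_smul_left, real_inner_self_eq_norm_sq, hN]; ring
  have hxN : |⟪x, N⟫| ≤ R₀ := (abs_real_inner_le_norm x N).trans (by rw [hN, mul_one]; exact hx)
  rw [radialComp, hin, div_sub_one hy.ne', abs_div, abs_of_pos hy, div_le_iff₀ hy]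
  have h5 : |⟪x, N⟫ + ρ - ‖x + ρ • N‖| ≤ 2 * R₀ := by
    rw [abs_le] at *
    constructor <;> linarith [hxN.1, hxN.2, h1.1, h1.2]
  calc _ ≤ 2 * R₀ := h5
    _ = 4 * R₀ * ρ⁻¹ * (ρ / 2) := by field_simp; ring
    _ ≤ _ := by gcongr

theorem hasDerivAt_ray : HasDerivAt (fun ρ : ℝ => x + ρ • N) N ρ := by
  simpa using ((hasDerivAt_id ρ).smul_const N).const_add x

theorem hasDerivAt_norm_ray (hy : x + ρ • N ≠ 0) :
    HasDerivAt (fun ρ : ℝ => ‖x + ρ • N‖) (radialComp N (x + ρ • N)) ρ := by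
  refine ((hasFDerivAt_norm_of_ne_zero hy).comp_hasDerivAt ρ hasDerivAt_ray).congr_deriv ?_
  simp only [smul_apply, innerSL_apply_apply, smul_eq_mul, radialComp]
  rw [inv_mul_eq_div]

/-- Functions on the rays `x + ρ N`, `‖x‖ ≤ R₀`, that decay like `ρ ^ m` and gain one order with
the first derivative, uniformly in the ray. -/
def IsRaySymbol (R₀ ρ₂ m : ℝ) (τ : E → E → ℝ → ℂ) : Prop :=
  ∃ C : ℝ, 0 ≤ C ∧ ∀ x N ρ, ‖x‖ ≤ R₀ → ‖N‖ = 1 → ρ₂ < ρ →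
    ∃ τ', HasDerivAt (τ x N) τ' ρ ∧ ‖τ x N ρ‖ ≤ C * ρ ^ m ∧ ‖τ'‖ ≤ C * ρ ^ (m - 1)

theorem IsRaySymbol.congr (hτ : IsRaySymbol R₀ ρ₂ m τ)
    (h : ∀ x N ρ, ‖x‖ ≤ R₀ → ‖N‖ = 1 → ρ₂ < ρ → τ x N ρ = σ x N ρ) : IsRaySymbol R₀ ρ₂ m σ := by
  obtain ⟨C, hC, H⟩ := hτ
  refine ⟨C, hC, fun x N ρ hx hN hρ => ?_⟩
  obtain ⟨τ', h1, h2, h3⟩ := H x N ρ hx hN hρ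
  refine ⟨τ', h1.congr_of_eventuallyEq ?_, h x N ρ hx hN hρ ▸ h2, h3⟩
  filter_upwards [lt_mem_nhds hρ] with s hs
  exact (h x N s hx hN hs).symm

theorem IsRaySymbol.add (hτ : IsRaySymbol R₀ ρ₂ m τ) (hσ : IsRaySymbol R₀ ρ₂ m σ) :
    IsRaySymbol R₀ ρ₂ m (fun x N ρ => τ x N ρ + σ x N ρ) := by
  obtain ⟨C, hC, H⟩ := hτ
  obtain ⟨C', hC', H'⟩ := hσ
  refine ⟨C + C', add_nonneg hC hC', fun x N ρ hx hN hρ => ?_⟩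
  obtain ⟨τ', h1, h2, h3⟩ := H x N ρ hx hN hρ
  obtain ⟨σ', k1, k2, k3⟩ := H' x N ρ hx hN hρ
  refine ⟨τ' + σ', h1.add k1, ?_, ?_⟩
  · exact (norm_add_le _ _).trans (by linarith)
  · exact (norm_add_le _ _).trans (by linarith)

theorem IsRaySymbol.mul (hρ₂ : 0 ≤ ρ₂) (hτ : IsRaySymbol R₀ ρ₂ m τ)
    (hσ : IsRaySymbol R₀ ρ₂ m' σ) :
    IsRaySymbol R₀ ρ₂ (m + m') (fun x N ρ => τ x N ρ * σ x N ρ) := by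
  obtain ⟨C, hC, H⟩ := hτ
  obtain ⟨C', hC', H'⟩ := hσ
  refine ⟨2 * (C * C'), by positivity, fun x N ρ hx hN hρ => ?_⟩
  obtain ⟨τ', h1, h2, h3⟩ := H x N ρ hx hN hρ
  obtain ⟨σ', k1, k2, k3⟩ := H' x N ρ hx hN hρ
  have hρ0 : 0 < ρ := by linarith
  have e1 : ρ ^ (m + m') = ρ ^ m * ρ ^ m' := Real.rpow_add hρ0 _ _
  have e2 : ρ ^ (m + m' - 1) = ρ ^ (m - 1) * ρ ^ m' := by
    rw [← Real.rpow_add hρ0]; congr 1; ring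
  have e3 : ρ ^ (m + m' - 1) = ρ ^ m * ρ ^ (m' - 1) := by
    rw [← Real.rpow_add hρ0]; congr 1; ring
  refine ⟨_, h1.mul k1, ?_, ?_⟩
  · rw [norm_mul, e1]
    have : 0 ≤ C * ρ ^ m * (C' * ρ ^ m') := by positivity
    calc _ ≤ (C * ρ ^ m) * (C' * ρ ^ m') := by gcongr
      _ ≤ _ := by linarith
  · calc _ ≤ ‖τ'‖ * ‖σ x N ρ‖ + ‖τ x N ρ‖ * ‖σ'‖ := by
          refine (norm_add_le _ _).trans ?_
          rw [norm_mul, norm_mul]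
      _ ≤ (C * ρ ^ (m - 1)) * (C' * ρ ^ m') + (C * ρ ^ m) * (C' * ρ ^ (m' - 1)) := by gcongr
      _ = C * C' * (ρ ^ (m - 1) * ρ ^ m') + C * C' * (ρ ^ m * ρ ^ (m' - 1)) := by ring
      _ = _ := by rw [← e2, ← e3]; ring

theorem isRaySymbol_id (hρ₂ : 0 ≤ ρ₂) : IsRaySymbol (E := E) R₀ ρ₂ 1 (fun _ _ ρ => (ρ : ℂ)) := by
  refine ⟨1, zero_le_one, fun x N ρ _ _ hρ => ⟨1, (hasDerivAt_id ρ).ofReal_comp, ?_, by simp⟩⟩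
  simp [abs_of_pos (hρ₂.trans_lt hρ)]

/-- `‖x + ρ N‖ - ρ` has derivative `radialComp N - 1 = O(1/ρ)`. So `exp(ik‖y‖)` may be replaced on
the ray by the pure oscillation `exp(ikρ)` at the cost of a symbol of order `0`. -/
theorem isRaySymbol_phase (hr : 0 < r) (hR₀ : 0 ≤ R₀) (hρ₂ : 2 * R₀ + 2 * r ≤ ρ₂) (k : ℝ) :
    IsRaySymbol (E := E) R₀ ρ₂ 0
      (fun x N ρ => Complex.exp (Complex.I * ((k * (‖x + ρ • N‖ - ρ) : ℝ) : ℂ))) := by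
  refine ⟨1 + |k| * (4 * R₀), by positivity, fun x N ρ hx hN hρ => ?_⟩
  obtain ⟨hρ0, h1, h2, h3, -⟩ := norm_ray hr hR₀ hρ₂ hx hN hρ
  have hn : HasDerivAt (fun ρ : ℝ => k * (‖x + ρ • N‖ - ρ)) (k * (radialComp N (x + ρ • N) - 1))
      ρ := ((hasDerivAt_norm_ray (ne_zero_of_lt_norm hr h2)).sub (hasDerivAt_id ρ)).const_mul k
  refine ⟨_, (hn.ofReal_comp.const_mul Complex.I).cexp, ?_, ?_⟩
  · beta_reduce
    rw [mul_comm Complex.I, Complex.norm_exp_ofReal_mul_I, Real.rpow_zero, mul_one]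
    have : 0 ≤ |k| * (4 * R₀) := by positivity
    linarith
  · have h4 := abs_radialComp_ray_sub_one_le hr hR₀ hρ₂ hx hN hρ
    rw [norm_mul]
    have e1 : ∀ s : ℝ, ‖Complex.exp (Complex.I * (s : ℂ))‖ = 1 := fun s => by
      rw [mul_comm, Complex.norm_exp_ofReal_mul_I]
    rw [e1, one_mul, norm_mul, Complex.norm_I, one_mul, Complex.norm_real, Real.norm_eq_abs,
      abs_mul, zero_sub, Real.rpow_neg_one]
    have : 0 < ρ⁻¹ := inv_pos.2 hρ0
    calc _ ≤ |k| * (4 * R₀ * ρ⁻¹) := by gcongr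
      _ ≤ _ := by nlinarith [abs_nonneg k]

end Rays

variable {d : ℕ} {r R₀ ρ₂ m : ℝ} {K : ℕ} {a : EuclideanSpace ℝ (Fin d) → ℂ}

theorem apply_eq_sum_single (L : EuclideanSpace ℝ (Fin d) →L[ℝ] ℂ)
    (w : EuclideanSpace ℝ (Fin d)) :
    L w = ∑ i, (w i : ℂ) * L (EuclideanSpace.single i 1) := by
  have h : w = ∑ i, w i • EuclideanSpace.single i (1 : ℝ) := by
    ext j
    simp [Finset.sum_apply, Pi.single_apply]
  conv_lhs => rw [h]
  simp [map_sum]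

theorem IsSymbol.exists_norm_fderiv_le (ha : IsSymbol r (K + 1) m a) :
    ∃ C : ℝ, 0 ≤ C ∧ ∀ y, r < ‖y‖ → ‖fderiv ℝ a y‖ ≤ C * ‖y‖ ^ (m - 1) := by
  choose C hC using fun i : Fin d => (ha.dirDeriv (EuclideanSpace.single i 1)).bound
  refine ⟨∑ i, |C i|, by positivity, fun y hy => ?_⟩
  refine ContinuousLinearMap.opNorm_le_bound _ (by positivity) fun w => ?_
  rw [apply_eq_sum_single, Finset.sum_mul, Finset.sum_mul]
  refine (norm_sum_le _ _).trans (Finset.sum_le_sum fun i _ => ?_)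
  rw [norm_mul, Complex.norm_real, mul_comm]
  have h1 := hC i y hy
  have h2 : ‖w i‖ ≤ ‖w‖ := PiLp.norm_apply_le w i
  calc _ ≤ (C i * ‖y‖ ^ (m - 1)) * ‖w‖ :=
        mul_le_mul h1 h2 (norm_nonneg _) ((norm_nonneg _).trans h1)
    _ ≤ _ := by gcongr; exact le_abs_self _

theorem IsSymbol.isRaySymbol (hr : 0 < r) (hR₀ : 0 ≤ R₀) (hρ₂ : 2 * R₀ + 2 * r ≤ ρ₂)
    (ha : IsSymbol r (K + 1) m a) : IsRaySymbol R₀ ρ₂ m (fun x N ρ => a (x + ρ • N)) := by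
  obtain ⟨C, hC⟩ := ha.bound
  obtain ⟨C', hC'0, hC'⟩ := ha.exists_norm_fderiv_le
  refine ⟨|C| * 2 ^ |m| + C' * 2 ^ |m - 1|, by positivity, fun x N ρ hx hN hρ => ?_⟩
  obtain ⟨hρ0, -, h2, h3, h4⟩ := norm_ray hr hR₀ hρ₂ hx hN hρ
  refine ⟨fderiv ℝ a (x + ρ • N) N,
    (ha.differentiableAt h2).hasFDerivAt.comp_hasDerivAt ρ hasDerivAt_ray, ?_, ?_⟩
  · calc _ ≤ C * ‖x + ρ • N‖ ^ m := hC _ h2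
      _ ≤ |C| * ‖x + ρ • N‖ ^ m := by gcongr; exact le_abs_self C
      _ ≤ |C| * (2 ^ |m| * ρ ^ m) := by gcongr; exact rpow_le_of_half_le hρ0 h3 h4 m
      _ ≤ _ := by
        have : 0 ≤ C' * 2 ^ |m - 1| * ρ ^ m := by positivity
        nlinarith
  · calc _ ≤ ‖fderiv ℝ a (x + ρ • N)‖ * ‖N‖ := ContinuousLinearMap.le_opNorm _ _
      _ ≤ C' * ‖x + ρ • N‖ ^ (m - 1) := by rw [hN, mul_one]; exact hC' _ h2
      _ ≤ C' * (2 ^ |m - 1| * ρ ^ (m - 1)) := by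
        gcongr; exact rpow_le_of_half_le hρ0 h3 h4 _
      _ ≤ _ := by
        have : 0 ≤ |C| * 2 ^ |m| * ρ ^ (m - 1) := by positivity
        nlinarith

/-- The function is `⟪x, N⟫ + ρ - ‖y‖` divided by `‖y‖`. The numerator is bounded and its derivative
is `1 - radialComp N`, already known to be `O(1/ρ)`. -/
theorem isRaySymbol_radialComp_sub_one (hr : 0 < r) (hR₀ : 0 ≤ R₀)
    (hρ₂ : 2 * R₀ + 2 * r ≤ ρ₂) : IsRaySymbol (E := EuclideanSpace ℝ (Fin d)) R₀ ρ₂ (-1)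
      (fun x N ρ => ((radialComp N (x + ρ • N) - 1 : ℝ) : ℂ)) := by
  have h1 : IsRaySymbol (E := EuclideanSpace ℝ (Fin d)) R₀ ρ₂ 0
      (fun x N ρ => ((⟪x, N⟫ + ρ - ‖x + ρ • N‖ : ℝ) : ℂ)) := by
    refine ⟨4 * R₀, by positivity, fun x N ρ hx hN hρ => ?_⟩
    obtain ⟨hρ0, h1, h2, h3, -⟩ := norm_ray hr hR₀ hρ₂ hx hN hρ
    refine ⟨_, (((hasDerivAt_id ρ).const_add ⟪x, N⟫).sub
      (hasDerivAt_norm_ray (ne_zero_of_lt_norm hr h2))).ofReal_comp, ?_, ?_⟩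
    · have hxN : |⟪x, N⟫| ≤ R₀ :=
        (abs_real_inner_le_norm x N).trans (by rw [hN, mul_one]; exact hx)
      rw [Complex.norm_real, Real.norm_eq_abs, Real.rpow_zero, mul_one]
      rw [abs_le] at *
      constructor <;> linarith [hxN.1, hxN.2, h1.1, h1.2]
    · rw [Complex.norm_real, Real.norm_eq_abs, abs_sub_comm, zero_sub, Real.rpow_neg_one]
      exact abs_radialComp_ray_sub_one_le hr hR₀ hρ₂ hx hN hρ
  have h2 := (isSymbol_norm_rpow (E := EuclideanSpace ℝ (Fin d)) (K := 1) (m := -1) hr).isRaySymbol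
    hr hR₀ hρ₂
  have h3 := h1.mul (by linarith) h2
  rw [zero_add] at h3
  refine h3.congr fun x N ρ hx hN hρ => ?_
  obtain ⟨hρ0, -, h2, -⟩ := norm_ray hr hR₀ hρ₂ hx hN hρ
  have hy : ‖x + ρ • N‖ ≠ 0 := (hr.trans h2).ne'
  have hin : ⟪x + ρ • N, N⟫ = ⟪x, N⟫ + ρ := by
    rw [inner_add_left, real_inner_smul_left, real_inner_self_eq_norm_sq, hN]; ring
  rw [← Complex.ofReal_mul, radialComp, hin, Real.rpow_neg_one, div_sub_one hy, div_eq_mul_inv]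

/-- Symbol estimates hold for fixed directions, whereas `N` varies with the ray. Expanding `N` in
the standard basis gives uniformity, as its coordinates are bounded and constant along the ray. -/
theorem IsSymbol.isRaySymbol_dirDeriv (hr : 0 < r) (hR₀ : 0 ≤ R₀) (hρ₂ : 2 * R₀ + 2 * r ≤ ρ₂)
    (ha : IsSymbol r (K + 2) m a) :
    IsRaySymbol R₀ ρ₂ (m - 1) (fun x N ρ => _root_.dirDeriv N a (x + ρ • N)) := by
  have hcoord : ∀ i, IsRaySymbol (E := EuclideanSpace ℝ (Fin d)) R₀ ρ₂ 0
      (fun _ N _ => (N i : ℂ)) := by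
    intro i
    refine ⟨1, zero_le_one, fun x N ρ _ hN hρ => ⟨0, hasDerivAt_const _ _, ?_, ?_⟩⟩
    · rw [Complex.norm_real, Real.rpow_zero, mul_one, ← hN]
      exact PiLp.norm_apply_le N i
    · have : 0 < ρ := by linarith
      simp only [norm_zero]; positivity
  have hterm : ∀ i, IsRaySymbol R₀ ρ₂ (m - 1) (fun x N ρ =>
      (N i : ℂ) * _root_.dirDeriv (EuclideanSpace.single i 1) a (x + ρ • N)) := by
    intro i
    have := (hcoord i).mul (by linarith)
      ((ha.dirDeriv (EuclideanSpace.single i 1)).isRaySymbol hr hR₀ hρ₂)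
    rwa [zero_add] at this
  have hsum : ∀ s : Finset (Fin d), IsRaySymbol R₀ ρ₂ (m - 1) (fun x N ρ => ∑ i ∈ s,
      (N i : ℂ) * _root_.dirDeriv (EuclideanSpace.single i 1) a (x + ρ • N)) := by
    intro s
    classical
    induction s using Finset.induction_on with
    | empty =>
      refine ⟨0, le_rfl, fun x N ρ _ _ _ => ⟨0, ?_, by simp, by simp⟩⟩
      simpa using hasDerivAt_const ρ (0 : ℂ)
    | insert i s hi ih =>
      simp only [Finset.sum_insert hi]
      exact (hterm i).add ih
  exact (hsum Finset.univ).congr fun x N ρ _ _ _ => (apply_eq_sum_single _ N).symm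

end RaySymbols

/-! ### Decay of Kirchhoff integrals of outgoing data. -/

section RayBounds

open Filter Topology MeasureTheory
open Real (sin cos)

section Uniform

variable {E : Type*} [NormedAddCommGroup E] [InnerProductSpace ℝ E]
  {R₀ ρ₂ m : ℝ} {q : E → E → ℝ → ℂ}

theorem exists_norm_le_of_norm_le_rpow [FiniteDimensional ℝ E] (hρ₂ : 0 < ρ₂) (hm : m ≤ 0)
    (hq : Continuous fun p : E × E × ℝ => q p.1 p.2.1 p.2.2) {C : ℝ} (hC : 0 ≤ C)
    (h : ∀ x N ρ, ‖x‖ ≤ R₀ → ‖N‖ = 1 → ρ₂ < ρ → ‖q x N ρ‖ ≤ C * ρ ^ m) :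
    ∃ B : ℝ, 0 ≤ B ∧ ∀ x N ρ, ‖x‖ ≤ R₀ → ‖N‖ = 1 → 0 ≤ ρ → ‖q x N ρ‖ ≤ B * (1 + ρ) ^ m := by
  obtain ⟨D, hD⟩ := ((isCompact_closedBall (0 : E) R₀).prod ((isCompact_sphere (0 : E) 1).prod
    (isCompact_Icc (a := (0 : ℝ)) (b := ρ₂)))).exists_bound_of_continuousOn hq.continuousOn
  -- `κ` is the smallest value of `ρ / (1 + ρ)` for `ρ ≥ ρ₂`; below `ρ₂` the bound comes from
  -- compactness.
  set κ := ρ₂ / (1 + ρ₂) with hκ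
  have hκ0 : 0 < κ := by positivity
  have h1 : 0 < (1 + ρ₂) ^ m := by positivity
  refine ⟨|D| * ((1 + ρ₂) ^ m)⁻¹ + C * κ ^ m, by positivity, fun x N ρ hx hN hρ => ?_⟩
  have h3 : 0 < (1 + ρ) ^ m := by positivity
  rcases le_or_gt ρ ρ₂ with hle | hlt
  · have h2 := hD (x, N, ρ) ⟨by simpa using hx, by simpa using hN, hρ, hle⟩
    have h4 : (1 + ρ₂) ^ m ≤ (1 + ρ) ^ m :=
      Real.rpow_le_rpow_of_nonpos (by linarith) (by linarith) hm
    calc ‖q x N ρ‖ ≤ |D| := h2.trans (le_abs_self D)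
      _ = |D| * ((1 + ρ₂) ^ m)⁻¹ * (1 + ρ₂) ^ m := by field_simp
      _ ≤ |D| * ((1 + ρ₂) ^ m)⁻¹ * (1 + ρ) ^ m := by gcongr
      _ ≤ _ := by
        have : 0 ≤ C * κ ^ m * (1 + ρ) ^ m := by positivity
        nlinarith
  · have h5 : κ * (1 + ρ) ≤ ρ := by
      rw [hκ, div_mul_eq_mul_div, div_le_iff₀ (by positivity)]
      nlinarith
    calc ‖q x N ρ‖ ≤ C * ρ ^ m := h x N ρ hx hN hlt
      _ ≤ C * (κ * (1 + ρ)) ^ m := by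
        gcongr C * ?_
        exact Real.rpow_le_rpow_of_nonpos (by positivity) h5 hm
      _ = C * κ ^ m * (1 + ρ) ^ m := by rw [Real.mul_rpow hκ0.le (by positivity), mul_assoc]
      _ ≤ _ := by
        have : 0 ≤ |D| * ((1 + ρ₂) ^ m)⁻¹ * (1 + ρ) ^ m := by positivity
        nlinarith

theorem hasDerivAt_ray_section (hq : ContDiff ℝ 1 fun p : E × E × ℝ => q p.1 p.2.1 p.2.2)
    (x N : E) (ρ : ℝ) : HasDerivAt (q x N)
      (fderiv ℝ (fun p : E × E × ℝ => q p.1 p.2.1 p.2.2) (x, N, ρ) (0, 0, 1)) ρ := by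
  have h := ((hq.differentiable one_ne_zero) (x, N, ρ)).hasFDerivAt
  have h' : HasDerivAt (fun s : ℝ => (x, N, s)) (0, 0, 1) ρ :=
    (hasDerivAt_const ρ x).prodMk ((hasDerivAt_const ρ N).prodMk (hasDerivAt_id ρ))
  exact h.comp_hasDerivAt ρ h'

theorem continuous_deriv_ray_section (hq : ContDiff ℝ 1 fun p : E × E × ℝ => q p.1 p.2.1 p.2.2) :
    Continuous fun p : E × E × ℝ => deriv (q p.1 p.2.1) p.2.2 := by
  simp only [fun x N ρ => (hasDerivAt_ray_section hq x N ρ).deriv]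
  exact (hq.continuous_fderiv one_ne_zero).clm_apply continuous_const

theorem IsRaySymbol.exists_bound [FiniteDimensional ℝ E] (hρ₂ : 0 < ρ₂) (hm : m ≤ 0)
    (hq : ContDiff ℝ 1 fun p : E × E × ℝ => q p.1 p.2.1 p.2.2) (hs : IsRaySymbol R₀ ρ₂ m q) :
    ∃ B : ℝ, 0 ≤ B ∧ ∀ x N ρ, ‖x‖ ≤ R₀ → ‖N‖ = 1 → 0 ≤ ρ →
      ‖q x N ρ‖ ≤ B * (1 + ρ) ^ m ∧ ‖deriv (q x N) ρ‖ ≤ B * (1 + ρ) ^ (m - 1) := by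
  obtain ⟨C, hC, H⟩ := hs
  obtain ⟨B, hB, h1⟩ := exists_norm_le_of_norm_le_rpow hρ₂ hm hq.continuous hC
    fun x N ρ hx hN hρ => (H x N ρ hx hN hρ).choose_spec.2.1
  obtain ⟨B', hB', h2⟩ := exists_norm_le_of_norm_le_rpow (m := m - 1)
    (q := fun x N => deriv (q x N)) hρ₂ (by linarith)
    (continuous_deriv_ray_section hq) hC fun x N ρ hx hN hρ => by
      obtain ⟨τ', h1, -, h3⟩ := H x N ρ hx hN hρ
      rwa [h1.deriv]
  refine ⟨B + B', by positivity, fun x N ρ hx hN hρ => ⟨(h1 x N ρ hx hN hρ).trans ?_,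
    (h2 x N ρ hx hN hρ).trans ?_⟩⟩ <;> gcongr <;> linarith

end Uniform

variable {d : ℕ} {r k c m R₀ : ℝ} {f g : EuclideanSpace ℝ (Fin d) → ℂ}

/-- The values of `f` on a ray, without the oscillating factor. -/
noncomputable def rayProfile (k : ℝ) (f : EuclideanSpace ℝ (Fin d) → ℂ)
    (x N : EuclideanSpace ℝ (Fin d)) (ρ : ℝ) : ℂ :=
  Complex.exp (-(Complex.I * ((k * ρ : ℝ) : ℂ))) * f (x + ρ • N)

/-- The outgoing derivative `ρ (∂_N f + c⁻¹ g)` on a ray, without the oscillating factor. -/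
noncomputable def rayDefect (k c : ℝ) (f g : EuclideanSpace ℝ (Fin d) → ℂ)
    (x N : EuclideanSpace ℝ (Fin d)) (ρ : ℝ) : ℂ :=
  Complex.exp (-(Complex.I * ((k * ρ : ℝ) : ℂ))) *
    ((ρ : ℂ) * (dirDeriv N f (x + ρ • N) + c⁻¹ * g (x + ρ • N)))

theorem contDiff_ray : ContDiff ℝ 1 fun p : EuclideanSpace ℝ (Fin d) ×
    EuclideanSpace ℝ (Fin d) × ℝ => p.1 + p.2.2 • p.2.1 := by fun_prop

theorem contDiff_ray_factor (k : ℝ) : ContDiff ℝ 1 fun p : EuclideanSpace ℝ (Fin d) ×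
    EuclideanSpace ℝ (Fin d) × ℝ => Complex.exp (-(Complex.I * ((k * p.2.2 : ℝ) : ℂ))) := by
  refine ContDiff.cexp (contDiff_const.mul (Complex.ofRealCLM.contDiff.comp
    (contDiff_const.mul (contDiff_snd.comp contDiff_snd)))).neg

theorem contDiff_rayProfile (hf : ContDiff ℝ 1 f) : ContDiff ℝ 1 fun p : EuclideanSpace ℝ (Fin d) ×
    EuclideanSpace ℝ (Fin d) × ℝ => rayProfile k f p.1 p.2.1 p.2.2 :=
  (contDiff_ray_factor k).mul (hf.comp contDiff_ray)

theorem contDiff_rayDefect (hf : ContDiff ℝ 2 f) (hg : ContDiff ℝ 1 g) :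
    ContDiff ℝ 1 fun p : EuclideanSpace ℝ (Fin d) ×
      EuclideanSpace ℝ (Fin d) × ℝ => rayDefect k c f g p.1 p.2.1 p.2.2 := by
  refine (contDiff_ray_factor k).mul (ContDiff.mul ?_ (ContDiff.add ?_ ?_))
  · exact Complex.ofRealCLM.contDiff.comp (by fun_prop)
  · exact ((hf.fderiv_right (m := 1) (by norm_num)).comp contDiff_ray).clm_apply (by fun_prop)
  · exact contDiff_const.mul (hg.comp contDiff_ray)

theorem exp_neg_mul_exp (k ρ s : ℝ) : Complex.exp (-(Complex.I * ((k * ρ : ℝ) : ℂ)))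
    * Complex.exp (Complex.I * ((k * s : ℝ) : ℂ))
      = Complex.exp (Complex.I * ((k * (s - ρ) : ℝ) : ℂ)) := by
  rw [← Complex.exp_add]
  congr 1
  push_cast
  ring

/-- Up to the phase, `∂_N f + c⁻¹ g` is `(i k a + c⁻¹ b) + i k (radialComp N - 1) a + ∂_N a`. Each
summand has order `m - 1`: by the outgoing condition, by the geometry of rays, and by the symbol
estimates. The factor `ρ` in `rayDefect` brings the order back to `m`. -/
theorem IsOutgoing.exists_ray_bound (hr : 0 < r) (hR₀ : 0 ≤ R₀) (hm : m ≤ 0)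
    (hf : ContDiff ℝ 2 f) (hg : ContDiff ℝ 1 g) (hfg : IsOutgoing r k c m 1 f g) :
    ∃ B : ℝ, 0 ≤ B ∧ ∀ x N ρ, ‖x‖ ≤ R₀ → ‖N‖ = 1 → 0 ≤ ρ →
      (‖rayProfile k f x N ρ‖ ≤ B * (1 + ρ) ^ m ∧
        ‖deriv (rayProfile k f x N) ρ‖ ≤ B * (1 + ρ) ^ (m - 1)) ∧
      ‖rayDefect k c f g x N ρ‖ ≤ B * (1 + ρ) ^ m ∧
        ‖deriv (rayDefect k c f g x N) ρ‖ ≤ B * (1 + ρ) ^ (m - 1) := by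
  obtain ⟨a, b, hfa, hgb, ha, hb, hab⟩ := hfg
  set ρ₂ := 2 * R₀ + 2 * r with hρ₂
  have hρ₂0 : 0 < ρ₂ := by positivity
  have hph := isRaySymbol_phase (E := EuclideanSpace ℝ (Fin d)) hr hR₀ hρ₂.ge k
  have s1 : IsRaySymbol R₀ ρ₂ m (rayProfile k f) := by
    have := hph.mul hρ₂0.le (ha.isRaySymbol hr hR₀ hρ₂.ge)
    rw [zero_add] at this
    refine this.congr fun x N ρ hx hN hρ => ?_
    obtain ⟨-, -, h2, -⟩ := norm_ray hr hR₀ hρ₂.ge hx hN hρ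
    rw [rayProfile, hfa _ h2, ← mul_assoc, exp_neg_mul_exp]
  have s2 : IsRaySymbol R₀ ρ₂ m (rayDefect k c f g) := by
    have t1 := hab.isRaySymbol hr hR₀ hρ₂.ge
    have t2 := (isRaySymbol_radialComp_sub_one hr hR₀ hρ₂.ge).mul hρ₂0.le
      ((ha.const_mul hr (Complex.I * k)).isRaySymbol hr hR₀ hρ₂.ge)
    rw [neg_add_eq_sub] at t2
    have t3 := IsSymbol.isRaySymbol_dirDeriv (K := 0) hr hR₀ hρ₂.ge ha
    have t4 := hph.mul hρ₂0.le ((isRaySymbol_id hρ₂0.le).mul hρ₂0.le ((t1.add t2).add t3))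
    rw [zero_add, add_sub_cancel] at t4
    refine t4.congr fun x N ρ hx hN hρ => ?_
    obtain ⟨-, -, h2, -⟩ := norm_ray hr hR₀ hρ₂.ge hx hN hρ
    rw [rayDefect, dirDeriv_eq_exp_mul hr hfa ha N _ h2, hgb _ h2, ← exp_neg_mul_exp]
    push_cast
    ring
  obtain ⟨B, hB, h1⟩ := s1.exists_bound hρ₂0 hm (contDiff_rayProfile (hf.of_le (by norm_num)))
  obtain ⟨B', hB', h2⟩ := s2.exists_bound hρ₂0 hm (contDiff_rayDefect hf hg)
  refine ⟨B + B', by positivity, fun x N ρ hx hN hρ => ?_⟩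
  obtain ⟨a1, a2⟩ := h1 x N ρ hx hN hρ
  obtain ⟨b1, b2⟩ := h2 x N ρ hx hN hρ
  refine ⟨⟨a1.trans ?_, a2.trans ?_⟩, b1.trans ?_, b2.trans ?_⟩ <;> gcongr <;> linarith

/-- In the plane `p'` and `u` enter with the weights `R sin² φ` and `R sin φ`, so they do not cancel
directly. The difference `R sin φ (sin φ - 1) p'` is exchanged, by parts, for a term in `p` without
the factor `R`. -/
theorem integral_meridian_eq {p p' u : ℝ → ℂ} (hp : ∀ ρ, HasDerivAt p (p' ρ) ρ)
    (hp' : Continuous p') (hu : Continuous u) (R : ℝ) :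
    ∫ φ in 0..Real.pi, (sin φ : ℂ) * (p (R * sin φ) + ((R * sin φ : ℝ) : ℂ) * p' (R * sin φ)
        + (R : ℂ) * u (R * sin φ))
      = (∫ φ in 0..Real.pi, (((1 + sin φ)⁻¹ : ℝ) : ℂ) * p (R * sin φ))
        + ∫ φ in 0..Real.pi, ((R * sin φ : ℝ) : ℂ) * (p' (R * sin φ) + u (R * sin φ)) := by
  have hpc : Continuous p := continuous_iff_continuousAt.2 fun ρ => (hp ρ).continuousAt
  have hpos : ∀ φ ∈ Icc 0 Real.pi, (0 : ℝ) < 1 + sin φ := fun φ hφ => by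
    linarith [Real.sin_nonneg_of_mem_Icc hφ]
  have hsin : Continuous fun φ : ℝ => R * sin φ := continuous_const.mul Real.continuous_sin
  have hps := hpc.comp hsin
  have hps' := hp'.comp hsin
  have hus := hu.comp hsin
  have hw : ContinuousOn (fun φ => (((1 + sin φ)⁻¹ : ℝ) : ℂ)) (Icc 0 Real.pi) :=
    Complex.continuous_ofReal.comp_continuousOn
      ((continuous_const.add Real.continuous_sin).continuousOn.inv₀ fun φ hφ => (hpos φ hφ).ne')
  have hi1 : IntervalIntegrable (fun φ => (((1 + sin φ)⁻¹ : ℝ) : ℂ) * p (R * sin φ)) volume 0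
      Real.pi := by
    refine ContinuousOn.intervalIntegrable ?_
    rw [uIcc_of_le Real.pi_pos.le]
    exact hw.mul hps.continuousOn
  have hi2 : IntervalIntegrable (fun φ => ((R * sin φ : ℝ) : ℂ) *
      (p' (R * sin φ) + u (R * sin φ))) volume 0 Real.pi :=
    ((Complex.continuous_ofReal.comp hsin).mul (hps'.add hus)).intervalIntegrable _ _
  have hi3 : IntervalIntegrable (fun φ => (sin φ : ℂ) * (p (R * sin φ)
      + ((R * sin φ : ℝ) : ℂ) * p' (R * sin φ) + (R : ℂ) * u (R * sin φ))) volume 0 Real.pi :=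
    ((Complex.continuous_ofReal.comp Real.continuous_sin).mul ((hps.add
      ((Complex.continuous_ofReal.comp hsin).mul hps')).add
        (continuous_const.mul hus))).intervalIntegrable _ _
  -- The multiplier `-sin φ cos φ / (1 + sin φ)` vanishes at both poles, has derivative `sin φ - 1 /
  -- (1 + sin φ)`, and its product with `R cos φ` is `R sin φ (sin φ - 1)`.
  have hd : ∀ φ ∈ uIcc 0 Real.pi, HasDerivAt
      (fun φ => ((-(sin φ * cos φ) / (1 + sin φ) : ℝ) : ℂ) * p (R * sin φ))
      ((sin φ : ℂ) * (p (R * sin φ) + ((R * sin φ : ℝ) : ℂ) * p' (R * sin φ)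
        + (R : ℂ) * u (R * sin φ)) - ((((1 + sin φ)⁻¹ : ℝ) : ℂ) * p (R * sin φ)
          + ((R * sin φ : ℝ) : ℂ) * (p' (R * sin φ) + u (R * sin φ)))) φ := by
    intro φ hφ
    rw [uIcc_of_le Real.pi_pos.le] at hφ
    have h0 := (hpos φ hφ).ne'
    have d1 : HasDerivAt (fun φ => -(sin φ * cos φ) / (1 + sin φ))
        (sin φ - (1 + sin φ)⁻¹) φ := by
      refine (((Real.hasDerivAt_sin φ).mul (Real.hasDerivAt_cos φ)).neg.div
        ((Real.hasDerivAt_sin φ).const_add 1) h0).congr_deriv ?_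
      simp only [Pi.neg_apply, Pi.mul_apply]
      have hc := Real.cos_sq' φ
      field_simp
      linear_combination (-1 : ℝ) * hc
    have d2 : HasDerivAt (fun φ => p (R * sin φ)) ((R * cos φ : ℝ) • p' (R * sin φ)) φ :=
      (hp (R * sin φ)).scomp φ ((Real.hasDerivAt_sin φ).const_mul R)
    refine (d1.ofReal_comp.mul d2).congr_deriv ?_
    have h3 : -(sin φ * cos φ) / (1 + sin φ) * (R * cos φ) = R * sin φ * (sin φ - 1) := by
      have hc := Real.cos_sq' φ
      field_simp
      linear_combination (-(R * sin φ)) * hc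
    have h4 : ((-(sin φ * cos φ) / (1 + sin φ) : ℝ) : ℂ) * ((R * cos φ : ℝ) • p' (R * sin φ))
        = ((R * sin φ * (sin φ - 1) : ℝ) : ℂ) * p' (R * sin φ) := by
      rw [Complex.real_smul, ← mul_assoc, ← Complex.ofReal_mul, h3]
    rw [h4]
    push_cast
    ring
  have hint := intervalIntegral.integral_eq_sub_of_hasDerivAt hd (hi3.sub (hi1.add hi2))
  rw [intervalIntegral.integral_sub hi3 (hi1.add hi2), intervalIntegral.integral_add hi1 hi2] at hint
  simp only [Real.sin_pi, Real.sin_zero, zero_mul, neg_zero, zero_div, Complex.ofReal_zero,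
    sub_zero] at hint
  exact sub_eq_zero.1 hint

/-- Both integrals of `integral_meridian_eq` are oscillatory with phase `k R sin φ`: the first has
amplitude `q` and weight `1 / (1 + sin φ)`, the second amplitude `s` and weight `1`. -/
theorem norm_integral_meridian_le {k R B : ℝ} (hk : 0 < k) (hR : 1 ≤ R) {p p' u : ℝ → ℂ}
    {q s : ℝ → ℂ} (hp : ∀ ρ, HasDerivAt p (p' ρ) ρ) (hp' : Continuous p') (hu : Continuous u)
    (hq : ∀ ρ, q ρ = Complex.exp (-(Complex.I * ((k * ρ : ℝ) : ℂ))) * p ρ)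
    (hs : ∀ ρ, s ρ = Complex.exp (-(Complex.I * ((k * ρ : ℝ) : ℂ))) * ((ρ : ℂ) * (p' ρ + u ρ)))
    (hq1 : ContDiff ℝ 1 q) (hs1 : ContDiff ℝ 1 s)
    (h1 : ∀ ρ, 0 ≤ ρ → ‖q ρ‖ ≤ B * (1 + ρ) ^ (-(1 / 2) : ℝ))
    (h2 : ∀ ρ, 0 ≤ ρ → ‖deriv q ρ‖ ≤ B * (1 + ρ) ^ (-(3 / 2) : ℝ))
    (h3 : ∀ ρ, 0 ≤ ρ → ‖s ρ‖ ≤ B * (1 + ρ) ^ (-(1 / 2) : ℝ))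
    (h4 : ∀ ρ, 0 ≤ ρ → ‖deriv s ρ‖ ≤ B * (1 + ρ) ^ (-(3 / 2) : ℝ)) :
    ‖∫ φ in 0..Real.pi, (sin φ : ℂ) * (p (R * sin φ) + ((R * sin φ : ℝ) : ℂ) * p' (R * sin φ)
        + (R : ℂ) * u (R * sin φ))‖ ≤ 120 * (1 + k⁻¹) * B / R := by
  have hpos : ∀ φ ∈ Icc 0 Real.pi, (0 : ℝ) < 1 + sin φ := fun φ hφ => by
    linarith [Real.sin_nonneg_of_mem_Icc hφ]
  have hcancel : ∀ ρ : ℝ, ∀ z : ℂ, Complex.exp (Complex.I * ((k * ρ : ℝ) : ℂ)) *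
      (Complex.exp (-(Complex.I * ((k * ρ : ℝ) : ℂ))) * z) = z := fun ρ z => by
    rw [← mul_assoc, ← Complex.exp_add, add_neg_cancel, Complex.exp_zero, one_mul]
  have b1 := norm_integral_oscillatory_le hk hR
    (fun ρ => (hq1.differentiable one_ne_zero ρ).hasDerivAt) (hq1.continuous_deriv le_rfl) h1 h2
    (w := fun φ => (1 + sin φ)⁻¹) (w' := fun φ => -cos φ / (1 + sin φ) ^ 2)
    (fun φ hφ => ((Real.hasDerivAt_sin φ).const_add 1).fun_inv (hpos φ hφ).ne')
    ((Real.continuous_cos.neg.continuousOn).div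
      ((continuous_const.add Real.continuous_sin).pow 2).continuousOn
      fun φ hφ => pow_ne_zero 2 (hpos φ hφ).ne')
    (fun φ hφ => by
      rw [abs_of_pos (inv_pos.2 (hpos φ hφ))]
      exact inv_le_one_of_one_le₀ (by linarith [Real.sin_nonneg_of_mem_Icc hφ]))
    (fun φ hφ => by
      have := Real.sin_nonneg_of_mem_Icc hφ
      rw [abs_div, abs_neg, abs_of_pos (pow_pos (hpos φ hφ) 2)]
      exact div_le_one_of_le₀ ((Real.abs_cos_le_one φ).trans (by nlinarith)) (by positivity))
  have b2 := norm_integral_oscillatory_le hk hR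
    (fun ρ => (hs1.differentiable one_ne_zero ρ).hasDerivAt) (hs1.continuous_deriv le_rfl) h3 h4
    (w := fun _ => 1) (w' := fun _ => 0) (fun φ _ => hasDerivAt_const _ _) continuousOn_const
    (fun φ _ => by simp) (fun φ _ => by simp)
  simp only [hq, hcancel] at b1
  simp only [hs, hcancel, Complex.ofReal_one, one_mul] at b2
  rw [integral_meridian_eq hp hp' hu]
  calc _ ≤ 60 * (1 + k⁻¹) * B / R + 60 * (1 + k⁻¹) * B / R := (norm_add_le _ _).trans (add_le_add b1 b2)
    _ = _ := by ring

theorem spherePoint_stdFrame_two (θ φ : ℝ) :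
    spherePoint (stdFrame 2) θ φ = sin φ • equatorPoint (stdFrame 2) θ := by
  have h : stdFrame 2 2 = 0 := by simp [stdFrame]
  rw [spherePoint, equatorPoint, h, smul_zero, add_zero, smul_add, smul_smul, smul_smul]

theorem norm_equatorPoint_stdFrame_two (θ : ℝ) : ‖equatorPoint (stdFrame 2) θ‖ = 1 := by
  rw [EuclideanSpace.norm_eq, Real.sqrt_eq_one, Fin.sum_univ_two]
  simp [equatorPoint, stdFrame]

theorem norm_spherePoint_stdFrame_three (θ φ : ℝ) : ‖spherePoint (stdFrame 3) θ φ‖ = 1 := by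
  rw [EuclideanSpace.norm_eq, Real.sqrt_eq_one, Fin.sum_univ_three]
  simp only [spherePoint, stdFrame, Real.norm_eq_abs, sq_abs]
  simp
  linear_combination sin φ ^ 2 * Real.sin_sq_add_cos_sq θ + Real.sin_sq_add_cos_sq φ

theorem norm_kirchhoff_le {E : Type*} [NormedAddCommGroup E] [NormedSpace ℝ E] {e : Fin 3 → E}
    {c t M : ℝ} {f g : E → ℂ} {x : E} (h : ∀ θ, ‖∫ φ in 0..Real.pi, sin φ •
      (f (x + (c * t) • spherePoint e θ φ)
        + (c * t) • fderiv ℝ f (x + (c * t) • spherePoint e θ φ) (spherePoint e θ φ)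
        + t • g (x + (c * t) • spherePoint e θ φ))‖ ≤ M) :
    ‖kirchhoff e c f g x t‖ ≤ M := by
  have hM := (norm_nonneg _).trans (h 0)
  have hpi := Real.pi_pos
  rw [kirchhoff, norm_smul, Real.norm_of_nonneg (by positivity)]
  have := intervalIntegral.norm_integral_le_of_norm_le_const (a := 0) (b := 2 * Real.pi)
    fun θ _ => h θ
  rw [sub_zero, abs_of_pos (by positivity)] at this
  calc _ ≤ (4 * Real.pi)⁻¹ * (M * (2 * Real.pi)) := by gcongr
    _ = M / 2 := by field_simp; ring
    _ ≤ M := by linarith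

theorem norm_rayProfile (x N : EuclideanSpace ℝ (Fin d)) (ρ : ℝ) :
    ‖rayProfile k f x N ρ‖ = ‖f (x + ρ • N)‖ := by
  rw [rayProfile, norm_mul, ← mul_neg, ← Complex.ofReal_neg, mul_comm Complex.I,
    Complex.norm_exp_ofReal_mul_I, one_mul]

theorem norm_rayDefect (x N : EuclideanSpace ℝ (Fin d)) (ρ : ℝ) :
    ‖rayDefect k c f g x N ρ‖
      = ‖(ρ : ℂ) * (dirDeriv N f (x + ρ • N) + c⁻¹ * g (x + ρ • N))‖ := by
  rw [rayDefect, norm_mul, ← mul_neg, ← Complex.ofReal_neg, mul_comm Complex.I,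
    Complex.norm_exp_ofReal_mul_I, one_mul]

theorem IsOutgoing.exists_norm_kirchhoff_two_le {f g : EuclideanSpace ℝ (Fin 2) → ℂ} (hr : 0 < r)
    (hk : 0 < k) (hc : 0 < c) (hR₀ : 0 ≤ R₀) (hf : ContDiff ℝ 2 f) (hg : ContDiff ℝ 1 g)
    (hfg : IsOutgoing r k c (-(1 / 2)) 1 f g) :
    ∃ C : ℝ, 0 ≤ C ∧ ∀ x t, ‖x‖ ≤ R₀ → 1 ≤ c * t →
      ‖kirchhoff (stdFrame 2) c f g x t‖ ≤ C / (c * t) := by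
  obtain ⟨B, hB, H⟩ := hfg.exists_ray_bound hr hR₀ (by norm_num) hf hg
  refine ⟨120 * (1 + k⁻¹) * B, by positivity, fun x t hx ht => norm_kirchhoff_le fun θ => ?_⟩
  set N := equatorPoint (stdFrame 2) θ with hN
  have hN1 : ‖N‖ = 1 := norm_equatorPoint_stdFrame_two θ
  set R := c * t with hR
  have e1 : (-(1 / 2) : ℝ) - 1 = -(3 / 2) := by norm_num
  have hray : Continuous fun ρ : ℝ => x + ρ • N := by fun_prop
  have hmap : ContDiff ℝ 1 fun ρ : ℝ => (x, N, ρ) := by fun_prop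
  have key := norm_integral_meridian_le hk ht (p := fun ρ => f (x + ρ • N))
    (p' := fun ρ => _root_.dirDeriv N f (x + ρ • N)) (u := fun ρ => c⁻¹ * g (x + ρ • N))
    (q := rayProfile k f x N) (s := rayDefect k c f g x N) (B := B)
    (fun ρ => (hf.differentiable two_ne_zero _).hasFDerivAt.comp_hasDerivAt ρ hasDerivAt_ray)
    (((hf.continuous_fderiv two_ne_zero).comp hray).clm_apply continuous_const)
    (continuous_const.mul (hg.continuous.comp hray)) (fun ρ => rfl) (fun ρ => rfl)
    ((contDiff_rayProfile (hf.of_le (by norm_num))).comp hmap) ((contDiff_rayDefect hf hg).comp hmap)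
    (fun ρ hρ => (H x N ρ hx hN1 hρ).1.1) (fun ρ hρ => e1 ▸ (H x N ρ hx hN1 hρ).1.2)
    (fun ρ hρ => (H x N ρ hx hN1 hρ).2.1) (fun ρ hρ => e1 ▸ (H x N ρ hx hN1 hρ).2.2)
  -- For fixed `θ` the meridian projects to the planar ray of direction `N`, at distance `R sin φ`
  -- from `x`.
  refine (congrArg norm (intervalIntegral.integral_congr fun φ _ => ?_)).trans_le key
  have hc' : (c : ℂ) ≠ 0 := by exact_mod_cast hc.ne'
  simp only [spherePoint_stdFrame_two, ← hN, smul_smul, map_smul, _root_.dirDeriv, Complex.real_smul]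
  rw [hR]
  push_cast
  field_simp

/-- The integrand lives on the sphere of radius `ct` itself, where `rayProfile` and `rayDefect` are
both `O(1/t)`. No oscillation is needed. -/
theorem IsOutgoing.exists_norm_kirchhoff_three_le {f g : EuclideanSpace ℝ (Fin 3) → ℂ} (hr : 0 < r)
    (hc : 0 < c) (hR₀ : 0 ≤ R₀) (hf : ContDiff ℝ 2 f) (hg : ContDiff ℝ 1 g)
    (hfg : IsOutgoing r k c (-1) 1 f g) :
    ∃ C : ℝ, 0 ≤ C ∧ ∀ x t, ‖x‖ ≤ R₀ → 1 ≤ c * t →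
      ‖kirchhoff (stdFrame 3) c f g x t‖ ≤ C / (c * t) := by
  obtain ⟨B, hB, H⟩ := hfg.exists_ray_bound hr hR₀ (by norm_num) hf hg
  have hpi := Real.pi_pos
  refine ⟨2 * B * Real.pi, by positivity, fun x t hx ht => norm_kirchhoff_le fun θ => ?_⟩
  have hR : 0 < c * t := by linarith
  have hint : ∀ φ ∈ uIoc 0 Real.pi, ‖sin φ • (f (x + (c * t) • spherePoint (stdFrame 3) θ φ)
        + (c * t) • fderiv ℝ f (x + (c * t) • spherePoint (stdFrame 3) θ φ)
          (spherePoint (stdFrame 3) θ φ)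
        + t • g (x + (c * t) • spherePoint (stdFrame 3) θ φ))‖ ≤ 2 * B / (c * t) := by
    intro φ _
    obtain ⟨⟨h1, -⟩, h2, -⟩ := H x _ (c * t) hx (norm_spherePoint_stdFrame_three θ φ) hR.le
    rw [norm_rayProfile] at h1
    rw [norm_rayDefect] at h2
    generalize spherePoint (stdFrame 3) θ φ = P at *
    have hc' : (c : ℂ) ≠ 0 := by exact_mod_cast hc.ne'
    have h3 : f (x + (c * t) • P) + (c * t) • fderiv ℝ f (x + (c * t) • P) P
        + t • g (x + (c * t) • P) = f (x + (c * t) • P)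
          + ((c * t : ℝ) : ℂ) * (_root_.dirDeriv P f (x + (c * t) • P) + c⁻¹ * g (x + (c * t) • P)) := by
      simp only [_root_.dirDeriv, Complex.real_smul]
      push_cast
      field_simp
      ring
    rw [norm_smul, Real.norm_eq_abs, h3]
    have h4 : (1 + c * t) ^ (-1 : ℝ) ≤ (c * t)⁻¹ := by
      rw [Real.rpow_neg_one]
      gcongr
      linarith
    calc _ ≤ 1 * (B * (1 + c * t) ^ (-1 : ℝ) + B * (1 + c * t) ^ (-1 : ℝ)) := by
          gcongr
          · exact Real.abs_sin_le_one φ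
          · exact (norm_add_le _ _).trans (add_le_add h1 h2)
      _ ≤ 1 * (B * (c * t)⁻¹ + B * (c * t)⁻¹) := by gcongr
      _ = _ := by rw [div_eq_mul_inv]; ring
  refine (intervalIntegral.norm_integral_le_of_norm_le_const hint).trans_eq ?_
  rw [sub_zero, abs_of_pos hpi]
  ring

/-- The wave with outgoing initial values of order `-(n / 2)` in the space `ℝ ^ (n + 1)` decays
like `t⁻¹` on bounded sets. -/
theorem IsOutgoing.exists_norm_kirchhoff_le {n : ℕ} (hn : n = 1 ∨ n = 2)
    {f g : EuclideanSpace ℝ (Fin (n + 1)) → ℂ} (hr : 0 < r) (hk : 0 < k) (hc : 0 < c)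
    (hR₀ : 0 ≤ R₀) (hf : ContDiff ℝ 2 f) (hg : ContDiff ℝ 1 g)
    (hfg : IsOutgoing r k c (-(n / 2)) 1 f g) :
    ∃ C : ℝ, 0 ≤ C ∧ ∀ x t, ‖x‖ ≤ R₀ → 0 ≤ t →
      ‖kirchhoff (stdFrame (n + 1)) c f g x t‖ ≤ C / (1 + t ^ 2) ^ (1 / 2 : ℝ) := by
  obtain ⟨C, hC, H⟩ : ∃ C : ℝ, 0 ≤ C ∧ ∀ x t, ‖x‖ ≤ R₀ → 1 ≤ c * t →
      ‖kirchhoff (stdFrame (n + 1)) c f g x t‖ ≤ C / (c * t) := by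
    rcases hn with rfl | rfl
    · refine IsOutgoing.exists_norm_kirchhoff_two_le hr hk hc hR₀ hf hg ?_
      convert hfg using 1
      norm_num
    · refine IsOutgoing.exists_norm_kirchhoff_three_le hr hc hR₀ hf hg (k := k) (r := r) ?_
      convert hfg using 1
      norm_num
  have hcont := (contDiff_kirchhoff (k := 1) (stdFrame (n + 1)) c
    (by exact_mod_cast hf) (by exact_mod_cast hg)).continuous
  obtain ⟨D, hD⟩ := ((isCompact_closedBall (0 : EuclideanSpace ℝ (Fin (n + 1))) R₀).prod
    (isCompact_Icc (a := (0 : ℝ)) (b := c⁻¹))).exists_bound_of_continuousOn hcont.continuousOn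
  refine ⟨|D| * (1 + c⁻¹) + C * ((1 + c) / c), by positivity, fun x t hx ht => ?_⟩
  have hs0 : 0 < (1 + t ^ 2) ^ (1 / 2 : ℝ) := by positivity
  have hs : (1 + t ^ 2) ^ (1 / 2 : ℝ) ≤ 1 + t := by
    rw [← Real.sqrt_eq_rpow, Real.sqrt_le_left (by linarith)]
    nlinarith
  rw [le_div_iff₀ hs0]
  have q1 : 0 ≤ |D| * (1 + c⁻¹) := by positivity
  have q2 : 0 ≤ C * ((1 + c) / c) := by positivity
  rcases le_total (c * t) 1 with h | h
  · have ht1 : t ≤ c⁻¹ := by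
      rw [← one_div, le_div_iff₀ hc]; linarith
    have h1 := hD (x, t) ⟨by simpa using hx, ht, ht1⟩
    calc _ ≤ |D| * (1 + c⁻¹) := by
          gcongr
          · exact h1.trans (le_abs_self D)
          · linarith
      _ ≤ _ := by linarith
  · have hct : 0 < c * t := by linarith
    calc _ ≤ C / (c * t) * (1 + t) := by
          gcongr
          exact H x t hx h
      _ ≤ C * ((1 + c) / c) := by
          rw [div_mul_eq_mul_div, mul_div_assoc]
          gcongr C * ?_
          rw [div_le_div_iff₀ hct hc]
          nlinarith
      _ ≤ _ := by linarith

end RayBounds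

/-! ### Assembly of the estimate. -/

section Decay

open Filter Topology

theorem exists_sum_norm_le {d : ℕ} {R₀ : ℝ} {s : ℝ → ℝ}
    {F : Fin d → EuclideanSpace ℝ (Fin d) → ℝ → ℂ}
    (h : ∀ i, ∃ C : ℝ, 0 ≤ C ∧ ∀ x t, ‖x‖ ≤ R₀ → 0 ≤ t → ‖F i x t‖ ≤ C / s t) :
    ∃ C : ℝ, 0 ≤ C ∧ ∀ x t, ‖x‖ ≤ R₀ → 0 ≤ t → ∑ i, ‖F i x t‖ ≤ C / s t := by
  choose C hC H using h
  refine ⟨∑ i, C i, Finset.sum_nonneg fun i _ => hC i, fun x t hx ht => ?_⟩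
  rw [Finset.sum_div]
  exact Finset.sum_le_sum fun i _ => H i x t hx ht

theorem contDiffOn_neg_mul_derivWithin {A : ℝ → ℂ} (hA : ContDiffOn ℝ 5 A (Ici 0)) (c : ℝ) :
    ContDiffOn ℝ 4 (fun ρ => -(c : ℂ) * derivWithin A (Ici 0) ρ) (Ici 0) :=
  contDiffOn_const.mul (hA.derivWithin (uniqueDiffOn_Ici 0) (by norm_num))

theorem derivWithin_eq_zero_of_eq_zero {A : ℝ → ℂ} {r : ℝ} (hA : ∀ ρ ∈ Icc 0 r, A ρ = 0) {ρ : ℝ}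
    (hρ : ρ ∈ Ico 0 r) : derivWithin A (Ici 0) ρ = 0 := by
  have h : A =ᶠ[𝓝[Ici 0] ρ] fun _ => 0 := by
    filter_upwards [self_mem_nhdsWithin, nhdsWithin_le_nhds (gt_mem_nhds hρ.2)] with s hs hs'
    exact hA s ⟨hs, hs'.le⟩
  rw [h.derivWithin_eq (hA ρ ⟨hρ.1, hρ.2.le⟩)]
  simp

end Decay

theorem lemma2p4
    -- the space dimension is `d = n + 1`, so `d = 2` or `d = 3`, and `(d - 1)/2 = n/2`
    (n : ℕ) (hn : n = 1 ∨ n = 2)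
    (c₀ ω ρ₀ ρ₁ : ℝ) (hc₀ : 0 < c₀) (hω : 0 < ω) (hρ₀ : 0 < ρ₀) (hρ₁ : ρ₀ < ρ₁)
    (Ω : Set (EuclideanSpace ℝ (Fin (n + 1))))
    (hΩ : ∃ ε : ℝ, 0 < ε ∧ Ω ⊆ ball 0 (ρ₀ - ε))
    (A : ℝ → ℂ) (Y : EuclideanSpace ℝ (Fin (n + 1)) → ℂ)
    (hA : ContDiffOn ℝ 5 A (Ici 0)) (hY : IsCkOnSphere 5 Y)
    (hA₀ : ∀ ρ ∈ Icc 0 ρ₀, A ρ = 0)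
    (hA₁ : ∀ ρ, ρ₁ < ρ →
      A ρ = Complex.exp (Complex.I * ((ω / c₀ * ρ : ℝ) : ℂ)) / ((ρ ^ ((n : ℝ) / 2) : ℝ) : ℂ)) :
    ∃ C : ℝ, 0 < C ∧
      ∀ v : EuclideanSpace ℝ (Fin (n + 1)) → ℝ → ℂ,
        IsWaveSolution c₀ (polarProduct A Y)
          (polarProduct (fun ρ => -(c₀ : ℂ) * derivWithin A (Ici 0) ρ) Y) v →
        IsCkSpaceTime 3 v ∧
        ∀ x ∈ Ω, ∀ t : ℝ, 0 ≤ t → derivSum v x t ≤ C / (1 + t ^ 2) ^ (1 / 2 : ℝ) := by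
  obtain ⟨ε, hε, hΩ⟩ := hΩ
  set f := polarProduct A Y with hf
  set g := polarProduct (fun ρ => -(c₀ : ℂ) * derivWithin A (Ici 0) ρ) Y with hg
  obtain ⟨h, hh⟩ : ∃ h, h = fun y => c₀ ^ 2 • sumSndDeriv f y := ⟨_, rfl⟩
  have hr : 0 < ρ₁ := hρ₀.trans hρ₁
  have hk : 0 < ω / c₀ := div_pos hω hc₀
  have hf5 : ContDiff ℝ 5 f :=
    contDiff_polarProduct (k := 5) hY hA hρ₀ fun ρ hρ => hA₀ ρ ⟨hρ.1, hρ.2.le⟩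
  have hg4 : ContDiff ℝ 4 g :=
    contDiff_polarProduct (k := 4) (hY.of_le (by norm_num)) (contDiffOn_neg_mul_derivWithin hA c₀)
      hρ₀ fun ρ hρ => by rw [derivWithin_eq_zero_of_eq_zero hA₀ hρ, mul_zero]
  have hh3 : ContDiff ℝ 3 h := by
    rw [hh]
    exact (contDiff_sumSndDeriv (l := 3) hf5 (by norm_num)).const_smul (c₀ ^ 2)
  -- The count starts at `4` because `Y` is `C⁵`. The passage to `(g, h)` costs one and two space
  -- derivatives cost two more, which leaves exactly the `1` that the decay estimate requires.
  have hfg : IsOutgoing ρ₁ (ω / c₀) c₀ (-((n : ℝ) / 2)) 4 f g := isOutgoing_polarProduct hr hc₀ hY hA₁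
  have hgh : IsOutgoing ρ₁ (ω / c₀) c₀ (-((n : ℝ) / 2)) 3 g h := hfg.next hr hc₀ hh
  have decay : ∀ {K : ℕ} {p q : EuclideanSpace ℝ (Fin (n + 1)) → ℂ}, ContDiff ℝ 2 p →
      ContDiff ℝ 1 q → IsOutgoing ρ₁ (ω / c₀) c₀ (-((n : ℝ) / 2)) (K + 1) p q →
      ∃ C : ℝ, 0 ≤ C ∧ ∀ x t, ‖x‖ ≤ ρ₀ → 0 ≤ t →
        ‖kirchhoff (stdFrame (n + 1)) c₀ p q x t‖ ≤ C / (1 + t ^ 2) ^ (1 / 2 : ℝ) :=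
    fun hp hq hpq => (hpq.of_le (by omega)).exists_norm_kirchhoff_le hn hr hk hc₀ hρ₀.le hp hq
  have hf4 : ∀ i, ContDiff ℝ 4 (dirDeriv (EuclideanSpace.single i 1) f) := fun i =>
    hf5.dirDeriv (by norm_num) _
  have hg3 : ∀ i, ContDiff ℝ 3 (dirDeriv (EuclideanSpace.single i 1) g) := fun i =>
    hg4.dirDeriv (by norm_num) _
  have hh2 : ∀ i, ContDiff ℝ 2 (dirDeriv (EuclideanSpace.single i 1) h) := fun i =>
    hh3.dirDeriv (by norm_num) _
  have hfg' := fun i => hfg.dirDeriv hr (EuclideanSpace.single i 1)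
  have hgh' := fun i => hgh.dirDeriv hr (EuclideanSpace.single i 1)
  obtain ⟨C₁, hC₁, H₁⟩ := decay (hf5.of_le (by norm_num)) (hg4.of_le (by norm_num)) hfg
  obtain ⟨C₂, hC₂, H₂⟩ := exists_sum_norm_le fun i =>
    decay ((hf4 i).of_le (by norm_num)) ((hg3 i).of_le (by norm_num)) (hfg' i)
  obtain ⟨C₃, hC₃, H₃⟩ := decay (hg4.of_le (by norm_num)) (hh3.of_le (by norm_num)) hgh
  obtain ⟨C₄, hC₄, H₄⟩ := exists_sum_norm_le fun i =>
    decay ((hf4 i).dirDeriv (l := 2) (by norm_num) (EuclideanSpace.single i 1))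
      ((hg3 i).dirDeriv (l := 1) (by norm_num) (EuclideanSpace.single i 1))
      ((hfg' i).dirDeriv hr (EuclideanSpace.single i 1))
  obtain ⟨C₅, hC₅, H₅⟩ := exists_sum_norm_le fun i =>
    decay ((hg3 i).of_le (by norm_num)) ((hh2 i).of_le (by norm_num)) (hgh' i)
  obtain ⟨C₆, hC₆, H₆⟩ := exists_sum_norm_le fun i =>
    decay ((hg3 i).dirDeriv (l := 2) (by norm_num) (EuclideanSpace.single i 1))
      ((hh2 i).dirDeriv (l := 1) (by norm_num) (EuclideanSpace.single i 1))
      ((hgh' i).dirDeriv hr (EuclideanSpace.single i 1))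
  -- The summand `1` only makes the constant strictly positive.
  refine ⟨C₁ + C₂ + C₃ + C₄ + C₅ + C₆ + 1, by positivity, fun v hv => ?_⟩
  obtain ⟨hv3, hle⟩ := hv.derivSum_le (by omega) hc₀ hf5 hg4 hh
  refine ⟨hv3, fun x hx t ht => (hle x t ht).trans ?_⟩
  have hxn : ‖x‖ ≤ ρ₀ := by
    have := mem_ball_zero_iff.1 (hΩ hx)
    linarith
  have h0 : 0 ≤ 1 / (1 + t ^ 2) ^ (1 / 2 : ℝ) := by positivity
  simp only [add_div]
  linarith [H₁ x t hxn ht, H₂ x t hxn ht, H₃ x t hxn ht, H₄ x t hxn ht, H₅ x t hxn ht,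
    H₆ x t hxn ht]
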